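/- **Setting.** Let $d\ge 2$ and let $\Gamma$ be a periodic graph in $\mathbf R^d$: a lattice $\mathbf L=\{\mathbf v(n)=\sum_k n_k\mathbf v_k : n\in\mathbf Z^d\}$ ($\mathbf v_1,\dots,\mathbf v_d$ a basis of $\mathbf R^d$), vertex set $\bigcup_{j=1}^{\mathsf s}(p_j+\mathbf L)$ with $p_i-p_j\notin\mathbf L$ for $i\ne j$, and an $\mathbf L$-invariant edge set such that every vertex has the same finite degree $d_g$. Functions on the vertices are written $u(n)=(u_1(n),\dots,u_{\mathsf s}(n))\in\mathbf C^{\mathsf s}$, $n\in\mathbf Z^d$, with $u_j(n)$ the value at $p_j+\mathbf v(n)$. The Laplacian is $(\Delta_\Gamma u)_j(n)=\frac1{d_g}\sum_{b\sim p_j+\mathbf v(n)}u_{i(b)}(n(b))$, where $b=p_{i(b)}+\mathbf v(n(b))$. Let $\mathcal L(e^{-i\eta})$, $\eta\in\mathbf T^d=\mathbf R^d/(2\pi\mathbf Z)^d$, be the Hermitian $\mathsf s\times\mathsf s$ matrix symbol of $-\Delta_\Gamma$, i.e. $\mathcal L(e^{-i\eta})_{ji}=-\frac1{d_g}\sum_{m\,:\,p_j\sim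 p_i+\mathbf v(m)}e^{im\cdot\eta}$. Fix $E_0,\nu\in\mathbf R$. Let $\lambda_1(\eta)\le\dots\le\lambda_{\mathsf s}(\eta)$ be the eigenvalues of $\mathcal L(e^{-i\eta})-E_0$. For $h>0$ put $\Delta_{disc,h}=h^{-\nu}(\Delta_\Gamma+E_0)$, $\mathcal L_h(e^{-ih\eta})=h^{-\nu}(\mathcal L(e^{-ih\eta})-E_0)$, with eigenvalues $\lambda_{k,h}(\eta)=h^{-\nu}\lambda_k(h\eta)$. Fix an index $j$, an open set $\mathcal K_0\subset\mathbf T^d$ and a point $d_1$; put $d_h=d_1/h$, and let $\mathcal K=\mathcal K_0-d_1$, viewed as a subset of $[-\pi,\pi]^d$ (all representatives in this cube being included). **Assumptions.** - (B-1) $\lambda_j\ge0$ on $\mathcal K_0$, and $d_1$ is the unique point of $\mathcal K_0$ at which $\lambda_j=0$. - Either (B-2-1): there are $\epsilon_1,\epsilon_2>0$ with $\lambda_{j-1}<-\epsilon_1<\lambda_j<\epsilon_2<\lambda_{j+1}$ on $\overline{\mathcal K_0}$; or (B-2-2): $j\ge 2$, $\lambda_{j-1}=-\lambda_j$ on $\mathcal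 K_0$ and there are $\epsilon_1,\epsilon_2>0$ with $\lambda_{j-2}<-\epsilon_1<\lambda_{j-1}\le\lambda_j<\epsilon_2<\lambda_{j+1}$ on $\overline{\mathcal K_0}$ (conditions on nonexistent eigenvalues $\lambda_0,\lambda_{\mathsf s+1}$ are void). - (B-3) As $h\to0^+$, $P_h(\xi):=\lambda_{j,h}(\xi+d_h)$ converges with all its derivatives to $P(\xi)$ for every $\xi\ne0$, where the real function $P$ is $C^\infty$ on $\mathbf R^d\setminus\{0\}$ and homogeneous of degree $\gamma>0$, and there is $C>0$ with $CP(\xi)\le P_h(\xi)\le C^{-1}P(\xi)$ for $0\ne\xi\in\mathcal K/h$ and all small $h>0$. - (B-4) Let $\Pi_h(\xi)$ be the eigenprojection of $\mathcal L_h(e^{-ih(\xi+d_h)})$ for the eigenvalue $\lambda_{j,h}(\xi+d_h)$ in case (B-2-1), and for the pair $\lambda_{j-1,h}(\xi+d_h),\lambda_{j,h}(\xi+d_h)$ in case (B-2-2). As $h\to0^+$, $\Pi_h(\xi)$ converges with all its derivatives to a projection $\Pi_0(\xi)$ for every $\xi\ne0$ ($\Pi_0$ smooth on $\mathbf R^d\setminus\{0\}$).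 Let $\epsilon_d>0$ with $\{|\xi|<2\epsilon_d\}\subset\mathcal K$, and let $\chi_d\in C_0^\infty(\mathbf R^d)$ be real-valued with $\chi_d=1$ for $|\xi|<\epsilon_d$ and $\chi_d=0$ for $|\xi|>2\epsilon_d$. Let $m>[d/2]+1$, $s>d+1$, and let $f\in H^{m,s}(\mathbf R^d;\mathbf C^{\mathsf s})$ (i.e. $(1+|x|^2)^{s/2}f\in H^m$; $f$ is taken to be continuous), $f_h(n)=f(hn)$. Let $z\in\mathbf C\setminus\mathbf R$. With $(\mathcal G_ha)(n)=e^{ihn\cdot d_h}a(n)$, for all small $h>0$ let $u_h=u_h(\cdot,z)\in\ell^2(\mathbf Z^d;\mathbf C^{\mathsf s})$ solve $$(-\mathcal G_h^*\Delta_{disc,h}\mathcal G_h-z)u_h=f_h\quad\text{on }\mathbf Z^d.$$ Put $\widehat u_h(\xi)=(\tfrac h{2\pi})^{d/2}\sum_n e^{-ihn\cdot\xi}u_h(n)$ and $$\widetilde v_h(x,z)=\Big(\frac h{2\pi}\Big)^{d/2}\int_{[-\pi/h,\pi/h]^d}e^{ix\cdot\xi}\chi_d(h\xi)\Pi_h(\xi)\widehat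 u_h(\xi)\,d\xi .$$ Let $\mathcal F_{cont}f(\xi)=(2\pi)^{-d/2}\int e^{-ix\cdot\xi}f(x)\,dx$ and let $P(D_x)$ be the Fourier multiplier with symbol $P(\xi)$. **Theorem.** There is $\widetilde v(\cdot,z)\in L^2(\mathbf R^d;\mathbf C^{\mathsf s})$ such that, as $h\to0^+$, $\widetilde v_h(\cdot,z)\to\widetilde v(\cdot,z)$ strongly in $L^{2,-s'}(\mathbf R^d)$ (the space with norm $\|(1+|x|^2)^{-s'/2}v\|_{L^2}$) for every $0<s'<1/2$, and also locally uniformly on $\mathbf R^d$. In case (B-2-1), $\widetilde v$ is the unique $L^2$-solution of $(P(D_x)-z)\widetilde v=g$, where $g\in L^2$ is given by $\mathcal F_{cont}g=\Pi_0\,\mathcal F_{cont}f$. In case (B-2-2), let $\Pi_h^{(\pm)}(\xi)$ be the eigenprojection of $\mathcal L_h(e^{-ih(\xi+d_h)})$ for $\lambda_{j,h}(\xi+d_h)=P_h(\xi)$ (sign $+$) and for $\lambda_{j-1,h}(\xi+d_h)$ (which is $-P_h(\xi)$ on $\mathcal K/h$; sign $-$). The limits $\Pi_0^{(\pm)}(\xi)=\lim_{h\to0^+}\Pi_h^{(\pm)}(\xi)$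 exist for $\xi\ne0$, $\Pi_0^{(+)}+\Pi_0^{(-)}=\Pi_0$ there, and $\widetilde v=\widetilde v^{(+)}+\widetilde v^{(-)}$, where $\widetilde v^{(\pm)}$ is the unique $L^2$-solution of $$(\pm P(D_x)-z)\widetilde v^{(\pm)}=g^{(\pm)},\qquad \mathcal F_{cont}g^{(\pm)}=\Pi_0^{(\pm)}\mathcal F_{cont}f,\quad g^{(\pm)}\in L^2 .$$ -/

import Mathlib

open Filter Topology MeasureTheory
open scoped ENNReal ContDiff FourierTransform

noncomputable section

namespace ContinuumLimit

/-- The space `ℝ^d` with its Euclidean norm. -/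
abbrev Space (d : ℕ) := EuclideanSpace ℝ (Fin d)

/-- The space `ℂ^s` in which lattice functions (one component for each vertex of a fundamental
cell) take their values. -/
abbrev Fiber (s : ℕ) := EuclideanSpace ℂ (Fin s)

/-- The `d`-dimensional torus `𝐓^d = ℝ^d / (2πℤ)^d`. -/
abbrev Torus (d : ℕ) := Fin d → Real.Angle

/-- The projection `ℝ^d → 𝐓^d`. -/
def toTorus {d : ℕ} (η : Space d) : Torus d := fun k => (η k : Real.Angle)

/-- The phase `n·ξ` for `n ∈ ℤ^d`, `ξ ∈ ℝ^d`. -/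
def phase {d : ℕ} (n : Fin d → ℤ) (ξ : Space d) : ℝ := ∑ k, (n k : ℝ) * ξ k

/-- `⟨x⟩ = (1 + |x|²)^{1/2}`. -/
def bracket {d : ℕ} (x : Space d) : ℝ := Real.sqrt (1 + ‖x‖ ^ 2)

/-! ### Periodic graphs and their Laplacians -/

/-- The lattice vector `𝐯(n) = ∑ₖ nₖ 𝐯ₖ`. -/
def latticeVec {d : ℕ} (b : Module.Basis (Fin d) ℝ (Space d)) (n : Fin d → ℤ) : Space d :=
  ∑ k, (n k : ℝ) • b k

/-- A periodic graph in `ℝ^d`: a lattice with basis `𝐯₁, …, 𝐯_d`, points `p₁, …, p_s` that are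
pairwise inequivalent modulo the lattice, vertex set `⋃ⱼ (pⱼ + 𝐋)`, and an edge set invariant under
lattice translations, such that every vertex has the same finite number `degree` of adjacent
vertices. -/
structure PeriodicGraph (d s : ℕ) where
  basis : Module.Basis (Fin d) ℝ (Space d)
  point : Fin s → Space d
  point_sub_ne : ∀ i j, i ≠ j → ∀ n : Fin d → ℤ, point i - point j ≠ latticeVec basis n
  edges : Set (Space d × Space d)
  edges_subset : ∀ e ∈ edges,
    (∃ j n, e.1 = point j + latticeVec basis n) ∧ ∃ j n, e.2 = point j + latticeVec basis n
  edges_periodic : ∀ (m : Fin d → ℤ), ∀ e ∈ edges,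
    (e.1 + latticeVec basis m, e.2 + latticeVec basis m) ∈ edges
  degree : ℕ
  finite_adjacent : ∀ (j : Fin s) (n : Fin d → ℤ),
    {b | (point j + latticeVec basis n, b) ∈ edges ∨
      (b, point j + latticeVec basis n) ∈ edges}.Finite
  ncard_adjacent : ∀ (j : Fin s) (n : Fin d → ℤ),
    {b | (point j + latticeVec basis n, b) ∈ edges ∨
      (b, point j + latticeVec basis n) ∈ edges}.ncard = degree

namespace PeriodicGraph

variable {d s : ℕ} (G : PeriodicGraph d s)

/-- The vertex `pⱼ + 𝐯(n)`; every vertex has exactly one such description. -/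
def vertex (j : Fin s) (n : Fin d → ℤ) : Space d := G.point j + latticeVec G.basis n

/-- Two points are adjacent if they are the two end points of an edge. -/
def Adj (a b : Space d) : Prop := (a, b) ∈ G.edges ∨ (b, a) ∈ G.edges

/-- The graph Laplacian, the mean over adjacent vertices:
`(Δ u)ⱼ(n) = (1 / deg) ∑_{b ∼ pⱼ + 𝐯(n)} u_{i(b)}(n(b))`, where a function on the vertices is
written `u(n) = (u₁(n), …, u_s(n))`. The graph of mesh size `h` is obtained by scaling all
vertices and edges by `h`; in the coordinates `n ∈ ℤ^d` its Laplacian is this same operator. -/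
def laplacian (u : (Fin d → ℤ) → Fiber s) : (Fin d → ℤ) → Fiber s := fun n =>
  WithLp.toLp 2 fun j =>
    (1 / (G.degree : ℂ)) *
      ∑ᶠ q ∈ {q : Fin s × (Fin d → ℤ) | G.Adj (G.vertex j n) (G.vertex q.1 q.2)}, u q.2 q.1

/-- The symbol `𝓛(e^{-iη}, e^{iη})` of `-Δ`. -/
def symbol (η : Space d) : Matrix (Fin s) (Fin s) ℂ := Matrix.of fun j i =>
  -(1 / (G.degree : ℂ)) *
    ∑ᶠ m ∈ {m : Fin d → ℤ | G.Adj (G.vertex j 0) (G.vertex i m)},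
      Complex.exp (Complex.I * (phase m η : ℂ))

lemma vertex_add (j : Fin s) (n m : Fin d → ℤ) :
    G.vertex j n + latticeVec G.basis m = G.vertex j (n + m) := by
  simp [vertex, latticeVec, add_smul, Finset.sum_add_distrib, add_assoc]

lemma adj_symm {a b : Space d} (h : G.Adj a b) : G.Adj b a := Or.symm h

lemma adj_translate {i j : Fin s} {n n' : Fin d → ℤ} (m : Fin d → ℤ)
    (h : G.Adj (G.vertex i n) (G.vertex j n')) :
    G.Adj (G.vertex i (n + m)) (G.vertex j (n' + m)) := by
  rw [← vertex_add, ← vertex_add]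
  exact h.imp (G.edges_periodic m _) (G.edges_periodic m _)

lemma adj_neg {i j : Fin s} {m : Fin d → ℤ} (h : G.Adj (G.vertex i 0) (G.vertex j m)) :
    G.Adj (G.vertex j 0) (G.vertex i (-m)) := by
  have := G.adj_symm (G.adj_translate (-m) h)
  simpa using this

lemma symbol_isHermitian (η : Space d) : (G.symbol η).IsHermitian := by
  ext j i
  simp only [symbol, Matrix.conjTranspose_apply, Matrix.of_apply, star_mul', star_neg]
  congr 1
  · simp
  · have h1 : ∀ S : Set (Fin d → ℤ), ∀ g : (Fin d → ℤ) → ℂ,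
        star (∑ᶠ m ∈ S, g m) = ∑ᶠ m ∈ S, star (g m) := by
      intro S g
      rw [finsum_mem_def, finsum_mem_def]
      refine ((starAddEquiv : ℂ ≃+ ℂ).map_finsum _).trans ?_
      refine finsum_congr fun m => ?_
      by_cases hm : m ∈ S <;> simp [hm]
    rw [h1]
    refine finsum_mem_eq_of_bijOn (fun m => -m) ⟨?_, neg_injective.injOn, ?_⟩ ?_
    · intro m hm
      exact G.adj_neg hm
    · intro m hm
      exact ⟨-m, G.adj_neg hm, neg_neg m⟩
    · intro m _
      rw [Complex.star_def, ← Complex.exp_conj]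
      simp [phase]

/-- `λ₁ ≤ ⋯ ≤ λ_s`: the eigenvalues of a Hermitian matrix in increasing order, repeated according
to multiplicity. -/
def increasingEigenvalue {A : Matrix (Fin s) (Fin s) ℂ} (hA : A.IsHermitian) (k : Fin s) : ℝ :=
  hA.eigenvalues₀ (Fin.rev (Fin.cast (Fintype.card_fin s).symm k))

/-- The matrix `𝓛(e^{-iη}, e^{iη}) - E₀ I`, where `E₀` is the reference energy. -/
def shiftedSymbol (E₀ : ℝ) (η : Space d) : Matrix (Fin s) (Fin s) ℂ := G.symbol η - (E₀ : ℂ) • 1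

lemma shiftedSymbol_isHermitian (E₀ : ℝ) (η : Space d) : (G.shiftedSymbol E₀ η).IsHermitian := by
  refine (G.symbol_isHermitian η).sub ?_
  ext i j
  by_cases h : i = j
  · subst h; simp
  · simp [h, Ne.symm h]

/-- The root `λ_k(e^{-iη})`: the `k`-th eigenvalue of `𝓛(e^{-iη}, e^{iη}) - E₀ I`. -/
def root (E₀ : ℝ) (k : Fin s) (η : Space d) : ℝ :=
  increasingEigenvalue (G.shiftedSymbol_isHermitian E₀ η) k

/-- The symbol `𝓛_h(e^{-ihη}, e^{ihη}) = h^{-ν} (𝓛(e^{-ihη}, e^{ihη}) - E₀ I)` of `-Δ_{disc,h}`. -/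
def scaledSymbol (E₀ ν h : ℝ) (η : Space d) : Matrix (Fin s) (Fin s) ℂ :=
  ((h ^ (-ν) : ℝ) : ℂ) • G.shiftedSymbol E₀ (h • η)

lemma scaledSymbol_isHermitian (E₀ ν h : ℝ) (η : Space d) :
    (G.scaledSymbol E₀ ν h η).IsHermitian := by
  have := G.shiftedSymbol_isHermitian E₀ (h • η)
  unfold scaledSymbol
  rw [Matrix.IsHermitian, Matrix.conjTranspose_smul, this.eq]
  simp

/-- The characteristic root `λ_{k,h}(η)` of `𝓛_h(e^{-ihη}, e^{ihη})`. -/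
def scaledRoot (E₀ ν : ℝ) (k : Fin s) (h : ℝ) (η : Space d) : ℝ :=
  increasingEigenvalue (G.scaledSymbol_isHermitian E₀ ν h η) k

/-- The eigenprojection of `𝓛_h(e^{-ihη}, e^{ihη})` associated with the group of eigenvalues
`λ_{k,h}(η)`, `k ∈ J`: the orthogonal projection onto the sum of their eigenspaces. -/
def eigenprojection (E₀ ν : ℝ) (J : Finset (Fin s)) (h : ℝ) (η : Space d) :
    Fiber s →L[ℂ] Fiber s :=
  (⨆ k ∈ J, Module.End.eigenspace (Matrix.toEuclideanLin (G.scaledSymbol E₀ ν h η))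
    (G.scaledRoot E₀ ν k h η : ℂ)).starProjection

/-- `P_h(ξ) = λ_{j,h}(ξ + d_h)`, where `d_h = d₁ / h`. -/
def localRoot (E₀ ν : ℝ) (j : Fin s) (d₁ : Space d) (h : ℝ) (ξ : Space d) : ℝ :=
  G.scaledRoot E₀ ν j h (ξ + h⁻¹ • d₁)

/-- `Π_h(ξ)`: the eigenprojection of `𝓛_h` at `ξ + d_h` for the eigenvalues with index in `J`. -/
def localProj (E₀ ν : ℝ) (J : Finset (Fin s)) (d₁ : Space d) (h : ℝ) (ξ : Space d) :
    Fiber s →L[ℂ] Fiber s :=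
  G.eigenprojection E₀ ν J h (ξ + h⁻¹ • d₁)

/-- `Δ_{disc,h} = h^{-ν} (Δ + E₀)`. -/
def discLaplacian (E₀ ν h : ℝ) (u : (Fin d → ℤ) → Fiber s) : (Fin d → ℤ) → Fiber s := fun n =>
  ((h ^ (-ν) : ℝ) : ℂ) • (G.laplacian u n + (E₀ : ℂ) • u n)

/-- The set `𝓚 = 𝓚₀ - d₁`, for a subset `𝓚₀` of the torus, as a subset of the fundamental cell
`[-π, π]^d`. -/
def cellSet (K₀ : Set (Torus d)) (d₁ : Space d) : Set (Space d) :=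
  {ξ | (∀ k, |ξ k| ≤ Real.pi) ∧ toTorus (ξ + d₁) ∈ K₀}

/-- Condition (B-1): `λⱼ ≥ 0` on `𝓚₀`, and `d₁` is the unique zero of `λⱼ` in `𝓚₀`. -/
def CondB1 (E₀ : ℝ) (j : Fin s) (K₀ : Set (Torus d)) (d₁ : Space d) : Prop :=
  (∀ η, toTorus η ∈ K₀ → 0 ≤ G.root E₀ j η) ∧
  toTorus d₁ ∈ K₀ ∧ G.root E₀ j d₁ = 0 ∧
  ∀ η, toTorus η ∈ K₀ → G.root E₀ j η = 0 → toTorus η = toTorus d₁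

/-- Condition (B-2-1): on the closure of `𝓚₀`, `λⱼ` is simple and uniformly isolated from the other
eigenvalues. -/
def CondB21 (E₀ : ℝ) (j : Fin s) (K₀ : Set (Torus d)) : Prop :=
  ∃ ε₁ > 0, ∃ ε₂ > 0, ∀ η, toTorus η ∈ closure K₀ →
    (∀ k < j, G.root E₀ k η < -ε₁) ∧ -ε₁ < G.root E₀ j η ∧ G.root E₀ j η < ε₂ ∧
    ∀ k > j, ε₂ < G.root E₀ k η

/-- Condition (B-2-2), to be used with `i = j - 1`: `λ_{j-1} = -λⱼ` on `𝓚₀`, and on the closure of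
`𝓚₀` this pair is uniformly isolated from the other eigenvalues. -/
def CondB22 (E₀ : ℝ) (i j : Fin s) (K₀ : Set (Torus d)) : Prop :=
  (∀ η, toTorus η ∈ K₀ → G.root E₀ i η = -G.root E₀ j η) ∧
  ∃ ε₁ > 0, ∃ ε₂ > 0, ∀ η, toTorus η ∈ closure K₀ →
    (∀ k < i, G.root E₀ k η < -ε₁) ∧ -ε₁ < G.root E₀ i η ∧ G.root E₀ i η ≤ G.root E₀ j η ∧
    G.root E₀ j η < ε₂ ∧ ∀ k > j, ε₂ < G.root E₀ k η

/-- Condition (B-3): `P_h(ξ) → P(ξ)` with all derivatives for `ξ ≠ 0`, where `P` is smooth off the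
origin and homogeneous of degree `γ > 0`, and `P_h` is comparable to `P` on `𝓚/h` uniformly in
small `h`. -/
def CondB3 (E₀ ν : ℝ) (j : Fin s) (K₀ : Set (Torus d)) (d₁ : Space d) (P : Space d → ℝ)
    (γ : ℝ) : Prop :=
  0 < γ ∧ ContDiffOn ℝ ∞ P {0}ᶜ ∧
  (∀ ξ ≠ 0, ∀ t : ℝ, 0 < t → P (t • ξ) = t ^ γ * P ξ) ∧
  (∀ ξ ≠ 0, ∀ k : ℕ, Tendsto (fun h => iteratedFDeriv ℝ k (G.localRoot E₀ ν j d₁ h) ξ)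
    (𝓝[>] 0) (𝓝 (iteratedFDeriv ℝ k P ξ))) ∧
  ∃ C > 0, ∃ h₀ > 0, ∀ h ∈ Set.Ioo (0 : ℝ) h₀, ∀ ξ ≠ 0, h • ξ ∈ cellSet K₀ d₁ →
    C * P ξ ≤ G.localRoot E₀ ν j d₁ h ξ ∧ G.localRoot E₀ ν j d₁ h ξ ≤ C⁻¹ * P ξ

/-- Condition (B-4): `Π_h(ξ) → Π₀(ξ)` with all derivatives for `ξ ≠ 0`, where `Π₀` is written `Pr₀`
(each `Π₀(ξ)`, `ξ ≠ 0`, is then an orthogonal projection, being a limit of such). -/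
def CondB4 (E₀ ν : ℝ) (J : Finset (Fin s)) (d₁ : Space d)
    (Pr₀ : Space d → Fiber s →L[ℂ] Fiber s) : Prop :=
  ContDiffOn ℝ ∞ Pr₀ {0}ᶜ ∧
  ∀ ξ ≠ 0, ∀ k : ℕ, Tendsto (fun h => iteratedFDeriv ℝ k (G.localProj E₀ ν J d₁ h) ξ)
    (𝓝[>] 0) (𝓝 (iteratedFDeriv ℝ k Pr₀ ξ))

end PeriodicGraph

/-! ### Fourier transforms and function spaces -/

section Fourier

variable {d s : ℕ}

/-- `(𝓕_cont f)(ξ) = (2π)^{-d/2} ∫ e^{-ix·ξ} f(x) dx`, for integrable `f`. -/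
def fourierCont (f : Space d → Fiber s) (ξ : Space d) : Fiber s :=
  (((2 * Real.pi) ^ (-(d : ℝ) / 2) : ℝ) : ℂ) •
    ∫ x, Complex.exp (-(Complex.I * (inner ℝ x ξ : ℂ))) • f x

/-- The same transform `𝓕_cont` on `L²(ℝ^d)`, a function defined almost everywhere. Mathlib's `𝓕`
has the kernel `e^{-2πix·ξ}`, whence the change of scale. -/
def fourierL2 (w : Lp (Fiber s) 2 (volume : Measure (Space d))) (ξ : Space d) : Fiber s :=
  (((2 * Real.pi) ^ (-(d : ℝ) / 2) : ℝ) : ℂ) •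
    (𝓕 w : Lp (Fiber s) 2 (volume : Measure (Space d))) ((2 * Real.pi)⁻¹ • ξ)

/-- `f ∈ H^{m,σ}(ℝ^d)` (for `m ≥ 0`): `⟨x⟩^σ f` is an `L²` function in the Sobolev space `H^m`. -/
def MemWeightedSobolev (m σ : ℝ) (f : Space d → Fiber s) : Prop :=
  ∃ w : Lp (Fiber s) 2 (volume : Measure (Space d)),
    (w =ᵐ[volume] fun x => ((bracket x ^ σ : ℝ) : ℂ) • f x) ∧
    TemperedDistribution.MemSobolev m 2 (Lp.toTemperedDistribution w)

/-- `f ∈ L^{2,σ}(ℝ^d)`. -/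
def MemWeightedL2 (σ : ℝ) (f : Space d → Fiber s) : Prop :=
  MemLp (fun x => ((bracket x ^ σ : ℝ) : ℂ) • f x) 2 volume

/-- The norm of `L^{2,σ}(ℝ^d)`, with values in `[0, ∞]`. -/
def weightedL2Norm (σ : ℝ) (f : Space d → Fiber s) : ℝ≥0∞ :=
  eLpNorm (fun x => ((bracket x ^ σ : ℝ) : ℂ) • f x) 2 volume

/-- The cell `𝐓^d_h = [-π/h, π/h]^d`. -/
def cell (d : ℕ) (h : ℝ) : Set (Space d) := {ξ | ∀ k, |ξ k| ≤ Real.pi / h}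

instance isFiniteMeasure_cell (h : ℝ) :
    IsFiniteMeasure ((volume : Measure (Space d)).restrict (cell d h)) := by
  refine ⟨?_⟩
  rw [Measure.restrict_apply_univ]
  refine Bornology.IsBounded.measure_lt_top ?_
  refine (Metric.isBounded_closedBall (x := (0 : Space d))
    (r := Real.sqrt (∑ _k : Fin d, (Real.pi / h) ^ 2))).subset ?_
  intro ξ hξ
  rw [mem_closedBall_zero_iff, EuclideanSpace.norm_eq]
  refine Real.sqrt_le_sqrt (Finset.sum_le_sum fun k _ => ?_)
  exact pow_le_pow_left₀ (norm_nonneg _) (hξ k) 2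

/-- The function `(h/2π)^{d/2} e^{-ihn·ξ} a` of `ξ`. -/
def mode (h : ℝ) (n : Fin d → ℤ) (a : Fiber s) (ξ : Space d) : Fiber s :=
  (((h / (2 * Real.pi)) ^ ((d : ℝ) / 2) : ℝ) : ℂ) •
    Complex.exp (-(Complex.I * (h * phase n ξ : ℝ))) • a

lemma memLp_mode (h : ℝ) (n : Fin d → ℤ) (a : Fiber s) :
    MemLp (mode h n a) 2 ((volume : Measure (Space d)).restrict (cell d h)) := by
  have hc : Continuous (mode h n a : Space d → Fiber s) := by
    unfold mode phase
    fun_prop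
  refine MemLp.of_bound hc.aestronglyMeasurable
    (‖(((h / (2 * Real.pi)) ^ ((d : ℝ) / 2) : ℝ) : ℂ)‖ * ‖a‖) (ae_of_all _ fun ξ => ?_)
  rw [mode, norm_smul, norm_smul]
  have : ‖Complex.exp (-(Complex.I * (h * phase n ξ : ℝ)))‖ = 1 := by
    rw [show -(Complex.I * ((h * phase n ξ : ℝ) : ℂ)) = ((-(h * phase n ξ) : ℝ) : ℂ) * Complex.I by
      push_cast; ring]
    exact Complex.norm_exp_ofReal_mul_I _
  rw [this, one_mul]

/-- The discrete Fourier transform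
`(𝓕_{disc,h} u)(ξ) = (h/2π)^{d/2} ∑ₙ e^{-ihn·ξ} u(n)`, the series being summed in `L²(𝐓^d_h)`; it
converges for every `u ∈ ℓ²(ℤ^d)`. -/
def discFourier (h : ℝ) (u : (Fin d → ℤ) → Fiber s) :
    Lp (Fiber s) 2 ((volume : Measure (Space d)).restrict (cell d h)) :=
  ∑' n, (memLp_mode h n (u n)).toLp (mode h n (u n))

/-- The samples `f_h(n) = f(hn)`. -/
def sample (h : ℝ) (f : Space d → Fiber s) (n : Fin d → ℤ) : Fiber s :=
  f (WithLp.toLp 2 fun k => h * (n k : ℝ))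

/-- The gauge transformation `(𝓖_h a)(n) = e^{ihn·d_h} a(n)`, with `d_h = d₁ / h`. -/
def gauge (h : ℝ) (d₁ : Space d) (a : (Fin d → ℤ) → Fiber s) (n : Fin d → ℤ) : Fiber s :=
  Complex.exp (Complex.I * (h * phase n (h⁻¹ • d₁) : ℝ)) • a n

/-- The adjoint (and inverse) `𝓖_h^*` of the gauge transformation. -/
def gaugeAdjoint (h : ℝ) (d₁ : Space d) (a : (Fin d → ℤ) → Fiber s) (n : Fin d → ℤ) : Fiber s :=
  Complex.exp (-(Complex.I * (h * phase n (h⁻¹ • d₁) : ℝ))) • a n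

/-- `u` is an `L²` solution of the gauge transformed free equation
`(-𝓖_h^* Δ_{disc,h} 𝓖_h - z) u = f_h` on `ℤ^d`. -/
def IsLatticeSolution (G : PeriodicGraph d s) (E₀ ν : ℝ) (d₁ : Space d) (z : ℂ)
    (f : Space d → Fiber s) (h : ℝ) (u : (Fin d → ℤ) → Fiber s) : Prop :=
  Memℓp u 2 ∧
  ∀ n, -gaugeAdjoint h d₁ (G.discLaplacian E₀ ν h (gauge h d₁ u)) n - z • u n = sample h f n

/-- The projected and interpolated function
`ṽ_h(x) = (h/2π)^{d/2} ∫_{𝐓^d_h} e^{ix·ξ} χ(hξ) Π_h(ξ) (𝓕_{disc,h} u)(ξ) dξ`, with `Π_h` the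
eigenprojection for the eigenvalues with index in `J`. -/
def interpolation (G : PeriodicGraph d s) (E₀ ν : ℝ) (J : Finset (Fin s)) (d₁ : Space d)
    (χ : Space d → ℝ) (h : ℝ) (u : (Fin d → ℤ) → Fiber s) (x : Space d) : Fiber s :=
  (((h / (2 * Real.pi)) ^ ((d : ℝ) / 2) : ℝ) : ℂ) •
    ∫ ξ in cell d h, Complex.exp (Complex.I * (inner ℝ x ξ : ℂ)) •
      (χ (h • ξ) : ℂ) • G.localProj E₀ ν J d₁ h ξ (discFourier h u ξ)

/-- `w ∈ L²(ℝ^d)` solves `(p(D_x) - z) w = g`, where `p(D_x)` is the Fourier multiplier with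
symbol `p`: the function `q = p(D_x) w` is in `L²(ℝ^d)` and `q - z w = g`. -/
def IsL2Solution (p : Space d → ℝ) (z : ℂ)
    (g w : Lp (Fiber s) 2 (volume : Measure (Space d))) : Prop :=
  ∃ q : Lp (Fiber s) 2 (volume : Measure (Space d)),
    (∀ᵐ ξ, fourierL2 q ξ = (p ξ : ℂ) • fourierL2 w ξ) ∧ q - z • w = g

/-- `w` is the unique `L²` solution of `(p(D_x) - z) w = g`. -/
def IsUniqueL2Solution (p : Space d → ℝ) (z : ℂ)
    (g w : Lp (Fiber s) 2 (volume : Measure (Space d))) : Prop :=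
  IsL2Solution p z g w ∧ ∀ w', IsL2Solution p z g w' → w' = w

/-- As `h → 0⁺`, `v_h → v` strongly in `L^{2,-σ}(ℝ^d)` for every `0 < σ < 1/2`, and locally
uniformly on `ℝ^d`. -/
def ConvergesTo (vh : ℝ → Space d → Fiber s) (v : Space d → Fiber s) : Prop :=
  (∀ σ ∈ Set.Ioo (0 : ℝ) (1 / 2),
    (∀ᶠ h in 𝓝[>] 0, MemWeightedL2 (-σ) (vh h)) ∧ MemWeightedL2 (-σ) v ∧
    Tendsto (fun h => weightedL2Norm (-σ) (vh h - v)) (𝓝[>] 0) (𝓝 0)) ∧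
  TendstoLocallyUniformly vh v (𝓝[>] 0)

end Fourier

end ContinuumLimit

end

open ContinuumLimit

open Filter Topology MeasureTheory
open scoped ENNReal ContDiff FourierTransform

noncomputable section

namespace ContinuumLimit

/-! ### The Fourier transform on `L¹ ∩ L²` -/

section FourierLp

variable {E F : Type*} [NormedAddCommGroup E] [InnerProductSpace ℝ E] [FiniteDimensional ℝ E]
  [MeasurableSpace E] [BorelSpace E] [NormedAddCommGroup F] [InnerProductSpace ℂ F]

/-! The limit is taken on the Fourier side, where the lattice equation becomes multiplication by a
matrix and $\widetilde v_h$ becomes an inverse Fourier integral of (bounded multiplier) ×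
(periodized data).

Data. The function $f$ is written as $\int e^{ix\cdot\xi}F(\xi)\,d\xi$ with $F$ integrable and
$(1+|\xi|)^N F\in L^2$, $N=[d/2]+1$ (`MemWeightedSobolev.exists_synthesis`). Since $\langle
x\rangle^{\sigma} f\in H^m$, this amounts to removing the weight: $\langle x\rangle^{-\sigma}$ is
the characteristic function of a Gaussian law with gamma distributed variance, so on the Fourier
side its effect is convolution with a probability measure having all moments, which preserves the
weighted $L^2$ bound. By Poisson summation (`integral_exp_periodization`) the samples $f(hn)$ are
the Fourier coefficients, on the cell $[-\pi/h,\pi/h]^d$, of the periodization of $F$ by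
$(2\pi/h)\mathbf Z^d$. The periodization differs from $F$ on the cell by something that tends to $0$
in $L^1$ and in $L^2$; the $L^2$ bound is where $2N>d$ enters.

Multipliers. Inverting the symbol (`symbolOp_discFourier_ae_eq`) identifies $\widetilde v_h$ with
the inverse Fourier integral of $1_{cell}\,\chi_d(h\xi)\,\Pi_h(\xi)\,(\mathcal L_h-z)^{-1}$ applied
to the periodization (`interpolation_eq_synthesis`). These operators are bounded uniformly, because
projections are contractions and the resolvent of a Hermitian matrix is at most $|\operatorname{Im}
z|^{-1}$, and they converge for $\xi\ne0$ to $(P-z)^{-1}\Pi_0$, or to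
$(P-z)^{-1}\Pi_0^{(+)}+(-P-z)^{-1}\Pi_0^{(-)}$. Dominated convergence
(`CellFamily.tendsto_lintegral_sub`) gives convergence of the integrands in $L^1$ and $L^2$. The
$L^1$ part yields uniform convergence, and the $L^2$ part, by Plancherel, convergence in $L^2$,
hence in every $L^{2,-s'}$ (`convergesTo_synthesis`). The limit equation is read off from its
multiplier, and uniqueness holds because $\pm P-z$ never vanishes.

The separate limits $\Pi_0^{(\pm)}$. In case (B-2-2) the two roots meet at $d_1$ and only the limit
of the sum of projections is assumed. Along a ray, $t\mapsto\mathcal L(t\xi+d_1)-E_0$ is an analytic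
curve of Hermitian matrices. Its part in the small pair of eigenspaces is
$\lambda_j(\Pi^{(+)}-\Pi^{(-)})$, whose norm is asymptotic to $t^{\nu}P(\xi)$. A polynomial in the
curve approximates this part up to $o(t^{\nu})$, and an analytic curve whose norm divided by $t^\nu$
has a positive limit must vanish to integer order exactly $\nu$ and have a leading coefficient
(`exists_tendsto_rpow_smul`, `exists_tendsto_smul_diagOp`). Hence $\Pi^{(+)}-\Pi^{(-)}$ converges,
and with the sum so does each projection. -/

lemma continuous_fourier_of_integrable {K : E → F} (hK : Integrable K) : Continuous (𝓕 K) :=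
  VectorFourier.fourierIntegral_continuous Real.continuous_fourierChar
    (by exact continuous_inner) hK

variable [CompleteSpace F]

/-- The $L^2$ transform is characterized by duality with Schwartz functions and the integral
transform satisfies the same duality by Fubini, so the two agree when tested on smooth compactly
supported functions. -/
lemma fourier_toLp_ae {K : E → F} (hK : Integrable K) (hK2 : MemLp K 2 volume) :
    (𝓕 (hK2.toLp K) : Lp F 2 (volume : Measure E)) =ᵐ[volume] 𝓕 K := by
  refine ae_eq_of_integral_contDiff_smul_eq
    ((Lp.memLp _).locallyIntegrable (by norm_num))
    (continuous_fourier_of_integrable hK).locallyIntegrable ?_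
  intro g hg hgc
  have h1 : HasCompactSupport (fun x => (g x : ℂ)) := hgc.comp_left (g := fun r : ℝ => (r : ℂ)) rfl
  have h2 : ContDiff ℝ ∞ (fun x => (g x : ℂ)) := Complex.ofRealCLM.contDiff.comp hg
  have h3 := congrArg (fun T : TemperedDistribution E F => T (h1.toSchwartzMap h2))
    (Lp.fourier_toTemperedDistribution_eq (hK2.toLp K))
  simp only [TemperedDistribution.fourier_apply, Lp.toTemperedDistribution_apply] at h3
  have h4 : ∀ x, (h1.toSchwartzMap h2) x = (g x : ℂ) := fun _ => rfl
  simp only [h4, Complex.coe_smul] at h3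
  rw [← h3]
  have h5 : ∫ x, (𝓕 (h1.toSchwartzMap h2)) x • (hK2.toLp K) x
      = ∫ x, (𝓕 (h1.toSchwartzMap h2)) x • K x := by
    refine integral_congr_ae ?_
    filter_upwards [hK2.coeFn_toLp] with x hx
    rw [hx]
  rw [h5]
  have h6 := VectorFourier.integral_fourierIntegral_smul_eq_flip (μ := (volume : Measure E))
    (ν := (volume : Measure E)) (L := innerₗ E) (e := Real.fourierChar)
    (f := fun x => (g x : ℂ)) (g := K) Real.continuous_fourierChar
    (by exact continuous_inner) ((h1.toSchwartzMap h2).integrable) hK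
  rw [flip_innerₗ] at h6
  refine Eq.trans ?_ (h6.trans ?_)
  · rw [SchwartzMap.fourier_coe]
    rfl
  · refine integral_congr_ae (ae_of_all _ fun x => ?_)
    simp only [Complex.coe_smul]
    rfl

/-- The same duality argument, with the pairing $-\langle x,\xi\rangle$, which is again symmetric.
-/
lemma fourierInv_toLp_ae {K : E → F} (hK : Integrable K) (hK2 : MemLp K 2 volume) :
    (𝓕⁻ (hK2.toLp K) : Lp F 2 (volume : Measure E)) =ᵐ[volume] 𝓕⁻ K := by
  have hneg : MeasurePreserving (fun x : E => -x) volume volume := Measure.measurePreserving_neg _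
  refine ae_eq_of_integral_contDiff_smul_eq
    ((Lp.memLp _).locallyIntegrable (by norm_num)) ?_ ?_
  · rw [Real.fourierInv_eq_fourier_comp_neg]
    exact (continuous_fourier_of_integrable (hneg.integrable_comp_of_integrable hK)).locallyIntegrable
  intro g hg hgc
  have h1 : HasCompactSupport (fun x => (g x : ℂ)) := hgc.comp_left (g := fun r : ℝ => (r : ℂ)) rfl
  have h2 : ContDiff ℝ ∞ (fun x => (g x : ℂ)) := Complex.ofRealCLM.contDiff.comp hg
  have h3 := congrArg (fun T : TemperedDistribution E F => T (h1.toSchwartzMap h2))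
    (Lp.fourierInv_toTemperedDistribution_eq (hK2.toLp K))
  simp only [TemperedDistribution.fourierInv_apply, Lp.toTemperedDistribution_apply] at h3
  have h4 : ∀ x, (h1.toSchwartzMap h2) x = (g x : ℂ) := fun _ => rfl
  simp only [h4, Complex.coe_smul] at h3
  rw [← h3]
  have h5 : ∫ x, (𝓕⁻ (h1.toSchwartzMap h2)) x • (hK2.toLp K) x
      = ∫ x, (𝓕⁻ (h1.toSchwartzMap h2)) x • K x := by
    refine integral_congr_ae ?_
    filter_upwards [hK2.coeFn_toLp] with x hx
    rw [hx]
  rw [h5]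
  have h6 := VectorFourier.integral_fourierIntegral_smul_eq_flip (μ := (volume : Measure E))
    (ν := (volume : Measure E)) (L := -innerₗ E) (e := Real.fourierChar)
    (f := fun x => (g x : ℂ)) (g := K) Real.continuous_fourierChar
    (by exact continuous_inner.neg) ((h1.toSchwartzMap h2).integrable) hK
  have h7 : (-innerₗ E).flip = -innerₗ E := by
    ext x y; simp [real_inner_comm]
  rw [h7] at h6
  refine Eq.trans ?_ (h6.trans ?_)
  · rw [SchwartzMap.fourierInv_coe]
    rfl
  · refine integral_congr_ae (ae_of_all _ fun x => ?_)
    simp only [Complex.coe_smul]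
    rfl

end FourierLp

/-! ### The inverse Fourier integral: Plancherel, uniform bound, continuity. -/

section Synthesis

variable {d s : ℕ}

/-- The unnormalized inverse Fourier integral `∫ e^{ix·ξ} K(ξ) dξ`. -/
def synthesis (K : Space d → Fiber s) (x : Space d) : Fiber s :=
  ∫ ξ, Complex.exp (Complex.I * (inner ℝ x ξ : ℂ)) • K ξ

lemma norm_exp_I_mul_ofReal (r : ℝ) : ‖Complex.exp (Complex.I * (r : ℂ))‖ = 1 := by
  rw [mul_comm]; exact Complex.norm_exp_ofReal_mul_I r

/-- The constant `(2π)^{d/2}`. -/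
def twoPiPow (d : ℕ) : ℝ := (2 * Real.pi) ^ ((d : ℝ) / 2)

lemma twoPiPow_pos (d : ℕ) : 0 < twoPiPow d := by unfold twoPiPow; positivity

lemma twoPiPow_mul_self (d : ℕ) : twoPiPow d * twoPiPow d = (2 * Real.pi) ^ d := by
  unfold twoPiPow
  rw [← Real.rpow_add (by positivity), add_halves, Real.rpow_natCast]

lemma two_pi_rpow_neg (d : ℕ) : (2 * Real.pi) ^ (-(d : ℝ) / 2) = (twoPiPow d)⁻¹ := by
  unfold twoPiPow
  rw [neg_div, Real.rpow_neg (by positivity)]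

lemma integral_comp_two_pi_smul {G : Type*} [NormedAddCommGroup G] [NormedSpace ℝ G]
    (φ : Space d → G) :
    ∫ ξ, φ ξ = ((2 * Real.pi) ^ d) • ∫ ξ, φ ((2 * Real.pi) • ξ) := by
  rw [Measure.integral_comp_smul, finrank_euclideanSpace_fin, abs_of_pos (by positivity),
    smul_smul, mul_inv_cancel₀ (by positivity), one_smul]

/-- The substitution $\xi\mapsto2\pi\xi$ passes from the kernel $e^{ix\cdot\xi}$ to the kernel
$e^{2\pi ix\cdot\xi}$, so that facts about `𝓕⁻` carry over. -/
lemma synthesis_eq_fourierInv (K : Space d → Fiber s) (x : Space d) :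
    synthesis K x = ((2 * Real.pi) ^ d) • 𝓕⁻ (fun ξ => K ((2 * Real.pi) • ξ)) x := by
  rw [synthesis, integral_comp_two_pi_smul, Real.fourierInv_eq']
  congr 1
  refine integral_congr_ae (ae_of_all _ fun ξ => ?_)
  simp only [inner_smul_right, real_inner_comm]
  congr 2
  push_cast
  ring

lemma quasiMeasurePreserving_smul {c : ℝ} (hc : c ≠ 0) :
    Measure.QuasiMeasurePreserving (fun ξ : Space d => c • ξ) volume volume := by
  refine ⟨measurable_const_smul c, ?_⟩
  rw [Measure.map_addHaar_smul _ hc]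
  exact Measure.smul_absolutelyContinuous

lemma memLp_comp_smul {K : Space d → Fiber s} (hK : MemLp K 2 volume) {c : ℝ} (hc : c ≠ 0) :
    MemLp (fun ξ => K (c • ξ)) 2 volume := by
  have h : MemLp K 2 (Measure.map (fun ξ : Space d => c • ξ) volume) := by
    rw [Measure.map_addHaar_smul _ hc]
    exact hK.smul_measure ENNReal.ofReal_ne_top
  exact h.comp_of_map (measurable_const_smul c).aemeasurable

lemma two_pi_ne_zero : (2 * Real.pi) ≠ 0 := by positivity

lemma synthesis_toLp_ae {K : Space d → Fiber s} (hK : Integrable K) (hK2 : MemLp K 2 volume) :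
    ((((2 * Real.pi) ^ d : ℝ) : ℂ) • 𝓕⁻ ((memLp_comp_smul hK2 two_pi_ne_zero).toLp _) :
      Lp (Fiber s) 2 (volume : Measure (Space d))) =ᵐ[volume] synthesis K := by
  filter_upwards [Lp.coeFn_smul (((2 * Real.pi) ^ d : ℝ) : ℂ)
      (𝓕⁻ ((memLp_comp_smul hK2 two_pi_ne_zero).toLp _) : Lp (Fiber s) 2 (volume : Measure (Space d))),
    fourierInv_toLp_ae (hK.comp_smul two_pi_ne_zero) (memLp_comp_smul hK2 two_pi_ne_zero)]
    with x h1 h2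
  rw [h1, Pi.smul_apply, h2, synthesis_eq_fourierInv, Complex.coe_smul]

lemma memLp_synthesis {K : Space d → Fiber s} (hK : Integrable K) (hK2 : MemLp K 2 volume) :
    MemLp (synthesis K) 2 volume :=
  (memLp_congr_ae (synthesis_toLp_ae hK hK2)).1 (Lp.memLp _)

lemma fourier_toLp_synthesis {K : Space d → Fiber s} (hK : Integrable K)
    (hK2 : MemLp K 2 volume) :
    𝓕 ((memLp_synthesis hK hK2).toLp (synthesis K)) =
      (((2 * Real.pi) ^ d : ℝ) : ℂ) • (memLp_comp_smul hK2 two_pi_ne_zero).toLp _ := by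
  have : (memLp_synthesis hK hK2).toLp (synthesis K) =
      (((2 * Real.pi) ^ d : ℝ) : ℂ) • 𝓕⁻ ((memLp_comp_smul hK2 two_pi_ne_zero).toLp _) := by
    refine Lp.ext ?_
    exact (MemLp.coeFn_toLp _).trans (synthesis_toLp_ae hK hK2).symm
  rw [this, FourierTransform.fourier_smul, FourierTransform.fourier_fourierInv_eq]

lemma fourierL2_toLp_synthesis {K : Space d → Fiber s} (hK : Integrable K)
    (hK2 : MemLp K 2 volume) :
    fourierL2 ((memLp_synthesis hK hK2).toLp (synthesis K)) =ᵐ[volume]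
      fun ξ => (twoPiPow d : ℂ) • K ξ := by
  have h1 : ((𝓕 ((memLp_synthesis hK hK2).toLp (synthesis K)) :
      Lp (Fiber s) 2 (volume : Measure (Space d))) : Space d → Fiber s) =ᵐ[volume]
      fun ξ => (((2 * Real.pi) ^ d : ℝ) : ℂ) • K ((2 * Real.pi) • ξ) := by
    rw [fourier_toLp_synthesis hK hK2]
    filter_upwards [Lp.coeFn_smul (((2 * Real.pi) ^ d : ℝ) : ℂ)
      ((memLp_comp_smul hK2 two_pi_ne_zero).toLp _),
      (memLp_comp_smul hK2 two_pi_ne_zero).coeFn_toLp] with ξ h1 h2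
    rw [h1, Pi.smul_apply, h2]
  filter_upwards [(quasiMeasurePreserving_smul (inv_ne_zero two_pi_ne_zero)).ae h1] with ξ hξ
  rw [fourierL2, hξ, smul_smul, smul_smul, mul_inv_cancel₀ two_pi_ne_zero, one_smul,
    two_pi_rpow_neg, ← twoPiPow_mul_self]
  congr 1
  have := (twoPiPow_pos d).ne'
  norm_cast
  field_simp

/-- Plancherel. The factor is $(2\pi)^d$ from the change of variables times $(2\pi)^{-d/2}$ from the
dilation inside the $L^2$ norm. -/
lemma eLpNorm_synthesis {K : Space d → Fiber s} (hK : Integrable K) (hK2 : MemLp K 2 volume) :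
    eLpNorm (synthesis K) 2 volume = ENNReal.ofReal (twoPiPow d) * eLpNorm K 2 volume := by
  have h1 : eLpNorm (synthesis K) 2 volume =
      ‖𝓕 ((memLp_synthesis hK hK2).toLp (synthesis K))‖ₑ := by
    rw [← Lp.enorm_toLp (hf := memLp_synthesis hK hK2), enorm_eq_iff_norm_eq, Lp.norm_fourier_eq]
  have h2 : eLpNorm (fun ξ => K ((2 * Real.pi) • ξ)) 2 volume =
      ENNReal.ofReal (twoPiPow d)⁻¹ * eLpNorm K 2 volume := by
    have h3 : eLpNorm (fun ξ => K ((2 * Real.pi) • ξ)) 2 volume =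
        eLpNorm K 2 (Measure.map (fun ξ : Space d => (2 * Real.pi) • ξ) volume) := by
      rw [eLpNorm_map_measure _ (measurable_const_smul _).aemeasurable]
      · rfl
      · rw [Measure.map_addHaar_smul _ two_pi_ne_zero]
        exact hK.1.smul_measure _
    rw [h3, Measure.map_addHaar_smul _ two_pi_ne_zero, finrank_euclideanSpace_fin,
      eLpNorm_smul_measure_of_ne_top (by norm_num), abs_of_pos (by positivity), smul_eq_mul,
      ← twoPiPow_mul_self]
    congr 1
    rw [ENNReal.ofReal_rpow_of_nonneg (by have := twoPiPow_pos d; positivity) (by norm_num)]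
    congr 1
    rw [mul_inv, ← pow_two, ← Real.rpow_natCast, ← Real.rpow_mul (by have := twoPiPow_pos d; positivity)]
    norm_num
  rw [h1, fourier_toLp_synthesis hK hK2, enorm_smul, Lp.enorm_toLp, h2, ← mul_assoc]
  congr 1
  have h4 := (twoPiPow_pos d).ne'
  rw [← ofReal_norm, Complex.norm_real, Real.norm_of_nonneg (by positivity), ← ENNReal.ofReal_mul (by positivity),
    ← twoPiPow_mul_self, mul_assoc, mul_inv_cancel₀ h4, mul_one]

lemma enorm_synthesis_le (K : Space d → Fiber s) (x : Space d) :
    ‖synthesis K x‖ₑ ≤ ∫⁻ ξ, ‖K ξ‖ₑ := by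
  refine (enorm_integral_le_lintegral_enorm _).trans (le_of_eq ?_)
  refine lintegral_congr fun ξ => ?_
  rw [enorm_smul, ← ofReal_norm (Complex.exp _), norm_exp_I_mul_ofReal]
  simp

lemma continuous_exp_inner :
    Continuous fun p : Space d × Space d => Complex.exp (Complex.I * (inner ℝ p.1 p.2 : ℂ)) :=
  Complex.continuous_exp.comp
    (continuous_const.mul (Complex.continuous_ofReal.comp continuous_inner))

lemma continuous_exp_inner_right (x : Space d) :
    Continuous fun ξ : Space d => Complex.exp (Complex.I * (inner ℝ x ξ : ℂ)) :=
  continuous_exp_inner.comp (Continuous.prodMk_right x)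

lemma continuous_exp_inner_left (ξ : Space d) :
    Continuous fun x : Space d => Complex.exp (Complex.I * (inner ℝ x ξ : ℂ)) :=
  continuous_exp_inner.comp (Continuous.prodMk_left ξ)

lemma continuous_synthesis {K : Space d → Fiber s} (hK : Integrable K) :
    Continuous (synthesis K) := by
  refine continuous_of_dominated (bound := fun ξ => ‖K ξ‖) ?_ ?_ hK.norm ?_
  · intro x
    exact (continuous_exp_inner_right x).aestronglyMeasurable.smul hK.1
  · intro x
    refine ae_of_all _ fun ξ => ?_
    rw [norm_smul, norm_exp_I_mul_ofReal, one_mul]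
  · exact ae_of_all _ fun ξ => (continuous_exp_inner_left ξ).smul continuous_const

lemma synthesis_sub {K L : Space d → Fiber s} (hK : Integrable K) (hL : Integrable L)
    (x : Space d) : synthesis (K - L) x = synthesis K x - synthesis L x := by
  have h : ∀ {K : Space d → Fiber s}, Integrable K →
      Integrable fun ξ => Complex.exp (Complex.I * (inner ℝ x ξ : ℂ)) • K ξ := by
    intro K hK
    refine hK.bdd_smul 1 (continuous_exp_inner_right x).aestronglyMeasurable (ae_of_all _ fun ξ => ?_)
    rw [norm_exp_I_mul_ofReal]
  rw [synthesis, synthesis, synthesis, ← integral_sub (h hK) (h hL)]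
  simp only [Pi.sub_apply, smul_sub]

end Synthesis

/-! ### Bessel potentials as superpositions of Gaussians -/

section Bessel

open ProbabilityTheory

variable {d s : ℕ}

/-- The Laplace transform of the gamma law. With $r=|x|^2$ it turns Gaussians $e^{-t|x|^2}$ into
powers of $1+|x|^2$. -/
lemma integral_gammaMeasure_exp {a : ℝ} (ha : 0 < a) {r : ℝ} (hr : 0 ≤ r) :
    ∫ t, Real.exp (-(r * t)) ∂(gammaMeasure a 1) = (1 + r) ^ (-a) := by
  have h1 : ∀ t ∈ Set.Ioi (0 : ℝ), gammaPDFReal a 1 t * Real.exp (-(r * t)) =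
      (Real.Gamma a)⁻¹ * (t ^ (a - 1) * Real.exp (-((1 + r) * t))) := by
    intro t ht
    rw [gammaPDFReal, if_pos (le_of_lt ht), Real.one_rpow,
      show -((1 + r) * t) = -(1 * t) + -(r * t) by ring, Real.exp_add]
    ring
  have h0 : ∀ t ∉ Set.Ici (0 : ℝ), gammaPDFReal a 1 t * Real.exp (-(r * t)) = 0 := by
    intro t ht
    rw [gammaPDFReal, if_neg (by simpa using ht), zero_mul]
  rw [gammaMeasure]
  unfold gammaPDF
  rw [integral_withDensity_eq_integral_toReal_smul
    (measurable_gammaPDFReal a 1).ennreal_ofReal (ae_of_all _ fun _ => ENNReal.ofReal_lt_top)]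
  have h2 : ∀ t, (ENNReal.ofReal (gammaPDFReal a 1 t)).toReal • Real.exp (-(r * t)) =
      gammaPDFReal a 1 t * Real.exp (-(r * t)) := by
    intro t
    rw [ENNReal.toReal_ofReal (gammaPDFReal_nonneg ha one_pos t), smul_eq_mul]
  simp_rw [h2]
  rw [← setIntegral_eq_integral_of_forall_compl_eq_zero h0, integral_Ici_eq_integral_Ioi,
    setIntegral_congr_fun measurableSet_Ioi h1, integral_const_mul,
    Real.integral_rpow_mul_exp_neg_mul_Ioi ha (by positivity), one_div,
    Real.inv_rpow (by positivity), Real.rpow_neg (by positivity)]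
  have := (Real.Gamma_pos_of_pos ha).ne'
  field_simp

lemma ae_gammaMeasure_nonneg (a : ℝ) : ∀ᵐ t ∂(gammaMeasure a 1), 0 ≤ t := by
  rw [ae_iff, gammaMeasure, withDensity_apply _ (by measurability)]
  rw [setLIntegral_congr_fun (g := fun _ => 0) (by measurability)]
  · simp
  · intro t ht
    exact gammaPDF_of_neg (by simpa using ht)

/-- Multiplying the density of rate $1$ by $e^{t/2}$ gives a multiple of the density of rate $1/2$.
-/
lemma lintegral_gammaMeasure_exp_half {a : ℝ} (ha : 0 < a) :
    ∫⁻ t, ENNReal.ofReal (Real.exp (t / 2)) ∂(gammaMeasure a 1) < ⊤ := by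
  have hm : Measurable (gammaPDF a 1) := (measurable_gammaPDFReal a 1).ennreal_ofReal
  rw [gammaMeasure, lintegral_withDensity_eq_lintegral_mul _ hm (by fun_prop)]
  have h : ∀ t, (gammaPDF a 1 * fun t => ENNReal.ofReal (Real.exp (t / 2))) t =
      ENNReal.ofReal (1 / (1 / 2) ^ a) * gammaPDF a (1 / 2) t := by
    intro t
    simp only [Pi.mul_apply, gammaPDF]
    rw [← ENNReal.ofReal_mul (gammaPDFReal_nonneg ha one_pos t), ← ENNReal.ofReal_mul (by positivity)]
    congr 1
    unfold gammaPDFReal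
    split_ifs with ht
    · have h1 : Real.exp (-(1 / 2 * t)) = Real.exp (-(1 * t)) * Real.exp (t / 2) := by
        rw [← Real.exp_add]; congr 1; ring
      have h2 : ((1 : ℝ) / 2) ^ a ≠ 0 := by positivity
      rw [h1, Real.one_rpow]
      field_simp
    · simp
  have hm' : Measurable (gammaPDF a (1 / 2)) := (measurable_gammaPDFReal a _).ennreal_ofReal
  rw [lintegral_congr h, lintegral_const_mul _ hm',
    lintegral_gammaPDF_eq_one ha (by norm_num)]
  simp

lemma exists_one_add_sqrt_pow_le (N : ℕ) :
    ∃ C : ℝ, 0 ≤ C ∧ ∀ t : ℝ, 0 ≤ t → (1 + Real.sqrt (2 * t)) ^ N ≤ C * Real.exp (t / 2) := by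
  -- From $y^N\le N!\,e^y$ at $y=1+\sqrt{2t}$, where $(\sqrt{2t}-2)^2\ge0$ gives $y\le2+t/2$.
  refine ⟨N.factorial * Real.exp 2, by positivity, fun t ht => ?_⟩
  have h1 := Real.pow_div_factorial_le_exp (1 + Real.sqrt (2 * t)) (by positivity) N
  rw [div_le_iff₀ (by positivity)] at h1
  refine h1.trans ?_
  rw [mul_comm, mul_assoc, ← Real.exp_add]
  refine mul_le_mul_of_nonneg_left (Real.exp_le_exp.2 ?_) (by positivity)
  nlinarith [Real.sq_sqrt (show 0 ≤ 2 * t by positivity), sq_nonneg (Real.sqrt (2 * t) - 2)]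

lemma lintegral_stdGaussian_pow_lt_top (d N : ℕ) :
    ∫⁻ ζ, ENNReal.ofReal ((1 + ‖ζ‖) ^ N) ∂(stdGaussian (Space d)) < ⊤ := by
  have h0 : MemLp (fun ζ : Space d => ζ) N (stdGaussian (Space d)) :=
    IsGaussian.memLp_id _ _ (ENNReal.natCast_ne_top N)
  have h00 : MemLp (fun ζ : Space d => ‖ζ‖) N (stdGaussian (Space d)) := h0.norm
  have h01 : MemLp (fun _ : Space d => (1 : ℝ)) N (stdGaussian (Space d)) := memLp_const 1
  have h1 : MemLp (fun ζ : Space d => 1 + ‖ζ‖) N (stdGaussian (Space d)) := h01.add h00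
  have h2 := h1.integrable_norm_pow'
  refine lt_of_eq_of_lt (lintegral_congr fun ζ => ?_) h2.2
  have h3 : ‖1 + ‖ζ‖‖ = 1 + ‖ζ‖ := Real.norm_of_nonneg (by positivity)
  simp only [h3]
  rw [← ofReal_norm, Real.norm_of_nonneg (by positivity)]

/-- The law on `ℝ^d` whose characteristic function is `⟨x⟩^{-σ}`; all its moments are finite. -/
lemma exists_measure_charFun_bracket {σ : ℝ} (hσ : 0 < σ) :
    ∃ ρ : Measure (Space d), IsProbabilityMeasure ρ ∧
      (∀ x : Space d, ∫ η, Complex.exp (Complex.I * (inner ℝ x η : ℂ)) ∂ρ =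
        ((bracket x ^ (-σ) : ℝ) : ℂ)) ∧
      ∀ N : ℕ, ∫⁻ η, ENNReal.ofReal ((1 + ‖η‖) ^ N) ∂ρ < ⊤ := by
  have ha : 0 < σ / 2 := by positivity
  have hp := isProbabilityMeasure_gammaMeasure ha one_pos
  -- The law is that of $\sqrt{2t}\,\zeta$ with $t$ gamma of shape $\sigma/2$ and $\zeta$ an
  -- independent standard Gaussian: given $t$ the characteristic function is $e^{-t|x|^2}$, and
  -- averaging over $t$ gives $(1+|x|^2)^{-\sigma/2}$.
  let θ : ℝ × Space d → Space d := fun p => Real.sqrt (2 * p.1) • p.2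
  have hθ : Measurable θ := by
    have : Continuous θ := by
      have : Continuous fun p : ℝ × Space d => Real.sqrt (2 * p.1) := by fun_prop
      exact this.smul continuous_snd
    exact this.measurable
  refine ⟨Measure.map θ ((gammaMeasure (σ / 2) 1).prod (stdGaussian (Space d))),
    Measure.isProbabilityMeasure_map hθ.aemeasurable, fun x => ?_, fun N => ?_⟩
  · rw [integral_map hθ.aemeasurable (continuous_exp_inner_right x).aestronglyMeasurable,
      integral_prod]
    · have h1 : ∀ᵐ t ∂(gammaMeasure (σ / 2) 1), (∫ ζ, Complex.exp (Complex.I * (inner ℝ x (θ (t, ζ)) : ℂ))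
          ∂(stdGaussian (Space d))) = ((Real.exp (-(‖x‖ ^ 2 * t)) : ℝ) : ℂ) := by
        filter_upwards [ae_gammaMeasure_nonneg (σ / 2)] with t ht
        have h2 := charFun_stdGaussian (Real.sqrt (2 * t) • x)
        rw [charFun_apply] at h2
        convert h2 using 1
        · refine integral_congr_ae (ae_of_all _ fun ζ => ?_)
          simp only [θ, inner_smul_right, real_inner_comm, mul_comm]
        · rw [norm_smul, Real.norm_of_nonneg (Real.sqrt_nonneg _), ← Complex.ofReal_pow, mul_pow,
            Real.sq_sqrt (by positivity)]
          push_cast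
          congr 1
          ring
      rw [integral_congr_ae h1, integral_complex_ofReal, integral_gammaMeasure_exp ha (by positivity)]
      congr 1
      rw [bracket, Real.sqrt_eq_rpow, ← Real.rpow_mul (by positivity)]
      congr 1
      ring
    · refine Integrable.of_bound ?_ 1 (ae_of_all _ fun p => ?_)
      · exact ((continuous_exp_inner_right x).measurable.comp hθ).aestronglyMeasurable
      · rw [norm_exp_I_mul_ofReal]
  · obtain ⟨C, hC, hCt⟩ := exists_one_add_sqrt_pow_le N
    have hG := lintegral_stdGaussian_pow_lt_top d N
    rw [lintegral_map (by fun_prop) hθ]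
    calc _ ≤ ∫⁻ p, ENNReal.ofReal (C * Real.exp (p.1 / 2)) * ENNReal.ofReal ((1 + ‖p.2‖) ^ N)
          ∂((gammaMeasure (σ / 2) 1).prod (stdGaussian (Space d))) := by
          refine lintegral_mono_ae ?_
          have h3 : ∀ᵐ p ∂((gammaMeasure (σ / 2) 1).prod (stdGaussian (Space d))), 0 ≤ p.1 :=
            Measure.quasiMeasurePreserving_fst.ae (ae_gammaMeasure_nonneg (σ / 2))
          filter_upwards [h3] with p hp
          rw [← ENNReal.ofReal_mul (by positivity)]
          refine ENNReal.ofReal_le_ofReal ?_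
          calc (1 + ‖θ p‖) ^ N ≤ ((1 + Real.sqrt (2 * p.1)) * (1 + ‖p.2‖)) ^ N := by
                refine pow_le_pow_left₀ (by positivity) ?_ N
                rw [norm_smul, Real.norm_of_nonneg (Real.sqrt_nonneg _)]
                nlinarith [norm_nonneg p.2, Real.sqrt_nonneg (2 * p.1)]
            _ = (1 + Real.sqrt (2 * p.1)) ^ N * (1 + ‖p.2‖) ^ N := mul_pow _ _ _
            _ ≤ _ := mul_le_mul_of_nonneg_right (hCt _ hp) (by positivity)
      _ = (∫⁻ t, ENNReal.ofReal (C * Real.exp (t / 2)) ∂(gammaMeasure (σ / 2) 1)) *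
          ∫⁻ ζ, ENNReal.ofReal ((1 + ‖ζ‖) ^ N) ∂(stdGaussian (Space d)) :=
          lintegral_prod_mul (f := fun t : ℝ => ENNReal.ofReal (C * Real.exp (t / 2)))
            (g := fun ζ : Space d => ENNReal.ofReal ((1 + ‖ζ‖) ^ N)) (by fun_prop) (by fun_prop)
      _ < ⊤ := by
          refine ENNReal.mul_lt_top ?_ hG
          simp_rw [ENNReal.ofReal_mul hC]
          rw [lintegral_const_mul _ (by fun_prop)]
          exact ENNReal.mul_lt_top ENNReal.ofReal_lt_top (lintegral_gammaMeasure_exp_half ha)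

end Bessel

/-! ### Convolution with a measure and weighted $L^2$ bounds. -/

section Convolution

/-- The Cauchy–Schwarz inequality with a weight. -/
lemma lintegral_mul_sq_le {Ω : Type*} [MeasurableSpace Ω] (μ : Measure Ω) {a b : Ω → ℝ≥0∞}
    (ha : AEMeasurable a μ) (hb : AEMeasurable b μ) :
    (∫⁻ t, a t * b t ∂μ) ^ 2 ≤ (∫⁻ t, a t ∂μ) * ∫⁻ t, a t * b t ^ 2 ∂μ := by
  have h1 := ENNReal.lintegral_mul_le_Lp_mul_Lq μ Real.HolderConjugate.two_two
    (ha.pow_const (1 / 2 : ℝ)) ((ha.pow_const (1 / 2 : ℝ)).mul hb)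
  have h2 : ∀ x : ℝ≥0∞, x ^ (1 / 2 : ℝ) * x ^ (1 / 2 : ℝ) = x := fun x => by
    rw [← ENNReal.rpow_add_of_nonneg _ _ (by norm_num) (by norm_num)]; norm_num
  have h3 : ∀ x : ℝ≥0∞, (x ^ (1 / 2 : ℝ)) ^ 2 = x := fun x => by rw [pow_two, h2]
  simp only [Pi.mul_apply, ← mul_assoc, h2, ENNReal.rpow_two, mul_pow, h3] at h1
  calc _ ≤ _ := pow_le_pow_left₀ (by positivity) h1 2
    _ = _ := by rw [mul_pow, h3, h3]

variable {d s : ℕ}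

lemma integrable_prod_comp_sub {W : Space d → Fiber s} (hW : StronglyMeasurable W)
    (hWi : Integrable W) (ρ : Measure (Space d)) [IsFiniteMeasure ρ] :
    Integrable (fun p : Space d × Space d => W (p.1 - p.2)) (volume.prod ρ) := by
  have hm : StronglyMeasurable fun p : Space d × Space d => W (p.1 - p.2) :=
    hW.comp_measurable (by fun_prop)
  rw [integrable_prod_iff' hm.aestronglyMeasurable]
  refine ⟨ae_of_all _ fun η => hWi.comp_sub_right η, ?_⟩
  simp_rw [integral_sub_right_eq_self (fun ξ => ‖W ξ‖)]
  exact integrable_const _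

/-- The convolution of a function with a measure. -/
def measureConv (ρ : Measure (Space d)) (W : Space d → Fiber s) (ξ : Space d) : Fiber s :=
  ∫ η, W (ξ - η) ∂ρ

lemma integrable_measureConv {W : Space d → Fiber s} (hW : StronglyMeasurable W)
    (hWi : Integrable W) (ρ : Measure (Space d)) [IsFiniteMeasure ρ] :
    Integrable (measureConv ρ W) :=
  (integrable_prod_comp_sub hW hWi ρ).integral_prod_left

lemma synthesis_measureConv {W : Space d → Fiber s} (hW : StronglyMeasurable W)
    (hWi : Integrable W) (ρ : Measure (Space d)) [IsFiniteMeasure ρ] (x : Space d) :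
    synthesis (measureConv ρ W) x =
      (∫ η, Complex.exp (Complex.I * (inner ℝ x η : ℂ)) ∂ρ) • synthesis W x := by
  have h1 : ∀ ξ, Complex.exp (Complex.I * (inner ℝ x ξ : ℂ)) • measureConv ρ W ξ =
      ∫ η, Complex.exp (Complex.I * (inner ℝ x ξ : ℂ)) • W (ξ - η) ∂ρ := fun ξ =>
    (integral_smul (Complex.exp (Complex.I * (inner ℝ x ξ : ℂ))) fun η => W (ξ - η)).symm
  have h2 : Integrable (fun p : Space d × Space d =>
      Complex.exp (Complex.I * (inner ℝ x p.1 : ℂ)) • W (p.1 - p.2)) (volume.prod ρ) := by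
    have hφ : AEStronglyMeasurable (fun p : Space d × Space d =>
        Complex.exp (Complex.I * (inner ℝ x p.1 : ℂ))) (volume.prod ρ) :=
      ((continuous_exp_inner_right x).comp continuous_fst).aestronglyMeasurable
    refine (integrable_prod_comp_sub hW hWi ρ).bdd_smul 1 hφ (ae_of_all _ fun p => ?_)
    rw [norm_exp_I_mul_ofReal]
  rw [synthesis, integral_congr_ae (ae_of_all _ h1), integral_integral_swap h2,
    ← integral_smul_const]
  refine integral_congr_ae (ae_of_all _ fun η => ?_)
  have h3 : ∀ ξ, Complex.exp (Complex.I * (inner ℝ x ξ : ℂ)) • W (ξ - η) =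
      (fun ζ => Complex.exp (Complex.I * (inner ℝ x (ζ + η) : ℂ)) • W ζ) (ξ - η) := by
    intro ξ; simp
  simp only []
  rw [integral_congr_ae (ae_of_all _ h3), integral_sub_right_eq_self
    (fun ζ => Complex.exp (Complex.I * (inner ℝ x (ζ + η) : ℂ)) • W ζ), synthesis, ← integral_smul]
  refine integral_congr_ae (ae_of_all _ fun ζ => ?_)
  simp only [inner_add_right, smul_smul, ← Complex.exp_add]
  congr 2
  push_cast
  ring

/-- The weight `(1 + |ξ|)^N`. -/
def weight (N : ℕ) (ξ : Space d) : ℝ≥0∞ := ENNReal.ofReal ((1 + ‖ξ‖) ^ N)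

lemma measurable_weight (N : ℕ) : Measurable (weight N : Space d → ℝ≥0∞) := by
  unfold weight; fun_prop

lemma weight_ne_top (N : ℕ) (ξ : Space d) : weight N ξ ≠ ⊤ := ENNReal.ofReal_ne_top

lemma one_le_weight (N : ℕ) (ξ : Space d) : 1 ≤ weight N ξ := by
  rw [weight, ENNReal.one_le_ofReal]
  exact one_le_pow₀ (by linarith [norm_nonneg ξ])

lemma weight_le_mul (N : ℕ) (ξ η : Space d) : weight N ξ ≤ weight N η * weight N (ξ - η) := by
  unfold weight
  rw [← ENNReal.ofReal_mul (by positivity), ← mul_pow]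
  refine ENNReal.ofReal_le_ofReal (pow_le_pow_left₀ (by positivity) ?_ N)
  have : ‖ξ‖ ≤ ‖η‖ + ‖ξ - η‖ := by simpa using norm_add_le η (ξ - η)
  nlinarith [norm_nonneg η, norm_nonneg (ξ - η)]

/-- The square of the norm of `(1 + |ξ|)^N F` in `L²`. -/
def weightedEnergy (N : ℕ) (F : Space d → Fiber s) : ℝ≥0∞ :=
  ∫⁻ ξ, (weight N ξ * ‖F ξ‖ₑ) ^ 2

/-- Submultiplicativity of the weight, $w(\xi)\le w(\eta)w(\xi-\eta)$, distributes it over the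
convolution; Cauchy–Schwarz for the finite measure $w\,d\rho$ and Tonelli then bound the result by
$(\int w\,d\rho)^2$ times the energy of `W`. -/
lemma weightedEnergy_measureConv_lt_top (N : ℕ) {W : Space d → Fiber s}
    (hW : StronglyMeasurable W) {ρ : Measure (Space d)} [IsFiniteMeasure ρ]
    (hρ : ∫⁻ η, weight N η ∂ρ < ⊤) (hWN : weightedEnergy N W < ⊤) :
    weightedEnergy N (measureConv ρ W) < ⊤ := by
  have hm := measurable_weight (d := d) N
  have hm2 : Measurable fun p : Space d × Space d =>
      weight N p.2 * (weight N (p.1 - p.2) * ‖W (p.1 - p.2)‖ₑ) ^ 2 := by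
    have := hW.enorm
    fun_prop
  have h1 : ∀ ξ, (weight N ξ * ‖measureConv ρ W ξ‖ₑ) ^ 2 ≤ (∫⁻ η, weight N η ∂ρ) *
      ∫⁻ η, weight N η * (weight N (ξ - η) * ‖W (ξ - η)‖ₑ) ^ 2 ∂ρ := by
    intro ξ
    have hWm : Measurable fun η => ‖W (ξ - η)‖ₑ := hW.enorm.comp (by fun_prop)
    have hb : Measurable fun η => weight N (ξ - η) * ‖W (ξ - η)‖ₑ := by fun_prop
    refine le_trans (pow_le_pow_left₀ (by positivity) ?_ 2) (lintegral_mul_sq_le ρ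
      hm.aemeasurable hb.aemeasurable)
    calc weight N ξ * ‖measureConv ρ W ξ‖ₑ ≤ weight N ξ * ∫⁻ η, ‖W (ξ - η)‖ₑ ∂ρ := by
          gcongr; exact enorm_integral_le_lintegral_enorm _
      _ = ∫⁻ η, weight N ξ * ‖W (ξ - η)‖ₑ ∂ρ := (lintegral_const_mul _ hWm).symm
      _ ≤ _ := by
          refine lintegral_mono fun η => ?_
          rw [← mul_assoc]
          gcongr
          exact weight_le_mul N ξ η
  calc weightedEnergy N (measureConv ρ W)
      ≤ ∫⁻ ξ, (∫⁻ η, weight N η ∂ρ) *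
        ∫⁻ η, weight N η * (weight N (ξ - η) * ‖W (ξ - η)‖ₑ) ^ 2 ∂ρ := lintegral_mono h1
    _ = (∫⁻ η, weight N η ∂ρ) *
        ∫⁻ η, (∫⁻ ξ, weight N η * (weight N (ξ - η) * ‖W (ξ - η)‖ₑ) ^ 2) ∂ρ := by
        rw [lintegral_const_mul' _ _ hρ.ne, lintegral_lintegral_swap hm2.aemeasurable]
    _ = (∫⁻ η, weight N η ∂ρ) * ∫⁻ η, weight N η * weightedEnergy N W ∂ρ := by
        congr 1
        refine lintegral_congr fun η => ?_
        rw [lintegral_const_mul' _ _ (weight_ne_top N η), weightedEnergy,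
          lintegral_sub_right_eq_self (fun ζ => (weight N ζ * ‖W ζ‖ₑ) ^ 2)]
    _ < ⊤ := by
        rw [lintegral_mul_const _ hm]
        exact ENNReal.mul_lt_top hρ (ENNReal.mul_lt_top hρ hWN)

lemma memLp_two_of_weightedEnergy {N : ℕ} {F : Space d → Fiber s}
    (hF : AEStronglyMeasurable F volume) (h : weightedEnergy N F < ⊤) : MemLp F 2 volume := by
  refine ⟨hF, ?_⟩
  rw [eLpNorm_lt_top_iff_lintegral_rpow_enorm_lt_top (by norm_num) (by norm_num)]
  refine lt_of_le_of_lt (lintegral_mono fun ξ => ?_) h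
  simp only [ENNReal.toReal_ofNat, ENNReal.rpow_two]
  refine pow_le_pow_left₀ (by positivity) (le_mul_of_one_le_left (by positivity) (one_le_weight N ξ)) 2

lemma lintegral_weight_inv_sq_lt_top {N : ℕ} (hN : d < 2 * N) :
    ∫⁻ ξ : Space d, ((weight N ξ)⁻¹) ^ 2 < ⊤ := by
  have h1 := (integrable_one_add_norm (E := Space d) (μ := volume) (r := (2 * N : ℕ))
    (by rw [finrank_euclideanSpace_fin]; exact_mod_cast hN)).2
  refine lt_of_eq_of_lt (lintegral_congr fun ξ => ?_) h1
  rw [weight, ← ENNReal.ofReal_inv_of_pos (by positivity), ← ENNReal.ofReal_pow (by positivity),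
    ← ofReal_norm, Real.norm_of_nonneg (by positivity)]
  simp only []
  rw [Real.rpow_neg (by positivity), Real.rpow_natCast, inv_pow, ← pow_mul, mul_comm 2 N]

/-- Cauchy–Schwarz for $F=w^{-1}\cdot wF$; the condition $d<2N$ makes $w^{-1}$ square integrable. -/
lemma integrable_of_weightedEnergy {N : ℕ} (hN : d < 2 * N) {F : Space d → Fiber s}
    (hF : AEStronglyMeasurable F volume) (h : weightedEnergy N F < ⊤) : Integrable F := by
  refine ⟨hF, ?_⟩
  have hm := measurable_weight (d := d) N
  have h1 := ENNReal.lintegral_mul_le_Lp_mul_Lq (volume : Measure (Space d))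
    Real.HolderConjugate.two_two hm.inv.aemeasurable (hm.aemeasurable.mul hF.enorm)
  simp only [Pi.mul_apply, ENNReal.rpow_two] at h1
  refine lt_of_le_of_lt (le_trans (le_of_eq (lintegral_congr fun ξ => ?_)) h1) ?_
  · rw [Pi.inv_apply, ← mul_assoc, ENNReal.inv_mul_cancel (by have := one_le_weight N ξ; positivity)
      (weight_ne_top N ξ), one_mul]
  · refine ENNReal.mul_lt_top (ENNReal.rpow_lt_top_of_nonneg (by norm_num) ?_)
      (ENNReal.rpow_lt_top_of_nonneg (by norm_num) h.ne)
    exact (lintegral_weight_inv_sq_lt_top hN).ne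

end Convolution

/-! ### Weighted Sobolev functions as inverse Fourier integrals. -/

section Sobolev

variable {d s : ℕ}

/-- The Sobolev condition is an identity of tempered distributions, $\langle\xi\rangle^m\widehat
w=f'$ with $f'\in L^2$. Multiplying by the bounded function $\langle\xi\rangle^{-m}$ keeps both
sides in $L^2$, and $L^2$ embeds injectively into the tempered distributions. -/
lemma exists_fourier_eq_of_memSobolev {m : ℝ} (hm : 0 ≤ m)
    {w : Lp (Fiber s) 2 (volume : Measure (Space d))}
    (hw : TemperedDistribution.MemSobolev m 2 (Lp.toTemperedDistribution w)) :
    ∃ f' : Lp (Fiber s) 2 (volume : Measure (Space d)),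
      (𝓕 w : Lp (Fiber s) 2 (volume : Measure (Space d))) =ᵐ[volume]
        fun ξ => (((1 + ‖ξ‖ ^ 2) ^ (-m / 2) : ℝ) : ℂ) • f' ξ := by
  obtain ⟨f', hf'⟩ := TemperedDistribution.memSobolev_iff_exists_smulLeftCLM_fourier.1 hw
  have hinv : ∀ ξ : Space d, (((1 + ‖ξ‖ ^ 2) ^ (-m / 2) : ℝ) : ℂ) *
      (((1 + ‖ξ‖ ^ 2) ^ (m / 2) : ℝ) : ℂ) = 1 := by
    intro ξ
    rw [← Complex.ofReal_mul, ← Real.rpow_add (by positivity), neg_div, neg_add_cancel,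
      Real.rpow_zero, Complex.ofReal_one]
  have hC : ∀ ξ : Space d, (1 + ‖ξ‖ ^ 2) ^ (-m / 2) ≤ 1 := fun ξ =>
    Real.rpow_le_one_of_one_le_of_nonpos (by nlinarith [sq_nonneg ‖ξ‖]) (by linarith)
  have hg : (fun ξ : Space d => (((1 + ‖ξ‖ ^ 2) ^ (-m / 2) : ℝ) : ℂ)).HasTemperateGrowth := by
    fun_prop
  have hmem : MemLp (fun ξ : Space d => (((1 + ‖ξ‖ ^ 2) ^ (-m / 2) : ℝ) : ℂ)) ⊤ volume := by
    refine memLp_top_of_bound hg.1.continuous.aestronglyMeasurable 1 (ae_of_all _ fun ξ => ?_)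
    rw [Complex.norm_real, Real.norm_of_nonneg (by positivity)]
    exact hC ξ
  have h1 := congrArg (TemperedDistribution.smulLeftCLM (Fiber s)
    (fun ξ : Space d => (((1 + ‖ξ‖ ^ 2) ^ (-m / 2) : ℝ) : ℂ))) hf'
  rw [TemperedDistribution.smulLeftCLM_smulLeftCLM_apply (by fun_prop) hg,
    ← Lp.toTemperedDistribution_smul_eq (p := ⊤) (q := 2) (r := 2) hg hmem, Lp.fourier_toTemperedDistribution_eq] at h1
  have h2 : (fun ξ : Space d => (((1 + ‖ξ‖ ^ 2) ^ (-m / 2) : ℝ) : ℂ)) *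
      (fun ξ : Space d => (((1 + ‖ξ‖ ^ 2) ^ (m / 2) : ℝ) : ℂ)) = fun _ => 1 := by
    funext ξ; exact hinv ξ
  rw [mul_comm, h2, TemperedDistribution.smulLeftCLM_const, one_smul] at h1
  have h3 : (𝓕 w : Lp (Fiber s) 2 (volume : Measure (Space d))) = hmem.toLp _ • f' :=
    LinearMap.ker_eq_bot.1 (Lp.ker_toTemperedDistributionCLM_eq_bot
      (E := Space d) (F := Fiber s) (μ := volume) (p := 2)) h1
  refine ⟨f', ?_⟩
  rw [h3]
  filter_upwards [Lp.coeFn_lpSMul (r := 2) (hmem.toLp _) f', hmem.coeFn_toLp] with ξ h4 h5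
  rw [h4, Pi.smul_apply', h5]

lemma exists_weight_le (d N : ℕ) {m : ℝ} (hNm : (N : ℝ) ≤ m) :
    ∃ C : ℝ, 0 ≤ C ∧ ∀ ξ : Space d,
      (1 + ‖(2 * Real.pi) • ξ‖) ^ N * (1 + ‖ξ‖ ^ 2) ^ (-m / 2) ≤ C := by
  refine ⟨(2 * Real.pi * 2) ^ N, by positivity, fun ξ => ?_⟩
  have hpi : 1 ≤ 2 * Real.pi := by linarith [Real.pi_gt_three]
  have h1 : (1 + ‖ξ‖ ^ 2) ^ (-m / 2) ≤ (1 + ‖ξ‖ ^ 2) ^ (-(N : ℝ) / 2) :=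
    Real.rpow_le_rpow_of_exponent_le (by nlinarith [sq_nonneg ‖ξ‖]) (by linarith)
  have h2 : (1 + ‖ξ‖ ^ 2) ^ (-(N : ℝ) / 2) = ((Real.sqrt (1 + ‖ξ‖ ^ 2)) ^ N)⁻¹ := by
    rw [neg_div, Real.rpow_neg (by positivity), Real.sqrt_eq_rpow, ← Real.rpow_mul_natCast
      (by positivity)]
    congr 2
    ring
  have h3 : 1 + ‖(2 * Real.pi) • ξ‖ ≤ (2 * Real.pi * 2) * Real.sqrt (1 + ‖ξ‖ ^ 2) := by
    rw [norm_smul, Real.norm_of_nonneg (by positivity)]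
    have h4 : 1 ≤ Real.sqrt (1 + ‖ξ‖ ^ 2) := by
      rw [Real.one_le_sqrt]; nlinarith [sq_nonneg ‖ξ‖]
    have h5 : ‖ξ‖ ≤ Real.sqrt (1 + ‖ξ‖ ^ 2) := Real.le_sqrt_of_sq_le (by linarith)
    nlinarith
  calc _ ≤ ((2 * Real.pi * 2) * Real.sqrt (1 + ‖ξ‖ ^ 2)) ^ N *
        ((Real.sqrt (1 + ‖ξ‖ ^ 2)) ^ N)⁻¹ := by
        rw [← h2]
        gcongr
    _ = _ := by
        have : Real.sqrt (1 + ‖ξ‖ ^ 2) ^ N ≠ 0 := by positivity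
        rw [mul_pow, mul_assoc, mul_inv_cancel₀ this, mul_one]

lemma exists_synthesis_of_memSobolev {m : ℝ} {N : ℕ} (hN : d < 2 * N) (hNm : (N : ℝ) ≤ m)
    {w : Lp (Fiber s) 2 (volume : Measure (Space d))}
    (hw : TemperedDistribution.MemSobolev m 2 (Lp.toTemperedDistribution w)) :
    ∃ W : Space d → Fiber s, StronglyMeasurable W ∧ Integrable W ∧ weightedEnergy N W < ⊤ ∧
      w =ᵐ[volume] synthesis W := by
  obtain ⟨f', hf'⟩ := exists_fourier_eq_of_memSobolev ((Nat.cast_nonneg N).trans hNm) hw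
  set ŵ := (𝓕 w : Lp (Fiber s) 2 (volume : Measure (Space d))) with hŵ
  let W : Space d → Fiber s := fun ξ =>
    ((((2 * Real.pi) ^ d)⁻¹ : ℝ) : ℂ) • ŵ ((2 * Real.pi)⁻¹ • ξ)
  have hWm : StronglyMeasurable W :=
    ((Lp.stronglyMeasurable ŵ).comp_measurable
      (measurable_const_smul (α := Space d) (2 * Real.pi)⁻¹)).const_smul
      ((((2 * Real.pi) ^ d)⁻¹ : ℝ) : ℂ)
  obtain ⟨C, hC, hCw⟩ := exists_weight_le d N hNm
  have hE : weightedEnergy N W < ⊤ := by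
    have h1 : weightedEnergy N W ≤ ∫⁻ ξ, ENNReal.ofReal (((2 * Real.pi) ^ d)⁻¹ * C) ^ 2 *
        ‖f' ((2 * Real.pi)⁻¹ • ξ)‖ₑ ^ 2 := by
      refine lintegral_mono_ae ?_
      filter_upwards [(quasiMeasurePreserving_smul (inv_ne_zero two_pi_ne_zero)).ae hf'] with ξ hξ
      rw [← mul_pow]
      refine pow_le_pow_left₀ (by positivity) ?_ 2
      simp only [W]
      rw [hξ, weight, enorm_smul, enorm_smul, ← mul_assoc, ← mul_assoc]
      gcongr
      rw [← ofReal_norm, ← ofReal_norm, Complex.norm_real, Complex.norm_real,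
        Real.norm_of_nonneg (by positivity), Real.norm_of_nonneg (by positivity),
        ← ENNReal.ofReal_mul (by positivity), ← ENNReal.ofReal_mul (by positivity)]
      refine ENNReal.ofReal_le_ofReal ?_
      have h2 := hCw ((2 * Real.pi)⁻¹ • ξ)
      rw [smul_smul, mul_inv_cancel₀ two_pi_ne_zero, one_smul] at h2
      calc _ = ((2 * Real.pi) ^ d)⁻¹ * ((1 + ‖ξ‖) ^ N *
            (1 + ‖(2 * Real.pi)⁻¹ • ξ‖ ^ 2) ^ (-m / 2)) := by ring
        _ ≤ _ := by gcongr
    refine lt_of_le_of_lt h1 ?_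
    rw [lintegral_const_mul' _ _ (by finiteness)]
    refine ENNReal.mul_lt_top (by finiteness) ?_
    have h3 := (memLp_comp_smul (Lp.memLp f') (inv_ne_zero two_pi_ne_zero)).2
    rw [eLpNorm_lt_top_iff_lintegral_rpow_enorm_lt_top (by norm_num) (by norm_num)] at h3
    simpa using h3
  have hWi := integrable_of_weightedEnergy hN hWm.aestronglyMeasurable hE
  have hW2 := memLp_two_of_weightedEnergy hWm.aestronglyMeasurable hE
  refine ⟨W, hWm, hWi, hE, ?_⟩
  refine EventuallyEq.trans ?_ (synthesis_toLp_ae hWi hW2)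
  have h4 : (((2 * Real.pi) ^ d : ℝ) : ℂ) • (memLp_comp_smul hW2 two_pi_ne_zero).toLp _ = ŵ := by
    refine Lp.ext ?_
    filter_upwards [Lp.coeFn_smul (((2 * Real.pi) ^ d : ℝ) : ℂ)
      ((memLp_comp_smul hW2 two_pi_ne_zero).toLp _),
      (memLp_comp_smul hW2 two_pi_ne_zero).coeFn_toLp] with ξ h1 h2
    rw [h1, Pi.smul_apply, h2]
    simp only [W]
    rw [smul_smul, smul_smul, inv_mul_cancel₀ two_pi_ne_zero, one_smul, ← Complex.ofReal_mul,
      mul_inv_cancel₀ (by positivity), Complex.ofReal_one, one_smul]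
  rw [← FourierTransform.fourierInv_smul, h4, hŵ, FourierTransform.fourierInv_fourier_eq]

lemma memLp_bracket {σ : ℝ} (hσ : (d : ℝ) < 2 * σ) :
    MemLp (fun x : Space d => ((bracket x ^ (-σ) : ℝ) : ℂ)) 2 volume := by
  have hc : Continuous fun x : Space d => bracket x ^ (-σ) := by
    unfold bracket
    refine Continuous.rpow_const (by fun_prop) fun x => Or.inl ?_
    positivity
  refine ⟨(Complex.continuous_ofReal.comp hc).aestronglyMeasurable, ?_⟩
  rw [eLpNorm_lt_top_iff_lintegral_rpow_enorm_lt_top (by norm_num) (by norm_num)]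
  have h1 := (integrable_rpow_neg_one_add_norm_sq (E := Space d) (μ := volume) (r := 2 * σ)
    (by rw [finrank_euclideanSpace_fin]; exact hσ)).2
  refine lt_of_eq_of_lt (lintegral_congr fun x => ?_) h1
  simp only [ENNReal.toReal_ofNat, ENNReal.rpow_two]
  rw [← ofReal_norm, ← ofReal_norm, Complex.norm_real, ← ENNReal.ofReal_pow (by positivity),
    ← norm_pow]
  congr 2
  rw [bracket, Real.sqrt_eq_rpow, ← Real.rpow_mul (by positivity), ← Real.rpow_mul_natCast
    (by positivity)]
  congr 1
  push_cast
  ring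

/-- A function of the weighted Sobolev space is the inverse Fourier integral of an integrable
function `F` with `(1 + |ξ|)^N F ∈ L²`. -/
lemma MemWeightedSobolev.exists_synthesis {m σ : ℝ} {N : ℕ} (hN : d < 2 * N) (hNm : (N : ℝ) ≤ m)
    (hσ : (d : ℝ) < 2 * σ) (hσ0 : 0 < σ) {f : Space d → Fiber s} (hfc : Continuous f)
    (hf : MemWeightedSobolev m σ f) :
    ∃ F : Space d → Fiber s, StronglyMeasurable F ∧ Integrable F ∧ weightedEnergy N F < ⊤ ∧
      synthesis F = f ∧ ∀ᵐ ξ, fourierCont f ξ = (twoPiPow d : ℂ) • F ξ := by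
  obtain ⟨w, hwf, hw⟩ := hf
  obtain ⟨W, hWm, hWi, hWE, hWw⟩ := exists_synthesis_of_memSobolev hN hNm hw
  -- Division by $\langle x\rangle^\sigma$ becomes convolution with `ρ` on the Fourier side.
  obtain ⟨ρ, hρp, hρ, hρN⟩ := exists_measure_charFun_bracket (d := d) hσ0
  have hFi := integrable_measureConv hWm hWi ρ
  have hFE := weightedEnergy_measureConv_lt_top N hWm (hρN N) hWE
  have hF2 := memLp_two_of_weightedEnergy hFi.1 hFE
  have hfw : ∀ᵐ x, f x = ((bracket x ^ (-σ) : ℝ) : ℂ) • w x := by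
    filter_upwards [hwf] with x hx
    have : 0 < bracket x := by unfold bracket; positivity
    rw [hx, smul_smul, ← Complex.ofReal_mul, ← Real.rpow_add this, neg_add_cancel, Real.rpow_zero,
      Complex.ofReal_one, one_smul]
  -- The identity is first known almost everywhere and holds everywhere because both sides are
  -- continuous. Pointwise equality is needed, as the lattice equation sees only samples of `f`.
  have hsyn : synthesis (measureConv ρ W) = f := by
    refine (Continuous.ae_eq_iff_eq volume (continuous_synthesis hFi) hfc).1 ?_
    filter_upwards [hfw, hWw] with x h1 h2
    rw [synthesis_measureConv hWm hWi, hρ, h1, h2]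
  -- Here $f=\langle x\rangle^{-\sigma}w$ is a product of two $L^2$ functions because $2\sigma>d$,
  -- so `fourierCont f` is a convergent integral.
  have hf1 : Integrable f := by
    refine Integrable.congr ?_ (EventuallyEq.symm hfw)
    exact memLp_one_iff_integrable.1 ((Lp.memLp w).smul (memLp_bracket hσ))
  have hf2 : MemLp f 2 volume := hsyn ▸ memLp_synthesis hFi hF2
  -- A strongly measurable representative is taken because the periodization evaluates `F` on
  -- countably many translates.
  have hmk := hFi.1.ae_eq_mk
  have hsyn' : synthesis (hFi.1.mk _) = f := by
    rw [← hsyn]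
    funext x
    refine integral_congr_ae ?_
    filter_upwards [hmk] with ξ hξ
    rw [hξ]
  refine ⟨hFi.1.mk _, hFi.1.stronglyMeasurable_mk, hFi.congr hmk, ?_, hsyn', ?_⟩
  · refine lt_of_eq_of_lt (lintegral_congr_ae ?_) hFE
    filter_upwards [hmk] with ξ hξ
    rw [hξ]
  · have h1 := fourierL2_toLp_synthesis hFi hF2
    have h2 : (memLp_synthesis hFi hF2).toLp (synthesis (measureConv ρ W)) = hf2.toLp f := by
      congr 1
    rw [h2] at h1
    have h3 := (quasiMeasurePreserving_smul (d := d) (inv_ne_zero two_pi_ne_zero)).ae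
      (fourier_toLp_ae hf1 hf2)
    filter_upwards [h1, h3, hmk] with ξ h1 h3 h4
    rw [← h4, ← h1, fourierL2, h3, fourierCont, Real.fourier_eq']
    congr 1
    refine integral_congr_ae (ae_of_all _ fun x => ?_)
    simp only [inner_smul_right]
    congr 2
    push_cast
    have : (Real.pi : ℂ) ≠ 0 := by exact_mod_cast Real.pi_ne_zero
    field_simp

end Sobolev

/-! ### Fourier series on the cell -/

section Cell

variable {d s : ℕ}

/-- The half open cell `(-π/h, π/h]^d`. -/
def halfOpenCell (d : ℕ) (h : ℝ) : Set (Space d) :=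
  {ξ | ∀ k, ξ k ∈ Set.Ioc (-(Real.pi / h)) (Real.pi / h)}

lemma measurableSet_halfOpenCell (h : ℝ) : MeasurableSet (halfOpenCell d h) := by
  have : halfOpenCell d h = ⋂ k, {ξ | ξ k ∈ Set.Ioc (-(Real.pi / h)) (Real.pi / h)} := by
    ext; simp [halfOpenCell]
  rw [this]
  refine MeasurableSet.iInter fun k => ?_
  have hk : Measurable fun ξ : Space d => ξ k := by fun_prop
  exact hk measurableSet_Ioc

lemma measurableSet_cell (h : ℝ) : MeasurableSet (cell d h) := by
  have : cell d h = ⋂ k, {ξ | |ξ k| ≤ Real.pi / h} := by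
    ext; simp [cell]
  rw [this]
  refine MeasurableSet.iInter fun k => ?_
  have hk : Measurable fun ξ : Space d => |ξ k| := by fun_prop
  exact hk measurableSet_Iic

/-- The half open cell is an exact fundamental domain of $(2\pi/h)\mathbf Z^d$, while the transforms
are defined on the closed cell; the two are interchangeable in integrals. -/
lemma halfOpenCell_ae_eq (h : ℝ) : halfOpenCell d h =ᵐ[volume] cell d h := by
  have h1 : (Set.univ.pi fun _ : Fin d => Set.Ioc (-(Real.pi / h)) (Real.pi / h)) =ᵐ[volume]
      Set.Icc (fun _ => -(Real.pi / h)) (fun _ => Real.pi / h) := Measure.univ_pi_Ioc_ae_eq_Icc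
  have h2 := (PiLp.volume_preserving_ofLp (Fin d)).quasiMeasurePreserving.preimage_ae_eq h1
  have h3 : halfOpenCell d h = WithLp.ofLp ⁻¹'
      (Set.univ.pi fun _ : Fin d => Set.Ioc (-(Real.pi / h)) (Real.pi / h)) := by
    ext ξ; simp [halfOpenCell]
  have h4 : cell d h = WithLp.ofLp ⁻¹'
      (Set.Icc (fun _ : Fin d => -(Real.pi / h)) (fun _ => Real.pi / h)) := by
    ext ξ; simp [cell, Pi.le_def, abs_le, forall_and]
  rw [h3, h4]
  exact h2

attribute [local instance] instMeasureSpaceUnitAddCircle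

/-- The parametrization of the cell by the torus `(ℝ/ℤ)^d`. -/
def cellParam (d : ℕ) (h : ℝ) (x : UnitAddTorus (Fin d)) : Space d :=
  (2 * Real.pi / h) • WithLp.toLp 2
    ((UnitAddTorus.measurableEquivPiIoc (fun _ : Fin d => -(1 / 2 : ℝ)) x : Fin d → ℝ))

lemma measurable_cellParam (h : ℝ) : Measurable (cellParam d h) := by
  unfold cellParam
  refine (measurable_const_smul (α := Space d) (2 * Real.pi / h)).comp ?_
  exact (WithLp.measurable_toLp 2 _).comp
    (measurable_subtype_coe.comp (MeasurableEquiv.measurable _))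

/-- The unit cube carries the Haar probability of the torus, and dilation by $2\pi/h$ multiplies
volumes by $(2\pi/h)^d$. This transports the Fourier basis of $L^2((\mathbf R/\mathbf Z)^d)$ to the
cell. -/
lemma map_cellParam {h : ℝ} (hh : 0 < h) :
    Measure.map (cellParam d h) volume =
      ENNReal.ofReal ((h / (2 * Real.pi)) ^ d) • volume.restrict (cell d h) := by
  have hc : 2 * Real.pi / h ≠ 0 := by positivity
  have h1 := (UnitAddTorus.measurePreserving_equivPiIoc (fun _ : Fin d => -(1 / 2 : ℝ)))
  let C : Set (Fin d → ℝ) := {x | ∀ i, x i ∈ Set.Ioc (-(1 / 2 : ℝ)) (-(1 / 2) + 1)}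
  have hC : MeasurableSet C := MeasurableSet.univ_pi' fun _ => measurableSet_Ioc
  have h2 : Measure.map (Subtype.val : C → (Fin d → ℝ)) (Measure.comap Subtype.val volume) =
      volume.restrict C := map_comap_subtype_coe hC volume
  have h3 : cellParam d h = (fun ξ : Space d => (2 * Real.pi / h) • ξ) ∘
      (WithLp.toLp 2 : (Fin d → ℝ) → Space d) ∘ (Subtype.val : C → (Fin d → ℝ)) ∘
      (UnitAddTorus.measurableEquivPiIoc (fun _ : Fin d => -(1 / 2 : ℝ))) := rfl
  have hm1 : Measurable (Subtype.val : C → (Fin d → ℝ)) := measurable_subtype_coe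
  have hm2 : Measurable (WithLp.toLp 2 : (Fin d → ℝ) → Space d) := WithLp.measurable_toLp 2 _
  have hm3 : Measurable (fun ξ : Space d => (2 * Real.pi / h) • ξ) := measurable_const_smul _
  rw [h3, ← Measure.map_map hm3 (hm2.comp (hm1.comp (MeasurableEquiv.measurable _))),
    ← Measure.map_map hm2 (hm1.comp (MeasurableEquiv.measurable _)),
    ← Measure.map_map hm1 (MeasurableEquiv.measurable _), h1.map_eq]
  erw [h2]
  have h4 : C = ((fun ξ : Space d => (2 * Real.pi / h) • ξ) ∘ (WithLp.toLp 2)) ⁻¹'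
      halfOpenCell d h := by
    ext y
    simp only [C, halfOpenCell, Set.mem_ofPred_eq, Set.mem_preimage, Function.comp_apply, Set.mem_Ioc, PiLp.smul_apply,
      smul_eq_mul]
    refine forall_congr' fun k => and_congr ?_ ?_
    · rw [← mul_lt_mul_iff_right₀ (show 0 < 2 * Real.pi / h by positivity)]
      rw [show 2 * Real.pi / h * -(1 / 2) = -(Real.pi / h) by ring]
    · rw [← mul_le_mul_iff_right₀ (show 0 < 2 * Real.pi / h by positivity)]
      rw [show 2 * Real.pi / h * (-(1 / 2) + 1) = Real.pi / h by ring]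
  rw [Measure.map_map hm3 hm2, h4]
  rw [← Measure.restrict_map (hm3.comp hm2) (measurableSet_halfOpenCell h),
    ← Measure.map_map hm3 hm2, (PiLp.volume_preserving_toLp (Fin d)).map_eq,
    Measure.map_addHaar_smul _ hc, Measure.restrict_smul,
    Measure.restrict_congr_set (halfOpenCell_ae_eq h), finrank_euclideanSpace_fin,
    abs_of_pos (by positivity), ← inv_pow, inv_div]

lemma mFourier_eq_cellParam {h : ℝ} (hh : 0 < h) (n : Fin d → ℤ) (x : UnitAddTorus (Fin d)) :
    UnitAddTorus.mFourier n x =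
      Complex.exp (Complex.I * (h * phase n (cellParam d h x) : ℝ)) := by
  have h1 : x = fun i => (((UnitAddTorus.measurableEquivPiIoc (fun _ : Fin d => -(1 / 2 : ℝ)) x :
      Fin d → ℝ) i : ℝ) : UnitAddCircle) := by
    rw [← UnitAddTorus.coe_symm_measurableEquivPiIoc_apply, MeasurableEquiv.symm_apply_apply]
  conv_lhs => rw [h1]
  rw [UnitAddTorus.mFourier, ContinuousMap.coe_mk]
  simp only [fourier_coe_apply]
  rw [← Complex.exp_sum]
  congr 1
  simp only [phase, cellParam, PiLp.smul_apply, smul_eq_mul]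
  rw [Finset.mul_sum, Complex.ofReal_sum, Finset.mul_sum]
  refine Finset.sum_congr rfl fun i _ => ?_
  push_cast
  have : (h : ℂ) ≠ 0 := by exact_mod_cast hh.ne'
  field_simp

lemma integral_cellParam {E : Type*} [NormedAddCommGroup E] [NormedSpace ℝ E] {h : ℝ}
    (hh : 0 < h) {φ : Space d → E} (hφ : AEStronglyMeasurable φ (volume.restrict (cell d h))) :
    ∫ x, φ (cellParam d h x) = ((h / (2 * Real.pi)) ^ d) • ∫ ξ in cell d h, φ ξ := by
  have h1 := integral_map (μ := volume) (measurable_cellParam (d := d) h).aemeasurable (f := φ)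
    (by rw [map_cellParam hh]; exact hφ.smul_measure _)
  rw [← h1, map_cellParam hh, integral_smul_measure, ENNReal.toReal_ofReal (by positivity)]

lemma continuous_phase (n : Fin d → ℤ) : Continuous (phase n : Space d → ℝ) := by
  unfold phase; fun_prop

lemma continuous_exp_phase (h : ℝ) (n : Fin d → ℤ) :
    Continuous fun ξ : Space d => Complex.exp (Complex.I * (h * phase n ξ : ℝ)) := by
  have := continuous_phase n
  fun_prop

lemma integral_cell_exp {h : ℝ} (hh : 0 < h) (n : Fin d → ℤ) :
    ∫ ξ in cell d h, Complex.exp (Complex.I * (h * phase n ξ : ℝ)) =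
      if n = 0 then ((((2 * Real.pi) / h) ^ d : ℝ) : ℂ) else 0 := by
  have h1 := integral_cellParam (d := d) hh (continuous_exp_phase h n).aestronglyMeasurable
  simp_rw [← mFourier_eq_cellParam hh] at h1
  have h2 := orthonormal_iff_ite.1 (UnitAddTorus.orthonormal_mFourier (d := Fin d)) 0 n
  rw [ContinuousMap.inner_toLp] at h2
  simp only [UnitAddTorus.mFourier_zero, ContinuousMap.one_apply, map_one, mul_one] at h2
  rw [h2] at h1
  have h3 : ((2 * Real.pi / h) ^ d : ℝ) * (h / (2 * Real.pi)) ^ d = 1 := by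
    rw [← mul_pow, div_mul_div_cancel₀' (by positivity), div_self (by positivity), one_pow]
  have h4 := congrArg (fun c : ℂ => ((2 * Real.pi / h) ^ d : ℝ) • c) h1
  simp only [smul_smul, h3, one_smul] at h4
  rw [← h4]
  by_cases hn : n = 0
  · simp [hn]
  · simp [hn, Ne.symm hn]

/-- Completeness of the exponentials on the cell, pulled back to the Hilbert basis
`UnitAddTorus.mFourierBasis`. -/
lemma ae_eq_zero_of_integral_exp_eq_zero {h : ℝ} (hh : 0 < h) {φ : Space d → ℂ}
    (hφ : MemLp φ 2 (volume.restrict (cell d h)))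
    (h0 : ∀ n : Fin d → ℤ, ∫ ξ in cell d h, Complex.exp (Complex.I * (h * phase n ξ : ℝ)) • φ ξ = 0) :
    φ =ᵐ[volume.restrict (cell d h)] 0 := by
  have hφ' : MemLp φ 2 (Measure.map (cellParam d h) volume) := by
    rw [map_cellParam hh]; exact hφ.smul_measure ENNReal.ofReal_ne_top
  have hm := (measurable_cellParam (d := d) h).aemeasurable (μ := volume)
  have hψ := hφ'.comp_of_map hm
  have h1 : hψ.toLp _ = 0 := by
    refine (UnitAddTorus.mFourierBasis (d := Fin d)).repr.injective ?_
    rw [map_zero]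
    ext n
    rw [UnitAddTorus.mFourierBasis_repr, UnitAddTorus.mFourierCoeff]
    have h2 : ∫ t, UnitAddTorus.mFourier (-n) t • (hψ.toLp _) t =
        ∫ t, (fun ξ => Complex.exp (Complex.I * (h * phase (-n) ξ : ℝ)) • φ ξ) (cellParam d h t) := by
      refine integral_congr_ae ?_
      filter_upwards [hψ.coeFn_toLp] with t ht
      rw [ht, mFourier_eq_cellParam hh]
      rfl
    have h3 := integral_cellParam (φ := fun ξ =>
      Complex.exp (Complex.I * (h * phase (-n) ξ : ℝ)) • φ ξ) hh
      ((continuous_exp_phase h (-n)).aestronglyMeasurable.smul hφ.1)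
    rw [h0, smul_zero] at h3
    exact h2.trans h3
  have h3 : eLpNorm φ 2 (Measure.map (cellParam d h) volume) = 0 := by
    rw [eLpNorm_map_measure hφ'.1 hm, ← Lp.enorm_toLp (hf := hψ), h1, enorm_zero]
  rw [eLpNorm_eq_zero_iff hφ'.1 (by norm_num), map_cellParam hh] at h3
  refine h3.filter_mono ?_
  refine Measure.AbsolutelyContinuous.ae_le ?_
  exact Measure.absolutelyContinuous_smul (by rw [Ne, ENNReal.ofReal_eq_zero, not_le]; positivity)

end Cell

/-! ### The discrete Fourier transform and its coefficients. -/

section DiscFourier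

variable {d s : ℕ}

/-- The constant `(h/2π)^{d/2}`. -/
def modeConst (d : ℕ) (h : ℝ) : ℝ := (h / (2 * Real.pi)) ^ ((d : ℝ) / 2)

lemma modeConst_pos {h : ℝ} (hh : 0 < h) : 0 < modeConst d h := by
  unfold modeConst; positivity

lemma modeConst_mul_self {h : ℝ} (hh : 0 < h) :
    modeConst d h * modeConst d h = (h / (2 * Real.pi)) ^ d := by
  unfold modeConst
  rw [← Real.rpow_add (by positivity), add_halves, Real.rpow_natCast]

lemma ae_eq_zero_of_integral_exp_smul_eq_zero {h : ℝ} (hh : 0 < h) {φ : Space d → Fiber s}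
    (hφ : MemLp φ 2 (volume.restrict (cell d h)))
    (h0 : ∀ n : Fin d → ℤ, ∫ ξ in cell d h, Complex.exp (Complex.I * (h * phase n ξ : ℝ)) • φ ξ = 0) :
    φ =ᵐ[volume.restrict (cell d h)] 0 := by
  have hφi : Integrable φ (volume.restrict (cell d h)) := hφ.integrable (by norm_num)
  have h1 : ∀ i : Fin s, ∀ᵐ ξ ∂(volume.restrict (cell d h)), φ ξ i = 0 := by
    intro i
    let π : Fiber s →L[ℂ] ℂ := EuclideanSpace.proj i
    refine ae_eq_zero_of_integral_exp_eq_zero (φ := fun ξ => π (φ ξ)) hh (π.comp_memLp' hφ) fun n => ?_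
    have h2 := π.integral_comp_comm (μ := volume.restrict (cell d h))
      (φ := fun ξ => Complex.exp (Complex.I * (h * phase n ξ : ℝ)) • φ ξ)
      (hφi.bdd_smul 1 (continuous_exp_phase h n).aestronglyMeasurable
        (ae_of_all _ fun ξ => by rw [norm_exp_I_mul_ofReal]))
    rw [h0, map_zero] at h2
    simpa only [map_smul] using h2
  filter_upwards [ae_all_iff.2 h1] with ξ hξ
  ext i
  exact hξ i

lemma inner_toLp_mode {h : ℝ} (hh : 0 < h) (n m : Fin d → ℤ) (a b : Fiber s) :
    inner ℂ ((memLp_mode h n a).toLp (mode h n a)) ((memLp_mode h m b).toLp (mode h m b)) =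
      if n = m then inner ℂ a b else 0 := by
  rw [L2.inner_def]
  have h1 : ∫ ξ in cell d h, inner ℂ ((memLp_mode h n a).toLp (mode h n a) ξ)
      ((memLp_mode h m b).toLp (mode h m b) ξ) = ∫ ξ in cell d h,
      (((modeConst d h * modeConst d h : ℝ) : ℂ) * inner ℂ a b) *
        Complex.exp (Complex.I * (h * phase (n - m) ξ : ℝ)) := by
    refine integral_congr_ae ?_
    filter_upwards [(memLp_mode h n a).coeFn_toLp, (memLp_mode h m b).coeFn_toLp] with ξ h1 h2
    rw [h1, h2]
    simp only [mode, inner_smul_left, inner_smul_right, ← Complex.exp_conj]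
    have h3 : Complex.exp (Complex.I * (h * phase (n - m) ξ : ℝ)) =
        Complex.exp (-(Complex.I * (h * phase m ξ : ℝ))) *
        Complex.exp ((starRingEnd ℂ) (-(Complex.I * (h * phase n ξ : ℝ)))) := by
      rw [← Complex.exp_add]
      congr 1
      simp only [phase, map_neg, map_mul, Complex.conj_I, Complex.conj_ofReal, Pi.sub_apply,
        Int.cast_sub, sub_mul, Finset.sum_sub_distrib]
      push_cast
      ring
    rw [h3, Complex.conj_ofReal]
    unfold modeConst
    push_cast
    ring
  rw [h1, integral_const_mul, integral_cell_exp hh]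
  by_cases hnm : n = m
  · rw [if_pos hnm, if_pos (by rw [hnm, sub_self]), mul_right_comm, ← Complex.ofReal_mul,
      modeConst_mul_self hh, ← mul_pow, div_mul_div_cancel₀' (by positivity),
      div_self (by positivity), one_pow, Complex.ofReal_one, one_mul]
  · rw [if_neg hnm, if_neg (by rwa [sub_eq_zero]), mul_zero]

/-- The map `a ↦ (h/2π)^{d/2} e^{-ihn·ξ} a` into `L²` of the cell. -/
def modeIsometry (s : ℕ) {h : ℝ} (hh : 0 < h) (n : Fin d → ℤ) :
    Fiber s →ₗᵢ[ℂ] Lp (Fiber s) 2 ((volume : Measure (Space d)).restrict (cell d h)) where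
  toFun a := (memLp_mode h n a).toLp (mode h n a)
  map_add' a b := by
    rw [← MemLp.toLp_add]
    congr 1
    funext ξ
    simp only [mode, smul_add, Pi.add_apply]
  map_smul' c a := by
    rw [RingHom.id_apply, ← MemLp.toLp_const_smul]
    congr 1
    funext ξ
    simp only [mode, Pi.smul_apply]
    rw [smul_comm _ c, smul_comm _ c]
  norm_map' a := by
    have h1 := inner_toLp_mode hh n n a a
    rw [if_pos rfl, inner_self_eq_norm_sq_to_K, inner_self_eq_norm_sq_to_K] at h1
    have h2 : ‖(memLp_mode h n a).toLp (mode h n a)‖ ^ 2 = ‖a‖ ^ 2 := by exact_mod_cast h1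
    exact (sq_eq_sq₀ (norm_nonneg _) (norm_nonneg _)).1 h2

lemma orthogonalFamily_modeIsometry {h : ℝ} (hh : 0 < h) :
    OrthogonalFamily ℂ (fun _ : Fin d → ℤ => Fiber s) (modeIsometry s hh) := by
  intro n m hnm a b
  exact (inner_toLp_mode hh n m a b).trans (if_neg hnm)

/-- The modes are pairwise orthogonal isometric copies of the fiber, so square summability of `u`
makes the series converge. -/
lemma hasSum_discFourier {h : ℝ} (hh : 0 < h) {u : (Fin d → ℤ) → Fiber s} (hu : Memℓp u 2) :
    HasSum (fun n => (memLp_mode h n (u n)).toLp (mode h n (u n))) (discFourier h u) :=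
  ((orthogonalFamily_modeIsometry hh).summable_of_lp ⟨u, hu⟩).hasSum

lemma inner_mode_discFourier {h : ℝ} (hh : 0 < h) {u : (Fin d → ℤ) → Fiber s} (hu : Memℓp u 2)
    (n : Fin d → ℤ) (a : Fiber s) :
    inner ℂ ((memLp_mode h n a).toLp (mode h n a)) (discFourier h u) = inner ℂ a (u n) := by
  have h1 := (hasSum_discFourier hh hu).mapL
    (innerSL ℂ ((memLp_mode h n a).toLp (mode h n a)))
  simp only [innerSL_apply_apply, inner_toLp_mode hh] at h1
  have h2 : (fun m => if n = m then inner ℂ a (u m) else 0) =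
      fun m => if m = n then inner ℂ a (u n) else 0 := by
    funext m
    by_cases hm : m = n
    · simp [hm]
    · simp [hm, Ne.symm hm]
  rw [h2] at h1
  exact h1.unique (hasSum_ite_eq n _)

lemma integrable_discFourier (h : ℝ) (u : (Fin d → ℤ) → Fiber s) :
    Integrable (discFourier h u) (volume.restrict (cell d h)) :=
  (Lp.memLp _).integrable (by norm_num)

lemma integrable_exp_phase_smul {h : ℝ} {φ : Space d → Fiber s}
    (hφ : Integrable φ (volume.restrict (cell d h))) (n : Fin d → ℤ) :
    Integrable (fun ξ => Complex.exp (Complex.I * (h * phase n ξ : ℝ)) • φ ξ)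
      (volume.restrict (cell d h)) :=
  hφ.bdd_smul 1 (continuous_exp_phase h n).aestronglyMeasurable
    (ae_of_all _ fun ξ => by rw [norm_exp_I_mul_ofReal])

/-- The Fourier coefficients of the discrete Fourier transform. -/
lemma integral_exp_discFourier {h : ℝ} (hh : 0 < h) {u : (Fin d → ℤ) → Fiber s}
    (hu : Memℓp u 2) (n : Fin d → ℤ) :
    ∫ ξ in cell d h, Complex.exp (Complex.I * (h * phase n ξ : ℝ)) • discFourier h u ξ =
      (((modeConst d h)⁻¹ : ℝ) : ℂ) • u n := by
  refine ext_inner_left ℂ fun a => ?_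
  rw [← integral_inner (integrable_exp_phase_smul (integrable_discFourier h u) n),
    inner_smul_right, ← inner_mode_discFourier hh hu, L2.inner_def, ← integral_const_mul]
  refine integral_congr_ae ?_
  filter_upwards [(memLp_mode h n a).coeFn_toLp] with ξ h1
  rw [h1]
  simp only [mode, inner_smul_left, inner_smul_right, ← Complex.exp_conj, map_neg, map_mul,
    Complex.conj_I, Complex.conj_ofReal, neg_mul, neg_neg]
  rw [← mul_assoc, ← mul_assoc, show ((h / (2 * Real.pi)) ^ ((d : ℝ) / 2)) = modeConst d h from rfl,
    ← Complex.ofReal_mul, inv_mul_cancel₀ (modeConst_pos hh).ne', Complex.ofReal_one, one_mul]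

end DiscFourier

/-! ### The lattice Laplacian as a Fourier multiplier. -/

section Lattice

variable {d s : ℕ} (G : PeriodicGraph d s)

lemma latticeVec_injective (b : Module.Basis (Fin d) ℝ (Space d)) :
    Function.Injective (latticeVec b) := by
  intro n m h
  funext k
  have h1 := congrArg (fun v => b.repr v k) h
  simp only [latticeVec, Module.Basis.repr_sum_self] at h1
  exact_mod_cast h1

namespace PeriodicGraph

lemma finite_translations (j i : Fin s) :
    {m : Fin d → ℤ | G.Adj (G.vertex j 0) (G.vertex i m)}.Finite := by
  refine Set.Finite.of_finite_image (f := G.vertex i) ((G.finite_adjacent j 0).subset ?_) ?_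
  · rintro _ ⟨m, hm, rfl⟩
    exact hm
  · intro n _ m _ h
    exact latticeVec_injective G.basis (add_left_cancel h)

/-- The `m ∈ ℤ^d` for which `pᵢ + 𝐯(m)` is adjacent to `pⱼ`. -/
def translations (j i : Fin s) : Finset (Fin d → ℤ) := (G.finite_translations j i).toFinset

lemma mem_translations {j i : Fin s} {m : Fin d → ℤ} :
    m ∈ G.translations j i ↔ G.Adj (G.vertex j 0) (G.vertex i m) := by
  simp [translations]

lemma symbol_apply (η : Space d) (j i : Fin s) :
    G.symbol η j i = -(1 / (G.degree : ℂ)) *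
      ∑ m ∈ G.translations j i, Complex.exp (Complex.I * (phase m η : ℂ)) := by
  rw [symbol, Matrix.of_apply, finsum_mem_eq_finite_toFinset_sum _ (G.finite_translations j i)]
  rfl

/-- Translation invariance of the edges: the neighbours of the vertex $(j,n)$ are those of $(j,0)$
moved by $n$, so the same finite index sets serve for every $n$. -/
lemma finsum_adj_eq (j : Fin s) (n : Fin d → ℤ) (φ : Fin s × (Fin d → ℤ) → ℂ) :
    ∑ᶠ q ∈ {q : Fin s × (Fin d → ℤ) | G.Adj (G.vertex j n) (G.vertex q.1 q.2)}, φ q =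
      ∑ i, ∑ m ∈ G.translations j i, φ (i, n + m) := by
  classical
  rw [Finset.sum_sigma' Finset.univ (fun i => G.translations j i) fun i m => φ (i, n + m)]
  have hinj : Function.Injective fun p : (_ : Fin s) × (Fin d → ℤ) => (p.1, n + p.2) := by
    rintro ⟨i, m⟩ ⟨i', m'⟩ h
    simp only [Prod.mk.injEq, add_right_inj] at h
    obtain ⟨rfl, rfl⟩ := h
    rfl
  have hset : {q : Fin s × (Fin d → ℤ) | G.Adj (G.vertex j n) (G.vertex q.1 q.2)} =
      ((Finset.univ.sigma fun i => G.translations j i).image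
        fun p : (_ : Fin s) × (Fin d → ℤ) => (p.1, n + p.2) : Finset _) := by
    ext ⟨i, m⟩
    simp only [Set.mem_ofPred_eq, Finset.coe_image, Set.mem_image, Finset.mem_coe,
      Finset.mem_sigma, Finset.mem_univ, true_and, mem_translations, Sigma.exists, Prod.mk.injEq]
    constructor
    · intro h
      refine ⟨i, m - n, ?_, rfl, by abel⟩
      have := G.adj_translate (-n) h
      simpa [sub_eq_add_neg] using this
    · rintro ⟨i', m', h, rfl, rfl⟩
      have := G.adj_translate n h
      simpa [add_comm] using this
  rw [hset, finsum_mem_coe_finset, Finset.sum_image hinj.injOn]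

/-- The operator on `ℂ^s` with matrix `𝓛_h` at `ξ + d_h`. -/
def symbolOp (E₀ ν : ℝ) (d₁ : Space d) (h : ℝ) (ξ : Space d) : Fiber s →L[ℂ] Fiber s :=
  Matrix.toEuclideanCLM (𝕜 := ℂ) (G.scaledSymbol E₀ ν h (ξ + h⁻¹ • d₁))

lemma phase_add (n m : Fin d → ℤ) (ξ : Space d) : phase (n + m) ξ = phase n ξ + phase m ξ := by
  simp [phase, add_mul, Finset.sum_add_distrib]

lemma phase_smul (n : Fin d → ℤ) (c : ℝ) (ξ : Space d) : phase n (c • ξ) = c * phase n ξ := by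
  simp only [phase, PiLp.smul_apply, smul_eq_mul, Finset.mul_sum]
  exact Finset.sum_congr rfl fun k _ => by ring

lemma phase_add_right (n : Fin d → ℤ) (ξ η : Space d) :
    phase n (ξ + η) = phase n ξ + phase n η := by
  simp [phase, mul_add, Finset.sum_add_distrib]

lemma symbolOp_apply (E₀ ν : ℝ) (d₁ : Space d) {h : ℝ} (hh : 0 < h) (ξ : Space d) (v : Fiber s)
    (j : Fin s) :
    G.symbolOp E₀ ν d₁ h ξ v j = ((h ^ (-ν) : ℝ) : ℂ) *
      (-(1 / (G.degree : ℂ)) * ∑ i, ∑ m ∈ G.translations j i,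
        Complex.exp (Complex.I * (phase m d₁ : ℂ)) *
          (Complex.exp (Complex.I * (h * phase m ξ : ℝ)) * v i) - (E₀ : ℂ) * v j) := by
  have h1 : G.symbolOp E₀ ν d₁ h ξ v j =
      ∑ i, G.scaledSymbol E₀ ν h (ξ + h⁻¹ • d₁) j i * v i := by
    rw [symbolOp, Matrix.ofLp_toEuclideanCLM]
    rfl
  rw [h1]
  have h2 : ∀ i, G.scaledSymbol E₀ ν h (ξ + h⁻¹ • d₁) j i * v i = ((h ^ (-ν) : ℝ) : ℂ) *
      (-(1 / (G.degree : ℂ)) * ∑ m ∈ G.translations j i,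
        Complex.exp (Complex.I * (phase m d₁ : ℂ)) *
          (Complex.exp (Complex.I * (h * phase m ξ : ℝ)) * v i)
        - (E₀ : ℂ) * if j = i then v i else 0) := by
    intro i
    rw [scaledSymbol, Matrix.smul_apply, shiftedSymbol, Matrix.sub_apply, symbol_apply,
      Matrix.smul_apply, Matrix.one_apply, smul_eq_mul, smul_eq_mul, mul_assoc, sub_mul, mul_assoc,
      mul_assoc, Finset.sum_mul]
    congr 2
    · congr 1
      refine Finset.sum_congr rfl fun m _ => ?_
      rw [← mul_assoc, ← Complex.exp_add]
      congr 2
      rw [phase_smul, phase_add_right, phase_smul, mul_add, mul_inv_cancel_left₀ hh.ne']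
      push_cast
      ring
    · split_ifs <;> simp
  rw [Finset.sum_congr rfl fun i _ => h2 i, ← Finset.mul_sum, Finset.sum_sub_distrib,
    ← Finset.mul_sum, ← Finset.mul_sum]
  simp

/-- The phase $e^{in\cdot d_1}$ cancels between the gauge transformation and its adjoint; each hop
by $m$ keeps the factor $e^{im\cdot d_1}$, which shifts the symbol by $d_h$. -/
lemma gauge_laplacian_apply (E₀ ν : ℝ) (d₁ : Space d) {h : ℝ} (hh : 0 < h)
    (u : (Fin d → ℤ) → Fiber s) (n : Fin d → ℤ) (j : Fin s) :
    (-gaugeAdjoint h d₁ (G.discLaplacian E₀ ν h (gauge h d₁ u)) n) j = ((h ^ (-ν) : ℝ) : ℂ) *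
      (-(1 / (G.degree : ℂ)) * ∑ i, ∑ m ∈ G.translations j i,
        Complex.exp (Complex.I * (phase m d₁ : ℂ)) * u (n + m) i - (E₀ : ℂ) * u n j) := by
  have hp : ∀ n : Fin d → ℤ, h * phase n (h⁻¹ • d₁) = phase n d₁ := fun n => by
    rw [phase_smul, mul_inv_cancel_left₀ hh.ne']
  simp only [gaugeAdjoint, discLaplacian, gauge, laplacian, hp, PiLp.neg_apply, PiLp.smul_apply,
    PiLp.add_apply, smul_eq_mul, finsum_adj_eq]
  have h1 : ∀ i, ∀ m, Complex.exp (Complex.I * (phase (n + m) d₁ : ℂ)) * u (n + m) i =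
      Complex.exp (Complex.I * (phase n d₁ : ℂ)) *
        (Complex.exp (Complex.I * (phase m d₁ : ℂ)) * u (n + m) i) := by
    intro i m
    rw [phase_add, ← mul_assoc, ← Complex.exp_add]
    congr 2
    push_cast
    ring
  simp only [h1, ← Finset.mul_sum]
  have h2 : Complex.exp (-(Complex.I * (phase n d₁ : ℂ))) *
      Complex.exp (Complex.I * (phase n d₁ : ℂ)) = 1 := by
    rw [← Complex.exp_add, neg_add_cancel, Complex.exp_zero]
  linear_combination (-((h ^ (-ν) : ℝ) : ℂ) * (1 / (G.degree : ℂ) * (∑ i, ∑ m ∈ G.translations j i,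
        Complex.exp (Complex.I * (phase m d₁ : ℂ)) * u (n + m) i) + (E₀ : ℂ) * u n j)) * h2

/-- The operator on `ℂ^s` with matrix `𝓛(e^{-iη}) - E₀`. -/
def shiftedOp (E₀ : ℝ) (η : Space d) : Fiber s →L[ℂ] Fiber s :=
  Matrix.toEuclideanCLM (𝕜 := ℂ) (G.shiftedSymbol E₀ η)

lemma symbolOp_eq (E₀ ν : ℝ) (d₁ : Space d) {h : ℝ} (hh : 0 < h) (ξ : Space d) :
    G.symbolOp E₀ ν d₁ h ξ = ((h ^ (-ν) : ℝ) : ℂ) • G.shiftedOp E₀ (h • ξ + d₁) := by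
  rw [symbolOp, scaledSymbol, map_smul, smul_add, smul_inv_smul₀ hh.ne']
  rfl

/-- The entries are trigonometric polynomials, since each vertex has finitely many neighbours.
Analyticity, beyond continuity, is what separates the two eigenprojections of the symmetric pair. -/
lemma analyticAt_shiftedOp (E₀ : ℝ) (η : Space d) : AnalyticAt ℝ (G.shiftedOp E₀) η := by
  have h1 : G.shiftedOp E₀ = fun η => ∑ j, ∑ i, G.shiftedSymbol E₀ η j i •
      Matrix.toEuclideanCLM (𝕜 := ℂ) (Matrix.single j i (1 : ℂ)) := by
    funext η
    rw [shiftedOp]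
    conv_lhs => rw [Matrix.matrix_eq_sum_single (G.shiftedSymbol E₀ η)]
    simp only [map_sum, ← map_smul, Matrix.smul_single, smul_eq_mul, mul_one]
  rw [h1]
  refine Finset.analyticAt_fun_sum _ fun j _ => Finset.analyticAt_fun_sum _ fun i _ => ?_
  have h3 : AnalyticAt ℝ (fun η => G.shiftedSymbol E₀ η j i) η := by
    simp only [shiftedSymbol, Matrix.sub_apply, symbol_apply]
    refine AnalyticAt.sub (analyticAt_const.mul ?_) analyticAt_const
    refine Finset.analyticAt_fun_sum _ fun m _ => ?_
    have h2 : AnalyticAt ℝ (fun η : Space d => (phase m η : ℂ)) η := by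
      let L : Space d →L[ℝ] ℂ := Complex.ofRealCLM.comp
        (∑ k, (m k : ℝ) • (EuclideanSpace.proj k : Space d →L[ℝ] ℝ))
      have hL : (fun η : Space d => (phase m η : ℂ)) = L := by
        funext η
        simp [L, phase]
      rw [hL]
      exact L.analyticAt η
    have h4 : AnalyticAt ℝ Complex.exp (Complex.I * (phase m η : ℂ)) :=
      AnalyticAt.restrictScalars (𝕜 := ℝ) (𝕜' := ℂ) analyticAt_cexp
    exact h4.fun_comp (f := fun η : Space d => Complex.I * (phase m η : ℂ)) (analyticAt_const.mul h2)
  exact h3.smul analyticAt_const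

lemma continuous_shiftedOp (E₀ : ℝ) : Continuous (G.shiftedOp E₀) :=
  continuous_iff_continuousAt.2 fun η => (G.analyticAt_shiftedOp E₀ η).continuousAt

lemma continuous_symbolOp (E₀ ν : ℝ) (d₁ : Space d) {h : ℝ} (hh : 0 < h) :
    Continuous (G.symbolOp E₀ ν d₁ h) := by
  rw [funext (G.symbolOp_eq E₀ ν d₁ hh)]
  have h1 : Continuous fun ξ : Space d => h • ξ + d₁ := by fun_prop
  exact ((G.continuous_shiftedOp E₀).comp h1).const_smul ((h ^ (-ν) : ℝ) : ℂ)

lemma memLp_clm_apply {μ : Measure (Space d)} {A : Space d → Fiber s →L[ℂ] Fiber s}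
    (hA : AEStronglyMeasurable A μ) {C : ℝ} (hC : ∀ᵐ ξ ∂μ, ‖A ξ‖ ≤ C) {φ : Space d → Fiber s}
    {p : ℝ≥0∞} (hφ : MemLp φ p μ) : MemLp (fun ξ => A ξ (φ ξ)) p μ := by
  refine hφ.of_le_mul (c := C) ?_ ?_
  · exact isBoundedBilinearMap_apply.continuous.comp_aestronglyMeasurable (hA.prodMk hφ.1)
  · filter_upwards [hC] with ξ hξ
    exact (A ξ).le_of_opNorm_le hξ _

lemma exists_norm_symbolOp_le (E₀ ν : ℝ) (d₁ : Space d) {h : ℝ} (hh : 0 < h) :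
    ∃ C : ℝ, ∀ᵐ ξ ∂(volume.restrict (cell d h)), ‖G.symbolOp E₀ ν d₁ h ξ‖ ≤ C := by
  have hb : Bornology.IsBounded (cell d h) := by
    refine (Metric.isBounded_closedBall (x := (0 : Space d))
      (r := Real.sqrt (∑ _k : Fin d, (Real.pi / h) ^ 2))).subset ?_
    intro ξ hξ
    rw [mem_closedBall_zero_iff, EuclideanSpace.norm_eq]
    refine Real.sqrt_le_sqrt (Finset.sum_le_sum fun k _ => ?_)
    exact pow_le_pow_left₀ (norm_nonneg _) (hξ k) 2
  obtain ⟨C, hC⟩ := hb.isCompact_closure.exists_bound_of_continuousOn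
    (G.continuous_symbolOp E₀ ν d₁ hh).continuousOn
  refine ⟨C, ?_⟩
  filter_upwards [ae_restrict_mem (measurableSet_cell h)] with ξ hξ
  exact hC ξ (subset_closure hξ)

lemma memLp_symbolOp_discFourier (E₀ ν : ℝ) (d₁ : Space d) {h : ℝ} (hh : 0 < h)
    (u : (Fin d → ℤ) → Fiber s) :
    MemLp (fun ξ => G.symbolOp E₀ ν d₁ h ξ (discFourier h u ξ)) 2 (volume.restrict (cell d h)) := by
  obtain ⟨C, hC⟩ := G.exists_norm_symbolOp_le E₀ ν d₁ hh
  exact memLp_clm_apply (G.continuous_symbolOp E₀ ν d₁ hh).aestronglyMeasurable hC (Lp.memLp _)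

/-- The discrete Fourier transform turns the gauge transformed Laplacian into multiplication by
its symbol. -/
lemma integral_exp_symbolOp_discFourier (E₀ ν : ℝ) (d₁ : Space d) {h : ℝ} (hh : 0 < h)
    {u : (Fin d → ℤ) → Fiber s} (hu : Memℓp u 2) (n : Fin d → ℤ) :
    ∫ ξ in cell d h, Complex.exp (Complex.I * (h * phase n ξ : ℝ)) •
        G.symbolOp E₀ ν d₁ h ξ (discFourier h u ξ) =
      (((modeConst d h)⁻¹ : ℝ) : ℂ) •
        -gaugeAdjoint h d₁ (G.discLaplacian E₀ ν h (gauge h d₁ u)) n := by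
  have hi := integrable_discFourier h u
  have hTi : Integrable (fun ξ => G.symbolOp E₀ ν d₁ h ξ (discFourier h u ξ))
      (volume.restrict (cell d h)) :=
    (G.memLp_symbolOp_discFourier E₀ ν d₁ hh u).integrable (by norm_num)
  have key : ∀ (i : Fin s) (n : Fin d → ℤ),
      Integrable (fun ξ => Complex.exp (Complex.I * (h * phase n ξ : ℝ)) * discFourier h u ξ i)
        (volume.restrict (cell d h)) ∧
      ∫ ξ in cell d h, Complex.exp (Complex.I * (h * phase n ξ : ℝ)) * discFourier h u ξ i =
      (((modeConst d h)⁻¹ : ℝ) : ℂ) * u n i := by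
    intro i n
    have h1 := integrable_exp_phase_smul hi n
    have h2 := (EuclideanSpace.proj i : Fiber s →L[ℂ] ℂ).integral_comp_comm h1
    have h3 := (EuclideanSpace.proj i : Fiber s →L[ℂ] ℂ).integrable_comp h1
    rw [integral_exp_discFourier hh hu] at h2
    exact ⟨h3, h2⟩
  ext j
  have h1 := (EuclideanSpace.proj j : Fiber s →L[ℂ] ℂ).integral_comp_comm
    (integrable_exp_phase_smul hTi n)
  refine (Eq.symm h1).trans ?_
  simp only [PiLp.proj_apply, PiLp.smul_apply, smul_eq_mul]
  rw [gauge_laplacian_apply G E₀ ν d₁ hh]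
  have h2 : ∀ ξ, Complex.exp (Complex.I * (h * phase n ξ : ℝ)) *
      G.symbolOp E₀ ν d₁ h ξ (discFourier h u ξ) j = ((h ^ (-ν) : ℝ) : ℂ) *
      (-(1 / (G.degree : ℂ)) * ∑ i, ∑ m ∈ G.translations j i,
        Complex.exp (Complex.I * (phase m d₁ : ℂ)) *
          (Complex.exp (Complex.I * (h * phase (n + m) ξ : ℝ)) * discFourier h u ξ i) -
        (E₀ : ℂ) * (Complex.exp (Complex.I * (h * phase n ξ : ℝ)) * discFourier h u ξ j)) := by
    intro ξ
    rw [symbolOp_apply G E₀ ν d₁ hh]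
    have h3 : ∀ i, ∀ m, Complex.exp (Complex.I * (phase m d₁ : ℂ)) *
          (Complex.exp (Complex.I * (h * phase (n + m) ξ : ℝ)) * discFourier h u ξ i) =
        Complex.exp (Complex.I * (h * phase n ξ : ℝ)) * (Complex.exp (Complex.I * (phase m d₁ : ℂ)) *
          (Complex.exp (Complex.I * (h * phase m ξ : ℝ)) * discFourier h u ξ i)) := by
      intro i m
      have h4 : Complex.exp (Complex.I * (h * phase (n + m) ξ : ℝ)) =
          Complex.exp (Complex.I * (h * phase n ξ : ℝ)) *
          Complex.exp (Complex.I * (h * phase m ξ : ℝ)) := by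
        rw [← Complex.exp_add, phase_add]
        congr 1
        push_cast
        ring
      rw [h4]
      ring
    simp only [h3, ← Finset.mul_sum]
    ring
  rw [integral_congr_ae (ae_of_all _ h2), integral_const_mul, integral_sub, integral_const_mul,
    integral_finsetSum]
  · simp_rw [integral_const_mul]
    rw [(key j n).2]
    have h5 : ∀ i, ∫ ξ in cell d h, ∑ m ∈ G.translations j i,
        Complex.exp (Complex.I * (phase m d₁ : ℂ)) *
          (Complex.exp (Complex.I * (h * phase (n + m) ξ : ℝ)) * discFourier h u ξ i) =
        (((modeConst d h)⁻¹ : ℝ) : ℂ) * ∑ m ∈ G.translations j i,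
          Complex.exp (Complex.I * (phase m d₁ : ℂ)) * u (n + m) i := by
      intro i
      rw [integral_finsetSum _ fun m _ => (key i (n + m)).1.const_mul _, Finset.mul_sum]
      refine Finset.sum_congr rfl fun m _ => ?_
      rw [integral_const_mul, (key i (n + m)).2]
      ring
    simp only [h5, ← Finset.mul_sum]
    ring
  · exact fun i _ => integrable_finsetSum _ fun m _ => (key i (n + m)).1.const_mul _
  · exact (integrable_finsetSum _ fun i _ => integrable_finsetSum _ fun m _ =>
      (key i (n + m)).1.const_mul _).const_mul _
  · exact (key j n).1.const_mul _

/-- The equation satisfied by the discrete Fourier transform of a solution, if the right-hand side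
has the Fourier series `S`. -/
lemma symbolOp_discFourier_ae_eq {E₀ ν : ℝ} {d₁ : Space d} {z : ℂ} {f : Space d → Fiber s} {h : ℝ}
    (hh : 0 < h) {u : (Fin d → ℤ) → Fiber s} (hu : IsLatticeSolution G E₀ ν d₁ z f h u)
    {S : Space d → Fiber s} (hS : MemLp S 2 (volume.restrict (cell d h)))
    (hSf : ∀ n : Fin d → ℤ, ∫ ξ in cell d h, Complex.exp (Complex.I * (h * phase n ξ : ℝ)) • S ξ =
      sample h f n) :
    ∀ᵐ ξ ∂(volume.restrict (cell d h)),
      G.symbolOp E₀ ν d₁ h ξ (discFourier h u ξ) - z • discFourier h u ξ =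
        (((modeConst d h)⁻¹ : ℝ) : ℂ) • S ξ := by
  have hT := G.memLp_symbolOp_discFourier E₀ ν d₁ hh u
  have hû : MemLp (discFourier h u) 2 (volume.restrict (cell d h)) := Lp.memLp _
  -- All Fourier coefficients of the difference of the two sides vanish: they are, up to the
  -- normalizing constant, the differences of the two sides of the lattice equation.
  have h1 := ae_eq_zero_of_integral_exp_smul_eq_zero hh
    (φ := fun ξ => (G.symbolOp E₀ ν d₁ h ξ (discFourier h u ξ) - z • discFourier h u ξ) -
      (((modeConst d h)⁻¹ : ℝ) : ℂ) • S ξ)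
    ((hT.sub (hû.const_smul z)).sub (hS.const_smul (((modeConst d h)⁻¹ : ℝ) : ℂ))) ?_
  · filter_upwards [h1] with ξ hξ
    exact sub_eq_zero.1 hξ
  · intro n
    have hTi := integrable_exp_phase_smul (hT.integrable (by norm_num)) n
    have hui := integrable_exp_phase_smul (hû.integrable (by norm_num)) n
    have hSi := integrable_exp_phase_smul (hS.integrable (by norm_num)) n
    have h2 : ∀ ξ, Complex.exp (Complex.I * (h * phase n ξ : ℝ)) •
        ((G.symbolOp E₀ ν d₁ h ξ (discFourier h u ξ) - z • discFourier h u ξ) -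
          (((modeConst d h)⁻¹ : ℝ) : ℂ) • S ξ) =
        (Complex.exp (Complex.I * (h * phase n ξ : ℝ)) • G.symbolOp E₀ ν d₁ h ξ (discFourier h u ξ) -
          z • (Complex.exp (Complex.I * (h * phase n ξ : ℝ)) • discFourier h u ξ)) -
        (((modeConst d h)⁻¹ : ℝ) : ℂ) • (Complex.exp (Complex.I * (h * phase n ξ : ℝ)) • S ξ) := by
      intro ξ
      rw [smul_sub, smul_sub, smul_comm z, smul_comm (((modeConst d h)⁻¹ : ℝ) : ℂ)]
    have hui' : Integrable (fun ξ => z • (Complex.exp (Complex.I * (h * phase n ξ : ℝ)) •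
        discFourier h u ξ)) (volume.restrict (cell d h)) := hui.smul z
    have hSi' : Integrable (fun ξ => (((modeConst d h)⁻¹ : ℝ) : ℂ) •
        (Complex.exp (Complex.I * (h * phase n ξ : ℝ)) • S ξ)) (volume.restrict (cell d h)) :=
      hSi.smul (((modeConst d h)⁻¹ : ℝ) : ℂ)
    have hsub : Integrable (fun ξ => Complex.exp (Complex.I * (h * phase n ξ : ℝ)) •
        G.symbolOp E₀ ν d₁ h ξ (discFourier h u ξ) -
          z • (Complex.exp (Complex.I * (h * phase n ξ : ℝ)) • discFourier h u ξ))
        (volume.restrict (cell d h)) := hTi.sub hui'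
    rw [integral_congr_ae (ae_of_all _ h2), integral_sub hsub hSi', integral_sub hTi hui', integral_smul, integral_smul,
      G.integral_exp_symbolOp_discFourier E₀ ν d₁ hh hu.1, integral_exp_discFourier hh hu.1, hSf,
      ← hu.2 n, smul_sub, smul_comm z, sub_self]

end PeriodicGraph

end Lattice

/-! ### Periodization -/

section Periodization

variable {d s : ℕ}

/-- The homomorphism `n ↦ (2π/h) n`. -/
def dualLatticeHom (d : ℕ) (h : ℝ) : (Fin d → ℤ) →+ Space d where
  toFun n := WithLp.toLp 2 fun k => 2 * Real.pi / h * (n k : ℝ)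
  map_zero' := by ext; simp
  map_add' n m := by ext; simp [mul_add]

/-- The lattice `(2π/h) ℤ^d`. -/
def dualLattice (d : ℕ) (h : ℝ) : AddSubgroup (Space d) := (dualLatticeHom d h).range

instance countable_dualLattice (h : ℝ) : Countable (dualLattice d h) :=
  Set.countable_coe_iff.2 (Set.countable_range (dualLatticeHom d h))

lemma dualLatticeHom_injective {h : ℝ} (hh : 0 < h) :
    Function.Injective (dualLatticeHom d h) := by
  intro n m hnm
  funext k
  have h1 := congrArg (fun v : Space d => v k) hnm
  have h2 : 2 * Real.pi / h ≠ 0 := by positivity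
  simpa [dualLatticeHom, h2, Real.pi_ne_zero, hh.ne'] using h1

lemma isAddFundamentalDomain_halfOpenCell {h : ℝ} (hh : 0 < h) :
    IsAddFundamentalDomain (dualLattice d h) (halfOpenCell d h) volume := by
  refine IsAddFundamentalDomain.mk' (measurableSet_halfOpenCell h).nullMeasurableSet fun ξ => ?_
  have hp : 0 < 2 * Real.pi / h := by positivity
  have h1 : ∀ (n : Fin d → ℤ), (dualLatticeHom d h n + ξ ∈ halfOpenCell d h ↔
      ∀ k, ξ k + n k • (2 * Real.pi / h) ∈
        Set.Ioc (-(Real.pi / h)) (-(Real.pi / h) + 2 * Real.pi / h)) := by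
    intro n
    refine forall_congr' fun k => ?_
    rw [show -(Real.pi / h) + 2 * Real.pi / h = Real.pi / h by ring]
    simp only [dualLatticeHom, AddMonoidHom.coe_mk, ZeroHom.coe_mk, PiLp.add_apply, zsmul_eq_mul]
    rw [add_comm, mul_comm]
  choose n hn hnu using fun k => existsUnique_add_zsmul_mem_Ioc hp (ξ k) (-(Real.pi / h))
  refine ⟨⟨dualLatticeHom d h n, n, rfl⟩, (h1 n).2 hn, ?_⟩
  rintro ⟨_, m, rfl⟩ hm
  have h2 : m = n := funext fun k => hnu k _ ((h1 m).1 hm k)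
  subst h2
  rfl

lemma add_notMem_halfOpenCell {h : ℝ} (hh : 0 < h) {l : dualLattice d h} (hl : l ≠ 0)
    {ξ : Space d} (hξ : ξ ∈ halfOpenCell d h) : (l : Space d) + ξ ∉ halfOpenCell d h := by
  intro hlξ
  have hu : ∃! g : dualLattice d h, g +ᵥ ξ ∈ halfOpenCell d h := by
    have hp : 0 < 2 * Real.pi / h := by positivity
    refine ⟨0, by simpa using hξ, ?_⟩
    rintro ⟨_, m, rfl⟩ hm
    have h2 : m = 0 := by
      funext k
      have h3 := existsUnique_add_zsmul_mem_Ioc hp (ξ k) (-(Real.pi / h))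
      rw [show -(Real.pi / h) + 2 * Real.pi / h = Real.pi / h by ring] at h3
      refine h3.unique ?_ (by simpa using hξ k)
      have h4 := hm k
      simp only [dualLatticeHom] at h4
      rw [zsmul_eq_mul, add_comm, mul_comm]
      exact h4
    subst h2
    ext1
    simp
  exact hl (hu.unique hlξ (by simpa using hξ))

/-- Unfolding: the translates of the fundamental domain tile the space up to null sets. -/
lemma lintegral_tsum_halfOpenCell {h : ℝ} (hh : 0 < h) {φ : Space d → ℝ≥0∞} (hφ : Measurable φ) :
    ∫⁻ ξ in halfOpenCell d h, ∑' l : dualLattice d h, φ (l + ξ) = ∫⁻ ξ, φ ξ := by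
  rw [(isAddFundamentalDomain_halfOpenCell hh).lintegral_eq_tsum'', lintegral_tsum]
  · rfl
  · exact fun l => (hφ.comp (measurable_const_add (l : Space d))).aemeasurable

/-- The periodization `∑_l F(l + ξ)`. -/
def periodization (h : ℝ) (F : Space d → Fiber s) (ξ : Space d) : Fiber s :=
  ∑' l : dualLattice d h, F (l + ξ)

lemma ae_summable_periodization {h : ℝ} (hh : 0 < h) {F : Space d → Fiber s}
    (hF : StronglyMeasurable F) (hFi : Integrable F) :
    ∀ᵐ ξ ∂(volume.restrict (halfOpenCell d h)), Summable fun l : dualLattice d h => F (l + ξ) := by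
  have h1 : ∫⁻ ξ in halfOpenCell d h, ∑' l : dualLattice d h, ‖F (l + ξ)‖ₑ < ⊤ := by
    rw [lintegral_tsum_halfOpenCell hh hF.enorm]
    exact hFi.2
  have h2 : Measurable fun ξ => ∑' l : dualLattice d h, ‖F (l + ξ)‖ₑ :=
    Measurable.tsum fun l => hF.enorm.comp (measurable_const_add (l : Space d))
  filter_upwards [ae_lt_top h2 h1.ne] with ξ hξ
  refine Summable.of_norm ?_
  have h3 := ENNReal.summable_toReal hξ.ne
  simpa using h3

lemma aestronglyMeasurable_periodization {h : ℝ} (hh : 0 < h) {F : Space d → Fiber s}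
    (hF : StronglyMeasurable F) (hFi : Integrable F) :
    AEStronglyMeasurable (periodization h F) (volume.restrict (halfOpenCell d h)) := by
  refine aestronglyMeasurable_of_tendsto_ae (u := (atTop : Filter (Finset (dualLattice d h))))
    (f := fun T ξ => ∑ l ∈ T, F (l + ξ)) ?_ ?_
  · intro T
    refine (Finset.stronglyMeasurable_fun_sum T fun l _ => ?_).aestronglyMeasurable
    exact hF.comp_measurable (measurable_const_add (l : Space d))
  · filter_upwards [ae_summable_periodization hh hF hFi] with ξ hξ
    exact hξ.hasSum

lemma exp_phase_dualLattice {h : ℝ} (hh : 0 < h) (n : Fin d → ℤ) (l : dualLattice d h)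
    (ξ : Space d) : Complex.exp (Complex.I * (h * phase n (l + ξ) : ℝ)) =
      Complex.exp (Complex.I * (h * phase n ξ : ℝ)) := by
  obtain ⟨_, m, rfl⟩ := l
  have h1 : h * phase n (dualLatticeHom d h m) = 2 * Real.pi * ((∑ k, n k * m k : ℤ) : ℝ) := by
    simp only [phase, dualLatticeHom, AddMonoidHom.coe_mk, ZeroHom.coe_mk, Finset.mul_sum,
      Int.cast_sum]
    refine Finset.sum_congr rfl fun k _ => ?_
    push_cast
    field_simp
  rw [PeriodicGraph.phase_add_right, mul_add, h1, Complex.ofReal_add, mul_add, Complex.exp_add]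
  have h2 : Complex.exp (Complex.I * ((2 * Real.pi * ((∑ k, n k * m k : ℤ) : ℝ) : ℝ) : ℂ)) = 1 := by
    rw [Complex.exp_eq_one_iff]
    refine ⟨∑ k, n k * m k, ?_⟩
    push_cast
    ring
  rw [h2, one_mul]

lemma inner_sample (h : ℝ) (n : Fin d → ℤ) (ξ : Space d) :
    inner ℝ (WithLp.toLp 2 fun k => h * (n k : ℝ) : Space d) ξ = h * phase n ξ := by
  simp only [PiLp.inner_apply, phase, Finset.mul_sum]
  refine Finset.sum_congr rfl fun k _ => ?_
  simp
  ring

/-- The Fourier coefficients of the periodization of `F` are the samples of the inverse Fourier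
integral of `F`. -/
lemma integral_exp_periodization {h : ℝ} (hh : 0 < h) {F : Space d → Fiber s}
    (hF : StronglyMeasurable F) (hFi : Integrable F) (n : Fin d → ℤ) :
    ∫ ξ in cell d h, Complex.exp (Complex.I * (h * phase n ξ : ℝ)) • periodization h F ξ =
      sample h (synthesis F) n := by
  rw [← Measure.restrict_congr_set (halfOpenCell_ae_eq h)]
  have hgi : Integrable (fun ξ => Complex.exp (Complex.I * (h * phase n ξ : ℝ)) • F ξ) :=
    hFi.bdd_smul 1 (continuous_exp_phase h n).aestronglyMeasurable
      (ae_of_all _ fun ξ => by rw [norm_exp_I_mul_ofReal])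
  have hgm : StronglyMeasurable (fun ξ => Complex.exp (Complex.I * (h * phase n ξ : ℝ)) • F ξ) :=
    (continuous_exp_phase h n).stronglyMeasurable.smul hF
  have h1 : sample h (synthesis F) n =
      ∫ ξ, Complex.exp (Complex.I * (h * phase n ξ : ℝ)) • F ξ := by
    simp only [sample, synthesis, inner_sample]
  rw [h1, (isAddFundamentalDomain_halfOpenCell hh).integral_eq_tsum'' _ hgi, ← integral_tsum]
  · refine integral_congr_ae (ae_of_all _ fun ξ => ?_)
    simp only [AddSubgroup.vadd_def, vadd_eq_add, exp_phase_dualLattice hh, periodization]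
    rw [tsum_const_smul'']
  · exact fun l => (hgm.comp_measurable (measurable_const_add (l : Space d))).aestronglyMeasurable
  · have h2 := lintegral_tsum_halfOpenCell hh hgm.enorm
    rw [lintegral_tsum] at h2
    · exact (lt_of_eq_of_lt h2 hgi.2).ne
    · exact fun l => (hgm.enorm.comp (measurable_const_add (l : Space d))).aemeasurable

/-- Subtracting `F ξ` removes the term $l=0$, and every other translate of a point of the cell lies
outside the cell. -/
lemma enorm_periodization_sub_le {h : ℝ} (hh : 0 < h) (F : Space d → Fiber s)
    {ξ : Space d} (hξ : ξ ∈ halfOpenCell d h)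
    (hs : Summable fun l : dualLattice d h => F (l + ξ)) :
    ‖periodization h F ξ - F ξ‖ₑ ≤
      ∑' l : dualLattice d h, (halfOpenCell d h)ᶜ.indicator (fun ζ => ‖F ζ‖ₑ) (l + ξ) := by
  classical
  have h1 := hs.tsum_eq_add_tsum_ite 0
  rw [periodization, h1]
  simp only [ZeroMemClass.coe_zero, zero_add, add_sub_cancel_left]
  refine (enorm_tsum_le_tsum_enorm).trans (ENNReal.tsum_le_tsum fun l => ?_)
  by_cases hl : l = 0
  · simp [hl]
  · rw [if_neg hl, Set.indicator_of_mem (add_notMem_halfOpenCell hh hl hξ)]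

lemma lintegral_enorm_periodization_sub_le {h : ℝ} (hh : 0 < h) {F : Space d → Fiber s}
    (hF : StronglyMeasurable F) (hFi : Integrable F) :
    ∫⁻ ξ in halfOpenCell d h, ‖periodization h F ξ - F ξ‖ₑ ≤
      ∫⁻ ξ, (halfOpenCell d h)ᶜ.indicator (fun ζ => ‖F ζ‖ₑ) ξ := by
  rw [← lintegral_tsum_halfOpenCell hh
    (hF.enorm.indicator (measurableSet_halfOpenCell h).compl)]
  refine lintegral_mono_ae ?_
  filter_upwards [ae_summable_periodization hh hF hFi,
    ae_restrict_mem (measurableSet_halfOpenCell h)] with ξ h1 h2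
  exact enorm_periodization_sub_le hh F h2 h1

lemma tsum_mul_sq_le {ι : Type*} (a b : ι → ℝ≥0∞) :
    (∑' i, a i * b i) ^ 2 ≤ (∑' i, a i) * ∑' i, a i * b i ^ 2 := by
  let _ : MeasurableSpace ι := ⊤
  have h1 := lintegral_mul_sq_le (Measure.count : Measure ι) (a := a) (b := b)
    (measurable_from_top.aemeasurable) (measurable_from_top.aemeasurable)
  simpa only [lintegral_count] using h1

/-- A lattice sum bounded uniformly in $h\le1$ and $\xi$: for $\xi$ in the cell, $|2\pi
n/h+\xi|\ge|n|$, so the sum is at most $\sum_{n\ne0}|n|^{-2N}$, which converges because $2N>d$. -/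
lemma exists_tsum_weight_le {N : ℕ} (hN : d < 2 * N) :
    ∃ C : ℝ≥0∞, C ≠ ⊤ ∧ ∀ h ∈ Set.Ioc (0 : ℝ) 1, ∀ ξ ∈ halfOpenCell d h,
      ∑' l : dualLattice d h, (halfOpenCell d h)ᶜ.indicator (fun ζ => ((weight N ζ)⁻¹) ^ 2) (l + ξ)
        ≤ C := by
  classical
  let b := (EuclideanSpace.basisFun (Fin d) ℝ).toBasis
  let L : Submodule ℤ (Space d) := Submodule.span ℤ (Set.range b)
  let v : (Fin d → ℤ) → Space d := fun n => WithLp.toLp 2 fun k => (n k : ℝ)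
  have hvL : ∀ n, v n ∈ L := by
    intro n
    have h1 : v n = ∑ k, n k • b k := by
      ext i
      simp [v, b, Finset.sum_apply, Pi.single_apply]
    rw [h1]
    exact Submodule.sum_mem _ fun k _ => Submodule.smul_mem _ _ (Submodule.subset_span ⟨k, rfl⟩)
  have hrank : Module.finrank ℤ L = d := by
    rw [ZLattice.rank ℝ L]
    simp
  have hsum : Summable fun x : L => ‖x‖⁻¹ ^ (2 * N) :=
    ZLattice.summable_norm_pow_inv L (2 * N) (by omega)
  refine ⟨∑' x : L, ENNReal.ofReal (‖x‖⁻¹ ^ (2 * N)), hsum.tsum_ofReal_ne_top, ?_⟩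
  rintro h ⟨hh, hh1⟩ ξ hξ
  let e : (Fin d → ℤ) ≃+ dualLattice d h := AddMonoidHom.ofInjective (dualLatticeHom_injective (d := d) hh)
  have hinj : Function.Injective fun n => (⟨v n, hvL n⟩ : L) := by
    intro n n' hn
    funext k
    have h1 := congrArg (fun x : L => (x : Space d) k) hn
    simpa [v] using h1
  refine le_trans ?_ (ENNReal.tsum_comp_le_tsum_of_injective hinj
    fun x => ENNReal.ofReal (‖x‖⁻¹ ^ (2 * N)))
  rw [← e.toEquiv.tsum_eq]
  refine ENNReal.tsum_le_tsum fun n => ?_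
  have he : ((e.toEquiv n : dualLattice d h) : Space d) = dualLatticeHom d h n := rfl
  rw [he]
  by_cases hn : n = 0
  · rw [hn, map_zero, zero_add, Set.indicator_of_notMem (by simpa using hξ)]
    exact zero_le
  refine (Set.indicator_le_self _ _ _).trans ?_
  -- In each coordinate with $n_k\ne0$, $|2\pi n_k/h+\xi_k|\ge(2|n_k|-1)\pi/h\ge|n_k|$, using
  -- $\pi/h\ge1$.
  have hle : ‖v n‖ ≤ ‖dualLatticeHom d h n + ξ‖ := by
    rw [EuclideanSpace.norm_eq, EuclideanSpace.norm_eq]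
    refine Real.sqrt_le_sqrt (Finset.sum_le_sum fun k _ => ?_)
    refine pow_le_pow_left₀ (norm_nonneg _) ?_ 2
    have h1 : |ξ k| ≤ Real.pi / h := abs_le.2 ⟨(hξ k).1.le, (hξ k).2⟩
    have h2 : (dualLatticeHom d h n + ξ) k = 2 * Real.pi / h * n k + ξ k := rfl
    rw [h2, Real.norm_eq_abs, Real.norm_eq_abs]
    change |(n k : ℝ)| ≤ _
    have h3 : |2 * Real.pi / h * n k| ≤ |2 * Real.pi / h * n k + ξ k| + |ξ k| := by
      simpa using abs_sub (2 * Real.pi / h * n k + ξ k) (ξ k)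
    rw [abs_mul, abs_of_pos (by positivity : 0 < 2 * Real.pi / h)] at h3
    have h4 : 1 ≤ Real.pi / h := by
      rw [le_div_iff₀ hh]
      linarith [Real.pi_gt_three]
    by_cases hk : n k = 0
    · simp [hk]
    have h5 : (1 : ℝ) ≤ |(n k : ℝ)| := by exact_mod_cast Int.one_le_abs hk
    have h6 : 2 * Real.pi / h = 2 * (Real.pi / h) := by ring
    rw [h6] at h3 ⊢
    nlinarith
  have hv : 0 < ‖v n‖ := by
    rw [norm_pos_iff]
    intro h0
    apply hn
    funext k
    have h1 := congrArg (fun x : Space d => x k) h0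
    simpa [v] using h1
  have hpos : 0 < (1 + ‖dualLatticeHom d h n + ξ‖) ^ N := by positivity
  change (ENNReal.ofReal _)⁻¹ ^ 2 ≤ _
  rw [← ENNReal.ofReal_inv_of_pos hpos, ← ENNReal.ofReal_pow (by positivity)]
  refine ENNReal.ofReal_le_ofReal ?_
  rw [← inv_pow, ← pow_mul, mul_comm N 2]
  change _ ≤ ‖v n‖⁻¹ ^ (2 * N)
  gcongr
  linarith

/-- Cauchy–Schwarz over the translates outside the cell costs the uniformly bounded sum of $w^{-2}$
and leaves the weighted energy of `F` outside the cell, after unfolding. -/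
lemma lintegral_enorm_periodization_sub_sq_le {N : ℕ} {C : ℝ≥0∞} {h : ℝ} (hh : 0 < h)
    (hC : ∀ ξ ∈ halfOpenCell d h, ∑' l : dualLattice d h,
      (halfOpenCell d h)ᶜ.indicator (fun ζ => ((weight N ζ)⁻¹) ^ 2) (l + ξ) ≤ C)
    {F : Space d → Fiber s} (hF : StronglyMeasurable F) (hFi : Integrable F) :
    ∫⁻ ξ in halfOpenCell d h, ‖periodization h F ξ - F ξ‖ₑ ^ 2 ≤
      C * ∫⁻ ξ, (halfOpenCell d h)ᶜ.indicator (fun ζ => (weight N ζ * ‖F ζ‖ₑ) ^ 2) ξ := by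
  have hm : Measurable fun ζ => (weight N ζ * ‖F ζ‖ₑ) ^ 2 := by
    have := measurable_weight (d := d) N
    have := hF.enorm
    fun_prop
  have hm' := hm.indicator (measurableSet_halfOpenCell (d := d) h).compl
  have hts : Measurable fun ξ => ∑' l : dualLattice d h,
      (halfOpenCell d h)ᶜ.indicator (fun ζ => (weight N ζ * ‖F ζ‖ₑ) ^ 2) (l + ξ) :=
    Measurable.tsum fun l => hm'.comp (measurable_const_add (l : Space d))
  rw [← lintegral_tsum_halfOpenCell hh hm', ← lintegral_const_mul _ hts]
  refine lintegral_mono_ae ?_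
  filter_upwards [ae_summable_periodization hh hF hFi,
    ae_restrict_mem (measurableSet_halfOpenCell h)] with ξ h1 h2
  have hw : ∀ ζ : Space d, weight N ζ ≠ 0 := fun ζ => by
    have := one_le_weight N ζ; positivity
  -- The factorization is $\|F\|=a\,b$ with $a=w^{-2}$, $b=w^2\|F\|$, for which $a\,b^2=(w\|F\|)^2$.
  have h3 := tsum_mul_sq_le
    (fun l : dualLattice d h =>
      (halfOpenCell d h)ᶜ.indicator (fun ζ => ((weight N ζ)⁻¹) ^ 2) ((l : Space d) + ξ))
    (fun l : dualLattice d h => weight N ((l : Space d) + ξ) ^ 2 * ‖F ((l : Space d) + ξ)‖ₑ)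
  have hinv : ∀ ζ : Space d, ((weight N ζ)⁻¹) ^ 2 * (weight N ζ ^ 2 * ‖F ζ‖ₑ) = ‖F ζ‖ₑ := by
    intro ζ
    rw [← mul_assoc, ← mul_pow, ENNReal.inv_mul_cancel (hw ζ) (weight_ne_top N ζ), one_pow, one_mul]
  have h4 : ∀ l : dualLattice d h, (halfOpenCell d h)ᶜ.indicator (fun ζ => ((weight N ζ)⁻¹) ^ 2) (l + ξ)
      * (weight N ((l : Space d) + ξ) ^ 2 * ‖F ((l : Space d) + ξ)‖ₑ) =
      (halfOpenCell d h)ᶜ.indicator (fun ζ => ‖F ζ‖ₑ) (l + ξ) := by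
    intro l
    by_cases hl : (l : Space d) + ξ ∈ (halfOpenCell d h)ᶜ
    · rw [Set.indicator_of_mem hl, Set.indicator_of_mem hl, hinv]
    · rw [Set.indicator_of_notMem hl, Set.indicator_of_notMem hl, zero_mul]
  have h5 : ∀ l : dualLattice d h, (halfOpenCell d h)ᶜ.indicator (fun ζ => ((weight N ζ)⁻¹) ^ 2) (l + ξ)
      * (weight N ((l : Space d) + ξ) ^ 2 * ‖F ((l : Space d) + ξ)‖ₑ) ^ 2 =
      (halfOpenCell d h)ᶜ.indicator (fun ζ => (weight N ζ * ‖F ζ‖ₑ) ^ 2) (l + ξ) := by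
    intro l
    by_cases hl : (l : Space d) + ξ ∈ (halfOpenCell d h)ᶜ
    · rw [Set.indicator_of_mem hl, Set.indicator_of_mem hl, pow_two (_ * _), ← mul_assoc, hinv]
      ring
    · rw [Set.indicator_of_notMem hl, Set.indicator_of_notMem hl, zero_mul]
  simp only [h4, h5] at h3
  refine (pow_le_pow_left₀ (by positivity) (enorm_periodization_sub_le hh F h2 h1) 2).trans
    (h3.trans ?_)
  gcongr
  exact hC ξ h2

lemma tendsto_lintegral_compl_halfOpenCell {φ : Space d → ℝ≥0∞} (hφ : Measurable φ)
    (hi : ∫⁻ ξ, φ ξ ≠ ⊤) :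
    Tendsto (fun h => ∫⁻ ξ, (halfOpenCell d h)ᶜ.indicator φ ξ) (𝓝[>] 0) (𝓝 0) := by
  have h1 := tendsto_lintegral_filter_of_dominated_convergence (μ := (volume : Measure (Space d)))
    (l := 𝓝[>] (0 : ℝ)) (F := fun h => (halfOpenCell d h)ᶜ.indicator φ) (f := fun _ => 0) φ
    (Eventually.of_forall fun h => hφ.indicator (measurableSet_halfOpenCell h).compl)
    (Eventually.of_forall fun h => ae_of_all _ fun ξ => Set.indicator_le_self _ _ _) hi ?_
  · simpa using h1
  · refine ae_of_all _ fun ξ => ?_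
    refine tendsto_const_nhds.congr' ?_
    have h2 : ∀ᶠ h in 𝓝[>] (0 : ℝ), ‖ξ‖ < Real.pi / h := by
      have h3 : (0 : ℝ) < Real.pi / (‖ξ‖ + 1) := by positivity
      filter_upwards [Ioo_mem_nhdsGT h3] with h hh
      rw [lt_div_iff₀ hh.1]
      have h4 := (lt_div_iff₀ (by positivity)).1 hh.2
      nlinarith [hh.1]
    filter_upwards [h2] with h hh
    rw [Set.indicator_of_notMem]
    rw [Set.notMem_compl_iff]
    intro k
    have h3 := PiLp.norm_apply_le ξ k
    rw [Real.norm_eq_abs] at h3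
    exact ⟨by linarith [neg_abs_le (ξ k)], by linarith [le_abs_self (ξ k)]⟩

end Periodization

/-! ### Convergence of Fourier integrals over the cells -/

section Convergence

variable {d s : ℕ}

/-- Dominated convergence along a countably generated filter with almost everywhere measurable
integrands, reduced to sequences; finitely many initial terms are dropped so that the eventual
hypotheses hold throughout. -/
lemma tendsto_lintegral_filter_of_dominated_ae {ι α : Type*} [MeasurableSpace α] {μ : Measure α}
    {l : Filter ι} [l.IsCountablyGenerated] {φ : ι → α → ℝ≥0∞} {φ₀ : α → ℝ≥0∞}
    (bound : α → ℝ≥0∞) (hφ : ∀ᶠ i in l, AEMeasurable (φ i) μ)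
    (hb : ∀ᶠ i in l, φ i ≤ᵐ[μ] bound) (hfin : ∫⁻ a, bound a ∂μ ≠ ⊤)
    (hlim : ∀ᵐ a ∂μ, Tendsto (fun i => φ i a) l (𝓝 (φ₀ a))) :
    Tendsto (fun i => ∫⁻ a, φ i a ∂μ) l (𝓝 (∫⁻ a, φ₀ a ∂μ)) := by
  refine tendsto_of_seq_tendsto fun u hu => ?_
  obtain ⟨N, hN⟩ := eventually_atTop.1 (hu.eventually (hφ.and hb))
  rw [← tendsto_add_atTop_iff_nat N]
  refine tendsto_lintegral_of_dominated_convergence' bound (fun n => (hN _ (by omega)).1)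
    (fun n => (hN _ (by omega)).2) hfin ?_
  filter_upwards [hlim] with a ha
  exact ha.comp ((tendsto_add_atTop_iff_nat N).2 hu)

lemma tendsto_lintegral_periodization_sub {F : Space d → Fiber s} (hF : StronglyMeasurable F)
    (hFi : Integrable F) :
    Tendsto (fun h => ∫⁻ ξ in cell d h, ‖periodization h F ξ - F ξ‖ₑ) (𝓝[>] 0) (𝓝 0) := by
  refine tendsto_of_tendsto_of_tendsto_of_le_of_le' tendsto_const_nhds
    (tendsto_lintegral_compl_halfOpenCell hF.enorm hFi.2.ne) (Eventually.of_forall fun _ => zero_le) ?_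
  filter_upwards [self_mem_nhdsWithin] with h hh
  rw [← Measure.restrict_congr_set (halfOpenCell_ae_eq h)]
  exact lintegral_enorm_periodization_sub_le hh hF hFi

lemma tendsto_lintegral_periodization_sub_sq {N : ℕ} (hN : d < 2 * N) {F : Space d → Fiber s}
    (hF : StronglyMeasurable F) (hFi : Integrable F) (hFN : weightedEnergy N F < ⊤) :
    Tendsto (fun h => ∫⁻ ξ in cell d h, ‖periodization h F ξ - F ξ‖ₑ ^ 2) (𝓝[>] 0) (𝓝 0) := by
  obtain ⟨C, hC, hCh⟩ := exists_tsum_weight_le hN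
  have hm : Measurable fun ζ => (weight N ζ * ‖F ζ‖ₑ) ^ 2 := by
    have := measurable_weight (d := d) N
    have := hF.enorm
    fun_prop
  have h1 := ENNReal.Tendsto.const_mul (tendsto_lintegral_compl_halfOpenCell hm hFN.ne)
    (Or.inr hC)
  rw [mul_zero] at h1
  refine tendsto_of_tendsto_of_tendsto_of_le_of_le' tendsto_const_nhds h1
    (Eventually.of_forall fun _ => zero_le) ?_
  filter_upwards [Ioc_mem_nhdsGT one_pos] with h hh
  rw [← Measure.restrict_congr_set (halfOpenCell_ae_eq h)]
  exact lintegral_enorm_periodization_sub_sq_le hh.1 (hCh h hh) hF hFi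

lemma memLp_two_of_lintegral_sq {μ : Measure (Space d)} {K : Space d → Fiber s}
    (hK : AEStronglyMeasurable K μ) (h : ∫⁻ ξ, ‖K ξ‖ₑ ^ 2 ∂μ < ⊤) : MemLp K 2 μ := by
  refine ⟨hK, ?_⟩
  rw [eLpNorm_lt_top_iff_lintegral_rpow_enorm_lt_top (by norm_num) (by norm_num)]
  simpa using h

lemma eLpNorm_two_eq {μ : Measure (Space d)} (K : Space d → Fiber s) :
    eLpNorm K 2 μ = (∫⁻ ξ, ‖K ξ‖ₑ ^ 2 ∂μ) ^ (1 / 2 : ℝ) := by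
  rw [eLpNorm_eq_lintegral_rpow_enorm_toReal (by norm_num) (by norm_num)]
  simp

/-- The function `1_{cell} A S`. -/
def cellMul (h : ℝ) (A : Space d → Fiber s →L[ℂ] Fiber s) (S : Space d → Fiber s) :
    Space d → Fiber s := (cell d h).indicator fun ξ => A ξ (S ξ)

lemma eventually_mem_cell (ξ : Space d) : ∀ᶠ h in 𝓝[>] (0 : ℝ), ξ ∈ cell d h := by
  have h3 : (0 : ℝ) < Real.pi / (‖ξ‖ + 1) := by positivity
  filter_upwards [Ioo_mem_nhdsGT h3] with h hh k
  rw [le_div_iff₀ hh.1]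
  have h4 := (lt_div_iff₀ (by positivity)).1 hh.2
  have h5 := PiLp.norm_apply_le ξ k
  rw [Real.norm_eq_abs] at h5
  nlinarith [hh.1]

lemma lintegral_pow_add_le {α : Type*} [MeasurableSpace α] {μ : Measure α} (p : ℕ)
    {a b : α → ℝ≥0∞} (ha : AEMeasurable a μ) :
    ∫⁻ x, (a x + b x) ^ p ∂μ ≤ 2 ^ p * (∫⁻ x, a x ^ p ∂μ + ∫⁻ x, b x ^ p ∂μ) := by
  rw [← lintegral_add_left' (ha.pow_const p), ← lintegral_const_mul' _ _ (by simp)]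
  refine lintegral_mono fun x => ?_
  have h1 : a x + b x ≤ 2 * max (a x) (b x) := by
    rw [two_mul]; exact add_le_add (le_max_left _ _) (le_max_right _ _)
  refine (pow_le_pow_left₀ zero_le h1 p).trans ?_
  rw [mul_pow]
  gcongr
  rcases le_total (a x) (b x) with h | h
  · rw [max_eq_right h]; exact le_add_self
  · rw [max_eq_left h]; exact le_self_add

/-- A family of operator valued functions on the cells which is measurable, bounded, and converges
almost everywhere. -/
structure CellFamily (A : ℝ → Space d → Fiber s →L[ℂ] Fiber s)
    (A₀ : Space d → Fiber s →L[ℂ] Fiber s) (B : NNReal) : Prop where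
  meas : ∀ h > 0, AEStronglyMeasurable (A h) (volume.restrict (cell d h))
  bound : ∀ h > 0, ∀ ξ, ‖A h ξ‖ₑ ≤ B
  lim : ∀ᵐ ξ, Tendsto (fun h => A h ξ) (𝓝[>] 0) (𝓝 (A₀ ξ))

namespace CellFamily

variable {A : ℝ → Space d → Fiber s →L[ℂ] Fiber s} {A₀ : Space d → Fiber s →L[ℂ] Fiber s}
  {B : NNReal}

lemma bound_lim (hA : CellFamily A A₀ B) : ∀ᵐ ξ, ‖A₀ ξ‖ₑ ≤ B := by
  filter_upwards [hA.lim] with ξ hξ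
  refine le_of_tendsto ((continuous_enorm.tendsto _).comp hξ) ?_
  filter_upwards [self_mem_nhdsWithin] with h hh
  exact hA.bound h hh ξ

lemma enorm_apply_le (hA : CellFamily A A₀ B) {h : ℝ} (hh : 0 < h) (ξ : Space d) (v : Fiber s) :
    ‖A h ξ v‖ₑ ≤ B * ‖v‖ₑ :=
  ((A h ξ).le_opENorm v).trans (by gcongr; exact hA.bound h hh ξ)

lemma aestronglyMeasurable_cellMul (hA : CellFamily A A₀ B) {h : ℝ} (hh : 0 < h) {S : Space d → Fiber s}
    (hS : AEStronglyMeasurable S (volume.restrict (cell d h))) :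
    AEStronglyMeasurable (cellMul h (A h) S) volume := by
  refine (aestronglyMeasurable_indicator_iff (measurableSet_cell h)).2 ?_
  exact isBoundedBilinearMap_apply.continuous.comp_aestronglyMeasurable ((hA.meas h hh).prodMk hS)

lemma lim_cellMul (hA : CellFamily A A₀ B) (F : Space d → Fiber s) :
    ∀ᵐ ξ, Tendsto (fun h => cellMul h (A h) F ξ) (𝓝[>] 0) (𝓝 (A₀ ξ (F ξ))) := by
  filter_upwards [hA.lim] with ξ hξ
  have h1 : Tendsto (fun h => A h ξ (F ξ)) (𝓝[>] 0) (𝓝 (A₀ ξ (F ξ))) :=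
    ((ContinuousLinearMap.apply ℂ (Fiber s) (F ξ)).continuous.tendsto _).comp hξ
  refine h1.congr' ?_
  filter_upwards [eventually_mem_cell ξ] with h hh
  rw [cellMul, Set.indicator_of_mem hh]

lemma aestronglyMeasurable_lim (hA : CellFamily A A₀ B) {F : Space d → Fiber s} (hF : AEStronglyMeasurable F volume) :
    AEStronglyMeasurable (fun ξ => A₀ ξ (F ξ)) volume := by
  have hu : Tendsto (fun n : ℕ => 1 / ((n : ℝ) + 1)) atTop (𝓝[>] 0) :=
    tendsto_nhdsWithin_iff.2 ⟨tendsto_one_div_add_atTop_nhds_zero_nat,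
      Eventually.of_forall fun n => by rw [Set.mem_Ioi]; positivity⟩
  refine aestronglyMeasurable_of_tendsto_ae (u := atTop)
    (f := fun n : ℕ => cellMul (1 / ((n : ℝ) + 1)) (A (1 / ((n : ℝ) + 1))) F) (fun n => ?_) ?_
  · exact hA.aestronglyMeasurable_cellMul (by positivity) hF.restrict
  · filter_upwards [hA.lim_cellMul F] with ξ hξ
    exact hξ.comp hu

lemma memLp_lim (hA : CellFamily A A₀ B) {F : Space d → Fiber s} {p : ℝ≥0∞} (hF : MemLp F p volume) :
    MemLp (fun ξ => A₀ ξ (F ξ)) p volume := by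
  refine hF.of_le_mul (c := (B : ℝ)) (hA.aestronglyMeasurable_lim hF.1) ?_
  filter_upwards [hA.bound_lim] with ξ hξ
  refine (A₀ ξ).le_of_opNorm_le ?_ _
  exact enorm_le_coe.1 hξ

lemma memLp_cellMul (hA : CellFamily A A₀ B) {h : ℝ} (hh : 0 < h) {S : Space d → Fiber s} {p : ℝ≥0∞}
    (hS : MemLp S p (volume.restrict (cell d h))) : MemLp (cellMul h (A h) S) p volume := by
  refine (memLp_indicator_iff_restrict (measurableSet_cell h)).2 ?_
  exact PeriodicGraph.memLp_clm_apply (hA.meas h hh) (C := (B : ℝ))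
    (ae_of_all _ fun ξ => enorm_le_coe.1 (hA.bound h hh ξ)) hS

/-- The error splits as $A_h(S_h-F)+(A_h-A_0)F$. The first term is controlled by the uniform bound
on $A_h$, the second by dominated convergence. Both $p=1$ and $p=2$ are needed. -/
lemma tendsto_lintegral_sub (hA : CellFamily A A₀ B) {p : ℕ} (hp : p ≠ 0) {F : Space d → Fiber s}
    (hF : AEStronglyMeasurable F volume) (hFp : ∫⁻ ξ, ‖F ξ‖ₑ ^ p ≠ ⊤)
    {S : ℝ → Space d → Fiber s}
    (hSm : ∀ h > 0, AEStronglyMeasurable (S h) (volume.restrict (cell d h)))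
    (hS : Tendsto (fun h => ∫⁻ ξ in cell d h, ‖S h ξ - F ξ‖ₑ ^ p) (𝓝[>] 0) (𝓝 0)) :
    Tendsto (fun h => ∫⁻ ξ, ‖cellMul h (A h) (S h) ξ - A₀ ξ (F ξ)‖ₑ ^ p) (𝓝[>] 0) (𝓝 0) := by
  have h1 : Tendsto (fun h => ∫⁻ ξ, ‖cellMul h (A h) F ξ - A₀ ξ (F ξ)‖ₑ ^ p) (𝓝[>] 0)
      (𝓝 (∫⁻ _ξ : Space d, 0)) := by
    refine tendsto_lintegral_filter_of_dominated_ae (fun ξ => (B * ‖F ξ‖ₑ + B * ‖F ξ‖ₑ) ^ p)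
      ?_ ?_ ?_ ?_
    · filter_upwards [self_mem_nhdsWithin] with h hh
      exact ((hA.aestronglyMeasurable_cellMul hh hF.restrict).sub
        (hA.aestronglyMeasurable_lim hF)).enorm.pow_const p
    · filter_upwards [self_mem_nhdsWithin] with h hh
      filter_upwards [hA.bound_lim] with ξ hξ
      refine pow_le_pow_left₀ zero_le ((enorm_sub_le).trans (add_le_add ?_ ?_)) p
      · by_cases hc : ξ ∈ cell d h
        · rw [cellMul, Set.indicator_of_mem hc]
          exact hA.enorm_apply_le hh ξ _
        · rw [cellMul, Set.indicator_of_notMem hc, enorm_zero]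
          exact zero_le
      · exact ((A₀ ξ).le_opENorm _).trans (by gcongr)
    · have h2 : ∀ ξ, ((B : ℝ≥0∞) * ‖F ξ‖ₑ + B * ‖F ξ‖ₑ) ^ p = (B + B) ^ p * ‖F ξ‖ₑ ^ p := by
        intro ξ
        rw [← add_mul, mul_pow]
      simp only [h2]
      rw [lintegral_const_mul' _ _ (by finiteness)]
      exact ENNReal.mul_ne_top (by finiteness) hFp
    · filter_upwards [hA.lim_cellMul F] with ξ hξ
      have h3 := (hξ.sub_const (A₀ ξ (F ξ))).enorm
      rw [sub_self, enorm_zero] at h3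
      have h4 := ((ENNReal.continuous_pow p).tendsto 0).comp h3
      rw [zero_pow hp] at h4
      exact h4
  rw [lintegral_zero] at h1
  have h5 := ENNReal.Tendsto.const_mul (a := 2 ^ p)
    ((ENNReal.Tendsto.const_mul (a := (B : ℝ≥0∞) ^ p) hS (Or.inr (by finiteness))).add h1)
    (Or.inr (by finiteness))
  rw [mul_zero, add_zero, mul_zero] at h5
  refine tendsto_of_tendsto_of_tendsto_of_le_of_le' tendsto_const_nhds h5
    (Eventually.of_forall fun _ => zero_le) ?_
  filter_upwards [self_mem_nhdsWithin] with h hh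
  have h6 : ∀ ξ, ‖cellMul h (A h) (S h) ξ - A₀ ξ (F ξ)‖ₑ ^ p ≤
      (‖cellMul h (A h) (S h - F) ξ‖ₑ + ‖cellMul h (A h) F ξ - A₀ ξ (F ξ)‖ₑ) ^ p := by
    intro ξ
    refine pow_le_pow_left₀ zero_le ?_ p
    have h7 : cellMul h (A h) (S h) ξ - A₀ ξ (F ξ) =
        cellMul h (A h) (S h - F) ξ + (cellMul h (A h) F ξ - A₀ ξ (F ξ)) := by
      by_cases hc : ξ ∈ cell d h
      · simp [cellMul, hc]
      · simp [cellMul, hc]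
    rw [h7]
    exact enorm_add_le _ _
  refine (lintegral_mono h6).trans ((lintegral_pow_add_le p ?_).trans ?_)
  · exact (hA.aestronglyMeasurable_cellMul hh ((hSm h hh).sub hF.restrict)).enorm
  · gcongr
    rw [← lintegral_const_mul' _ _ (by finiteness), ← lintegral_indicator (measurableSet_cell h)]
    refine lintegral_mono fun ξ => ?_
    by_cases hc : ξ ∈ cell d h
    · rw [cellMul, Set.indicator_of_mem hc, Set.indicator_of_mem hc, ← mul_pow]
      exact pow_le_pow_left₀ zero_le (hA.enorm_apply_le hh ξ _) p
    · rw [cellMul, Set.indicator_of_notMem hc, Set.indicator_of_notMem hc, enorm_zero, zero_pow hp]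

end CellFamily

lemma enorm_bracket_smul_le {σ : ℝ} (hσ : 0 < σ) (x : Space d) (v : Fiber s) :
    ‖((bracket x ^ (-σ) : ℝ) : ℂ) • v‖ ≤ ‖v‖ := by
  have h1 : 1 ≤ bracket x := by
    unfold bracket
    exact Real.one_le_sqrt.2 (by nlinarith [sq_nonneg ‖x‖])
  rw [norm_smul, Complex.norm_real, Real.norm_of_nonneg (by positivity)]
  exact mul_le_of_le_one_left (norm_nonneg _) (Real.rpow_le_one_of_one_le_of_nonpos h1 (by linarith))

lemma continuous_bracket_rpow (σ : ℝ) :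
    Continuous fun x : Space d => ((bracket x ^ (-σ) : ℝ) : ℂ) := by
  refine Complex.continuous_ofReal.comp ?_
  unfold bracket
  refine Continuous.rpow_const (by fun_prop) fun x => Or.inl ?_
  positivity

lemma memWeightedL2_of_memLp {σ : ℝ} (hσ : 0 < σ) {v : Space d → Fiber s}
    (hv : MemLp v 2 volume) : MemWeightedL2 (-σ) v :=
  hv.of_le ((continuous_bracket_rpow σ).aestronglyMeasurable.smul hv.1)
    (ae_of_all _ fun x => enorm_bracket_smul_le hσ x _)

/-- The $L^1$ error bounds the supremum of the difference, and the $L^2$ error its $L^2$ norm by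
Plancherel. The weight $\langle x\rangle^{-\sigma}\le1$ can only decrease the latter, so the
convergence is in fact global in both senses. -/
lemma convergesTo_synthesis {K : ℝ → Space d → Fiber s} {K₀ : Space d → Fiber s}
    (hK : ∀ᶠ h in 𝓝[>] 0, Integrable (K h) ∧ MemLp (K h) 2 volume)
    (hK₀ : Integrable K₀) (hK₀2 : MemLp K₀ 2 volume)
    (h1 : Tendsto (fun h => ∫⁻ ξ, ‖K h ξ - K₀ ξ‖ₑ) (𝓝[>] 0) (𝓝 0))
    (h2 : Tendsto (fun h => ∫⁻ ξ, ‖K h ξ - K₀ ξ‖ₑ ^ 2) (𝓝[>] 0) (𝓝 0))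
    {V : ℝ → Space d → Fiber s} (hV : ∀ᶠ h in 𝓝[>] 0, V h = synthesis (K h)) :
    ConvergesTo V (synthesis K₀) := by
  refine ⟨fun σ hσ => ⟨?_, memWeightedL2_of_memLp hσ.1 (memLp_synthesis hK₀ hK₀2), ?_⟩, ?_⟩
  · filter_upwards [hK, hV] with h hKh hVh
    rw [hVh]
    exact memWeightedL2_of_memLp hσ.1 (memLp_synthesis hKh.1 hKh.2)
  · have h3 := ENNReal.Tendsto.const_mul (a := ENNReal.ofReal (twoPiPow d))
      (h2.ennrpow_const (1 / 2)) (Or.inr (by finiteness))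
    rw [ENNReal.zero_rpow_of_pos (by norm_num), mul_zero] at h3
    refine tendsto_of_tendsto_of_tendsto_of_le_of_le' tendsto_const_nhds h3
      (Eventually.of_forall fun _ => zero_le) ?_
    filter_upwards [hK, hV] with h hKh hVh
    have h4 : V h - synthesis K₀ = synthesis (K h - K₀) := by
      funext x
      rw [Pi.sub_apply, hVh, synthesis_sub hKh.1 hK₀]
    rw [h4, weightedL2Norm]
    refine (eLpNorm_mono fun x => enorm_bracket_smul_le hσ.1 x _).trans (le_of_eq ?_)
    change eLpNorm (synthesis (K h - K₀)) 2 volume = _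
    rw [eLpNorm_synthesis (hKh.1.sub hK₀) (hKh.2.sub hK₀2), eLpNorm_two_eq]
    rfl
  · refine TendstoUniformly.tendstoLocallyUniformly ?_
    rw [EMetric.tendstoUniformly_iff]
    intro δ hδ
    filter_upwards [hK, hV, h1.eventually (gt_mem_nhds hδ)] with h hKh hVh hδh x
    rw [edist_comm, edist_eq_enorm_sub, hVh, ← synthesis_sub hKh.1 hK₀]
    exact (enorm_synthesis_le _ x).trans_lt hδh

end Convergence

/-! ### The limit equation -/

section LimitEquation

variable {d s : ℕ}

lemma fourierL2_add_smul (a b : Lp (Fiber s) 2 (volume : Measure (Space d))) (c : ℂ) :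
    ∀ᵐ ξ, fourierL2 (a + c • b) ξ = fourierL2 a ξ + c • fourierL2 b ξ := by
  have h1 : (𝓕 (a + c • b) : Lp (Fiber s) 2 (volume : Measure (Space d))) = 𝓕 a + c • 𝓕 b := by
    rw [FourierTransform.fourier_add, FourierTransform.fourier_smul]
  have hq := quasiMeasurePreserving_smul (d := d) (inv_ne_zero two_pi_ne_zero)
  filter_upwards [hq.ae (Lp.coeFn_add (𝓕 a) (c • 𝓕 b)), hq.ae (Lp.coeFn_smul c (𝓕 b))] with ξ h2 h3
  unfold fourierL2
  rw [h1, h2, Pi.add_apply, h3, Pi.smul_apply, smul_add, smul_comm c]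

lemma eq_zero_of_fourierL2 {w : Lp (Fiber s) 2 (volume : Measure (Space d))}
    (h : ∀ᵐ ξ, fourierL2 w ξ = 0) : w = 0 := by
  have h1 : (𝓕 w : Lp (Fiber s) 2 (volume : Measure (Space d))) = 0 := by
    rw [Lp.eq_zero_iff_ae_eq_zero]
    have hq := quasiMeasurePreserving_smul (d := d) two_pi_ne_zero
    filter_upwards [hq.ae h] with ξ hξ
    rw [fourierL2, smul_smul, inv_mul_cancel₀ two_pi_ne_zero, one_smul, smul_eq_zero] at hξ
    refine hξ.resolve_left ?_
    have : (0 : ℝ) < (2 * Real.pi) ^ (-(d : ℝ) / 2) := by positivity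
    exact_mod_cast this.ne'
  have h2 := Lp.norm_fourier_eq w
  rw [h1, norm_zero] at h2
  exact norm_eq_zero.1 h2.symm

lemma ofReal_sub_ne_zero {z : ℂ} (hz : z.im ≠ 0) (r : ℝ) : (r : ℂ) - z ≠ 0 := by
  intro h
  apply hz
  have := congrArg Complex.im h
  simpa using this

/-- Existence is the pointwise identity $(p-z)W=K$. For uniqueness, the transform of the difference
of two solutions is annihilated by $p-z$, which is nonzero everywhere since $p$ is real and $z$ is
not. -/
lemma isUniqueL2Solution_synthesis {p : Space d → ℝ} {z : ℂ} (hz : z.im ≠ 0)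
    {K W : Space d → Fiber s} (hK : Integrable K) (hK2 : MemLp K 2 volume)
    (hW : Integrable W) (hW2 : MemLp W 2 volume) (hKW : ∀ᵐ ξ, ((p ξ : ℂ) - z) • W ξ = K ξ) :
    IsUniqueL2Solution p z ((memLp_synthesis hK hK2).toLp _) ((memLp_synthesis hW hW2).toLp _) := by
  set g := (memLp_synthesis hK hK2).toLp (synthesis K)
  set w := (memLp_synthesis hW hW2).toLp (synthesis W)
  have h1 : ∀ᵐ ξ, fourierL2 (g + z • w) ξ = (p ξ : ℂ) • fourierL2 w ξ := by
    filter_upwards [fourierL2_add_smul g w z, fourierL2_toLp_synthesis hK hK2,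
      fourierL2_toLp_synthesis hW hW2, hKW] with ξ h2 h3 h4 h5
    rw [h2, h3, h4, ← h5]
    module
  refine ⟨⟨g + z • w, h1, by simp⟩, ?_⟩
  rintro w' ⟨q, hq, hqg⟩
  -- Differences are written as $a+(-1)b$ to match `fourierL2_add_smul`.
  have h6 : q = (g + z • w) + z • (w' + (-1 : ℂ) • w) := by
    rw [← hqg]; module
  have h7 : w' + (-1 : ℂ) • w = 0 := by
    refine eq_zero_of_fourierL2 ?_
    filter_upwards [hq, h1, fourierL2_add_smul (g + z • w) (w' + (-1 : ℂ) • w) z,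
      fourierL2_add_smul w' w (-1)] with ξ h8 h9 h10 h11
    rw [← h6, h8, h9] at h10
    have h12 : ((p ξ : ℂ) - z) • fourierL2 (w' + (-1 : ℂ) • w) ξ = 0 := by
      rw [sub_smul, sub_eq_zero, h11, smul_add, h10, ← h11]
      module
    exact (smul_eq_zero.1 h12).resolve_left (ofReal_sub_ne_zero hz _)
  have h13 : w' = (w' + (-1 : ℂ) • w) + w := by module
  rw [h13, h7, zero_add]

end LimitEquation

/-! ### Operators diagonal in an orthonormal basis -/

section Diagonal

variable {s : ℕ}

/-- The operator with eigenvalues `φ k` on the vectors `b k` of an orthonormal basis. -/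
def diagOp (b : OrthonormalBasis (Fin s) ℂ (Fiber s)) (φ : Fin s → ℂ) : Fiber s →L[ℂ] Fiber s :=
  ∑ k, φ k • (innerSL ℂ (b k)).smulRight (b k)

variable (b : OrthonormalBasis (Fin s) ℂ (Fiber s))

lemma diagOp_apply (φ : Fin s → ℂ) (v : Fiber s) :
    diagOp b φ v = ∑ k, φ k • (inner ℂ (b k) v : ℂ) • b k := by
  simp [diagOp]

@[simp]
lemma diagOp_basis (φ : Fin s → ℂ) (k : Fin s) : diagOp b φ (b k) = φ k • b k := by
  rw [diagOp_apply, Finset.sum_eq_single k]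
  · simp
  · intro l _ hl
    rw [b.orthonormal.inner_eq_zero hl, zero_smul, smul_zero]
  · simp

lemma clm_ext_basis {S T : Fiber s →L[ℂ] Fiber s} (h : ∀ k, S (b k) = T (b k)) : S = T := by
  refine ContinuousLinearMap.coe_injective (b.toBasis.ext fun k => ?_)
  simpa using h k

lemma eq_diagOp {T : Fiber s →L[ℂ] Fiber s} {φ : Fin s → ℂ} (h : ∀ k, T (b k) = φ k • b k) :
    T = diagOp b φ :=
  clm_ext_basis b fun k => by rw [h, diagOp_basis]

/-- `diagOp` as a homomorphism of algebras. -/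
def diagHom : (Fin s → ℂ) →ₐ[ℂ] (Fiber s →L[ℂ] Fiber s) where
  toFun := diagOp b
  map_one' := clm_ext_basis b fun k => by simp
  map_mul' φ ψ := clm_ext_basis b fun k => by simp [smul_smul, mul_comm]
  map_zero' := clm_ext_basis b fun k => by simp
  map_add' φ ψ := clm_ext_basis b fun k => by simp [add_smul]
  commutes' c := clm_ext_basis b fun k => by
    simp [Algebra.algebraMap_eq_smul_one]

lemma diagHom_apply (φ : Fin s → ℂ) : diagHom b φ = diagOp b φ := rfl

lemma inner_basis_diagOp (φ : Fin s → ℂ) (k : Fin s) (v : Fiber s) :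
    inner ℂ (b k) (diagOp b φ v) = φ k * inner ℂ (b k) v := by
  rw [diagOp_apply, inner_sum, Finset.sum_eq_single k]
  · rw [inner_smul_right, inner_smul_right, inner_self_eq_one_of_norm_eq_one (b.norm_eq_one k),
      mul_one]
  · intro l _ hl
    rw [inner_smul_right, inner_smul_right, b.orthonormal.inner_eq_zero hl.symm, mul_zero, mul_zero]
  · simp

lemma norm_diagOp_le {φ : Fin s → ℂ} {C : ℝ} (hC : 0 ≤ C) (h : ∀ k, ‖φ k‖ ≤ C) :
    ‖diagOp b φ‖ ≤ C := by
  refine ContinuousLinearMap.opNorm_le_bound _ hC fun v => ?_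
  refine le_of_sq_le_sq ?_ (by positivity)
  rw [← b.sum_sq_norm_inner_right, mul_pow, ← b.sum_sq_norm_inner_right v, Finset.mul_sum]
  refine Finset.sum_le_sum fun k _ => ?_
  rw [inner_basis_diagOp, norm_mul, mul_pow]
  gcongr
  exact h k

lemma le_norm_diagOp (φ : Fin s → ℂ) (k : Fin s) : ‖φ k‖ ≤ ‖diagOp b φ‖ := by
  have h := (diagOp b φ).le_opNorm (b k)
  rw [diagOp_basis, norm_smul, b.norm_eq_one] at h
  simpa using h

lemma diagOp_mul_inv {φ : Fin s → ℂ} (h : ∀ k, φ k ≠ 0) : diagOp b φ * diagOp b φ⁻¹ = 1 := by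
  rw [← diagHom_apply, ← diagHom_apply, ← map_mul]
  have : φ * φ⁻¹ = 1 := by
    funext k
    exact mul_inv_cancel₀ (h k)
  rw [this, map_one]

lemma diagOp_inv_mul {φ : Fin s → ℂ} (h : ∀ k, φ k ≠ 0) : diagOp b φ⁻¹ * diagOp b φ = 1 := by
  rw [← diagHom_apply, ← diagHom_apply, ← map_mul]
  have : φ⁻¹ * φ = 1 := by
    funext k
    exact inv_mul_cancel₀ (h k)
  rw [this, map_one]

lemma isUnit_diagOp {φ : Fin s → ℂ} (h : ∀ k, φ k ≠ 0) : IsUnit (diagOp b φ) :=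
  ⟨⟨diagOp b φ, diagOp b φ⁻¹, diagOp_mul_inv b h, diagOp_inv_mul b h⟩, rfl⟩

lemma inverse_diagOp {φ : Fin s → ℂ} (h : ∀ k, φ k ≠ 0) :
    Ring.inverse (diagOp b φ) = diagOp b φ⁻¹ := by
  have := Ring.inverse_unit
    (⟨diagOp b φ, diagOp b φ⁻¹, diagOp_mul_inv b h, diagOp_inv_mul b h⟩ : (Fiber s →L[ℂ] Fiber s)ˣ)
  exact this

lemma continuous_diagOp : Continuous (diagOp b) := by
  unfold diagOp
  fun_prop

open scoped Classical in
/-- The orthogonal projection onto the sum of the eigenspaces with eigenvalues `μ k`, `k ∈ J`. -/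
lemma starProjection_iSup_eigenspace {T : Fiber s →L[ℂ] Fiber s} {μ : Fin s → ℝ}
    (hT : T = diagOp b fun k => (μ k : ℂ)) (J : Finset (Fin s)) :
    (⨆ k ∈ J, Module.End.eigenspace (T : Fiber s →ₗ[ℂ] Fiber s) (μ k : ℂ)).starProjection =
      diagOp b fun k => if ∃ l ∈ J, μ l = μ k then 1 else 0 := by
  refine eq_diagOp b fun k => ?_
  have hTb : ∀ k, T (b k) = (μ k : ℂ) • b k := fun k => by rw [hT, diagOp_basis]
  split_ifs with h
  · obtain ⟨l, hl, hlk⟩ := h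
    rw [one_smul, Submodule.starProjection_eq_self_iff]
    refine Submodule.mem_iSup_of_mem l (Submodule.mem_iSup_of_mem hl ?_)
    rw [Module.End.mem_eigenspace_iff, hlk]
    exact hTb k
  · rw [zero_smul, Submodule.starProjection_apply_eq_zero_iff]
    push Not at h
    have hle : (⨆ k ∈ J, Module.End.eigenspace (T : Fiber s →ₗ[ℂ] Fiber s) (μ k : ℂ)) ≤
        (Submodule.span ℂ {b k})ᗮ := by
      refine iSup₂_le fun l hl v hv => ?_
      rw [Submodule.mem_orthogonal_singleton_iff_inner_right]
      rw [Module.End.mem_eigenspace_iff] at hv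
      have hv' : T v = (μ l : ℂ) • v := hv
      have h1 : inner ℂ (b k) (T v) = (μ k : ℂ) * inner ℂ (b k) v := by
        rw [hT, inner_basis_diagOp]
      rw [hv', inner_smul_right] at h1
      have h2 : ((μ l : ℂ) - μ k) * inner ℂ (b k) v = 0 := by rw [sub_mul, h1, sub_self]
      refine (mul_eq_zero.1 h2).resolve_left ?_
      exact sub_ne_zero.2 (by exact_mod_cast h l hl)
    refine Submodule.le_orthogonal_iff_le_orthogonal.1 hle ?_
    exact Submodule.mem_span_singleton_self (b k)

end Diagonal

/-! ### The increasing eigenvalues -/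

namespace PeriodicGraph

section Eigenvalues

variable {s : ℕ} {A : Matrix (Fin s) (Fin s) ℂ}

lemma exists_basis_increasingEigenvalue (hA : A.IsHermitian) :
    ∃ b : OrthonormalBasis (Fin s) ℂ (Fiber s),
      Matrix.toEuclideanCLM (𝕜 := ℂ) A = diagOp b fun k => (increasingEigenvalue hA k : ℂ) := by
  -- `eigenvalues₀` is decreasing, hence the reversal in the reindexing of the eigenvector basis.
  let e : Fin s ≃ Fin s := (finCongr (Fintype.card_fin s).symm).trans
    (Fin.revPerm.trans (Fintype.equivOfCardEq (Fintype.card_fin _)))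
  refine ⟨hA.eigenvectorBasis.reindex e.symm, eq_diagOp _ fun k => ?_⟩
  rw [OrthonormalBasis.reindex_apply, Equiv.symm_symm]
  have h1 : increasingEigenvalue hA k = hA.eigenvalues (e k) := by
    rw [Matrix.IsHermitian.eigenvalues, increasingEigenvalue]
    simp [e]
  rw [h1]
  ext i
  rw [Matrix.ofLp_toEuclideanCLM, hA.mulVec_eigenvectorBasis]
  simp

/-- The sorted eigenvalues are determined by the roots of the characteristic polynomial; these scale
by $c$, and $c>0$ preserves their order. -/
lemma increasingEigenvalue_smul (hA : A.IsHermitian) {c : ℝ} (hc : 0 < c)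
    (hcA : ((c : ℂ) • A).IsHermitian) (k : Fin s) :
    increasingEigenvalue hcA k = c * increasingEigenvalue hA k := by
  have h1 : ((c : ℂ) • A).charpoly.roots =
      Multiset.map (RCLike.ofReal ∘ fun k => c * hA.eigenvalues₀ k) Finset.univ.val := by
    have h2 : ((c : ℂ) • A).charpoly =
        ∏ i, (Polynomial.X - Polynomial.C ((c * hA.eigenvalues i : ℝ) : ℂ)) := by
      conv_lhs => rw [hA.spectral_theorem, Unitary.conjStarAlgAut_apply, ← Matrix.smul_mul,
        ← Matrix.mul_smul, Matrix.charpoly_mul_comm, ← mul_assoc]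
      simp [← Matrix.diagonal_smul, Matrix.charpoly_diagonal]
    rw [h2, Polynomial.roots_prod _ _ 
      (Finset.prod_ne_zero_iff.2 fun i _ => Polynomial.X_sub_C_ne_zero _)]
    simp only [Polynomial.roots_X_sub_C, Multiset.bind_singleton]
    rw [← Multiset.map_univ_val_equiv (Fintype.equivOfCardEq (Fintype.card_fin (Fintype.card (Fin s)))),
      Multiset.map_map]
    refine Multiset.map_congr rfl fun i _ => ?_
    simp [Matrix.IsHermitian.eigenvalues]
  have h3 : List.ofFn hcA.eigenvalues₀ = List.ofFn fun k => c * hA.eigenvalues₀ k := by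
    rw [← hcA.sort_roots_charpoly_eq_eigenvalues₀, h1]
    simp_rw [Fin.univ_val_map, Multiset.map_coe, List.map_ofFn, Function.comp_def,
      RCLike.ofReal_re, Multiset.coe_sort]
    apply List.mergeSort_of_pairwise
    simp_rw [decide_eq_true_eq, ← List.sortedGE_iff_pairwise]
    refine Antitone.sortedGE_ofFn ?_
    exact fun k l hkl => mul_le_mul_of_nonneg_left (hA.eigenvalues₀_antitone hkl) hc.le
  exact congrFun (List.ofFn_injective h3) _

end Eigenvalues

end PeriodicGraph

/-! ### Spectral description of the symbol -/

namespace PeriodicGraph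

section Spectral

variable {d s : ℕ} (G : PeriodicGraph d s)

/-- `b` diagonalizes `𝓛(e^{-iη}) - E₀`. -/
def IsEigenbasis (E₀ : ℝ) (η : Space d) (b : OrthonormalBasis (Fin s) ℂ (Fiber s)) : Prop :=
  G.shiftedOp E₀ η = diagOp b fun k => (G.root E₀ k η : ℂ)

lemma exists_isEigenbasis (E₀ : ℝ) (η : Space d) : ∃ b, G.IsEigenbasis E₀ η b :=
  exists_basis_increasingEigenvalue (G.shiftedSymbol_isHermitian E₀ η)

lemma scaledRoot_eq (E₀ ν : ℝ) {h : ℝ} (hh : 0 < h) (k : Fin s) (η : Space d) :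
    G.scaledRoot E₀ ν k h η = h ^ (-ν) * G.root E₀ k (h • η) :=
  increasingEigenvalue_smul (G.shiftedSymbol_isHermitian E₀ (h • η)) (by positivity) _ k

lemma localRoot_eq (E₀ ν : ℝ) (d₁ : Space d) {h : ℝ} (hh : 0 < h) (k : Fin s) (ξ : Space d) :
    G.localRoot E₀ ν k d₁ h ξ = h ^ (-ν) * G.root E₀ k (h • ξ + d₁) := by
  rw [localRoot, scaledRoot_eq G E₀ ν hh, smul_add, smul_inv_smul₀ hh.ne']

section Basis

variable {G} {E₀ : ℝ} {d₁ : Space d} {h : ℝ} {ξ : Space d}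
  {b : OrthonormalBasis (Fin s) ℂ (Fiber s)}

lemma IsEigenbasis.symbolOp_eq (hb : G.IsEigenbasis E₀ (h • ξ + d₁) b) (hh : 0 < h) (ν : ℝ) :
    G.symbolOp E₀ ν d₁ h ξ = diagOp b fun k => (G.localRoot E₀ ν k d₁ h ξ : ℂ) := by
  refine eq_diagOp b fun k => ?_
  rw [G.symbolOp_eq E₀ ν d₁ hh, hb, G.localRoot_eq E₀ ν d₁ hh, smul_apply,
    diagOp_basis, smul_smul]
  push_cast
  rfl

-- Membership is tested through equality of roots, since an index outside `J` may share an
-- eigenvalue with one in `J`. The factor $h^{-\nu}\ne0$ does not affect such coincidences, so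
-- unscaled roots can be used.
open scoped Classical in
lemma IsEigenbasis.localProj_eq (hb : G.IsEigenbasis E₀ (h • ξ + d₁) b) (hh : 0 < h) (ν : ℝ)
    (J : Finset (Fin s)) :
    G.localProj E₀ ν J d₁ h ξ = diagOp b fun k =>
      if ∃ l ∈ J, G.root E₀ l (h • ξ + d₁) = G.root E₀ k (h • ξ + d₁) then 1 else 0 := by
  have h1 := starProjection_iSup_eigenspace b (hb.symbolOp_eq hh ν) J
  have h2 : (0 : ℝ) < h ^ (-ν) := by positivity
  simp only [G.localRoot_eq E₀ ν d₁ hh, mul_right_inj' h2.ne'] at h1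
  simp only [← G.localRoot_eq E₀ ν d₁ hh] at h1
  rw [symbolOp, Matrix.coe_toEuclideanCLM_eq_toEuclideanLin] at h1
  exact h1

end Basis

/-- The resolvent `(𝓛_h(e^{-ih(ξ + d_h)}) - z)⁻¹`. -/
def resolventOp (E₀ ν : ℝ) (d₁ : Space d) (z : ℂ) (h : ℝ) (ξ : Space d) : Fiber s →L[ℂ] Fiber s :=
  Ring.inverse (G.symbolOp E₀ ν d₁ h ξ - z • 1)

section Basis

variable {G} {E₀ : ℝ} {d₁ : Space d} {h : ℝ} {ξ : Space d}
  {b : OrthonormalBasis (Fin s) ℂ (Fiber s)}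

lemma IsEigenbasis.symbolOp_sub_eq (hb : G.IsEigenbasis E₀ (h • ξ + d₁) b) (hh : 0 < h) (ν : ℝ)
    (z : ℂ) : G.symbolOp E₀ ν d₁ h ξ - z • 1 =
      diagOp b fun k => (G.localRoot E₀ ν k d₁ h ξ : ℂ) - z :=
  eq_diagOp b fun k => by
    rw [hb.symbolOp_eq hh ν]
    simp [sub_smul]

lemma IsEigenbasis.resolventOp_eq (hb : G.IsEigenbasis E₀ (h • ξ + d₁) b) (hh : 0 < h) (ν : ℝ)
    {z : ℂ} (hz : z.im ≠ 0) : G.resolventOp E₀ ν d₁ z h ξ =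
      diagOp b fun k => ((G.localRoot E₀ ν k d₁ h ξ : ℂ) - z)⁻¹ := by
  rw [resolventOp, hb.symbolOp_sub_eq hh, inverse_diagOp b fun k => ofReal_sub_ne_zero hz _]
  rfl

end Basis

lemma isUnit_symbolOp_sub (E₀ ν : ℝ) (d₁ : Space d) {h : ℝ} (hh : 0 < h) {z : ℂ} (hz : z.im ≠ 0)
    (ξ : Space d) : IsUnit (G.symbolOp E₀ ν d₁ h ξ - z • 1) := by
  obtain ⟨b, hb⟩ := G.exists_isEigenbasis E₀ (h • ξ + d₁)
  rw [hb.symbolOp_sub_eq hh]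
  exact isUnit_diagOp b fun k => ofReal_sub_ne_zero hz _

lemma resolventOp_apply_sub (E₀ ν : ℝ) (d₁ : Space d) {h : ℝ} (hh : 0 < h) {z : ℂ} (hz : z.im ≠ 0)
    (ξ : Space d) (v : Fiber s) :
    G.resolventOp E₀ ν d₁ z h ξ (G.symbolOp E₀ ν d₁ h ξ v - z • v) = v := by
  have h1 := Ring.inverse_mul_cancel _ (G.isUnit_symbolOp_sub E₀ ν d₁ hh hz ξ)
  exact congrArg (fun T : Fiber s →L[ℂ] Fiber s => T v) h1

lemma norm_resolventOp_le (E₀ ν : ℝ) (d₁ : Space d) {h : ℝ} (hh : 0 < h) {z : ℂ} (hz : z.im ≠ 0)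
    (ξ : Space d) : ‖G.resolventOp E₀ ν d₁ z h ξ‖ ≤ |z.im|⁻¹ := by
  obtain ⟨b, hb⟩ := G.exists_isEigenbasis E₀ (h • ξ + d₁)
  rw [hb.resolventOp_eq hh ν hz]
  refine norm_diagOp_le b (by positivity) fun k => ?_
  rw [norm_inv]
  refine inv_anti₀ (abs_pos.2 hz) ?_
  simpa using Complex.abs_im_le_norm ((G.localRoot E₀ ν k d₁ h ξ : ℂ) - z)

lemma continuous_resolventOp (E₀ ν : ℝ) (d₁ : Space d) {h : ℝ} (hh : 0 < h) {z : ℂ}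
    (hz : z.im ≠ 0) : Continuous (G.resolventOp E₀ ν d₁ z h) := by
  refine continuous_iff_continuousAt.2 fun ξ => ?_
  obtain ⟨x, hx⟩ := G.isUnit_symbolOp_sub E₀ ν d₁ hh hz ξ
  have h1 := NormedRing.inverse_continuousAt x
  rw [hx] at h1
  exact ContinuousAt.comp (f := fun ξ => G.symbolOp E₀ ν d₁ h ξ - z • 1) h1
    (((G.continuous_symbolOp E₀ ν d₁ hh).sub continuous_const).continuousAt)

lemma norm_localProj_le (E₀ ν : ℝ) (J : Finset (Fin s)) (d₁ : Space d) (h : ℝ) (ξ : Space d) :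
    ‖G.localProj E₀ ν J d₁ h ξ‖ ≤ 1 :=
  Submodule.starProjection_norm_le _

lemma localProj_singleton_comp_resolventOp (E₀ ν : ℝ) (j : Fin s) (d₁ : Space d) {h : ℝ}
    (hh : 0 < h) {z : ℂ} (hz : z.im ≠ 0) (ξ : Space d) :
    G.localProj E₀ ν {j} d₁ h ξ * G.resolventOp E₀ ν d₁ z h ξ =
      ((G.localRoot E₀ ν j d₁ h ξ : ℂ) - z)⁻¹ • G.localProj E₀ ν {j} d₁ h ξ := by
  obtain ⟨b, hb⟩ := G.exists_isEigenbasis E₀ (h • ξ + d₁)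
  rw [hb.resolventOp_eq hh ν hz, hb.localProj_eq hh]
  refine clm_ext_basis b fun k => ?_
  simp only [mul_apply_eq_comp, smul_apply, diagOp_basis, map_smul,
    Finset.mem_singleton, exists_eq_left]
  split_ifs with hk
  · rw [G.localRoot_eq E₀ ν d₁ hh, G.localRoot_eq E₀ ν d₁ hh, hk]
  · simp

lemma localProj_pair (E₀ ν : ℝ) {i j : Fin s} (d₁ : Space d) {h : ℝ} (hh : 0 < h) {ξ : Space d}
    (hij : G.root E₀ i (h • ξ + d₁) ≠ G.root E₀ j (h • ξ + d₁)) :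
    G.localProj E₀ ν {i, j} d₁ h ξ =
      G.localProj E₀ ν {j} d₁ h ξ + G.localProj E₀ ν {i} d₁ h ξ := by
  obtain ⟨b, hb⟩ := G.exists_isEigenbasis E₀ (h • ξ + d₁)
  rw [hb.localProj_eq hh, hb.localProj_eq hh, hb.localProj_eq hh]
  refine clm_ext_basis b fun k => ?_
  simp only [add_apply, diagOp_basis, Finset.mem_singleton, exists_eq_left,
    Finset.mem_insert, exists_eq_or_imp]
  by_cases h1 : G.root E₀ i (h • ξ + d₁) = G.root E₀ k (h • ξ + d₁)
  · have h2 : G.root E₀ j (h • ξ + d₁) ≠ G.root E₀ k (h • ξ + d₁) := fun h2 => hij (h1.trans h2.symm)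
    simp [h1, h2]
  · simp [h1]

/-- On a set where the chosen eigenvalues lie in $(a,c)$ and the others outside $[a,c]$, the
projection is a limit of continuous functions. The affine image $Q$ of the symbol that sends $(a,c)$
to $(-1,1)$ satisfies $(1+Q^{2n})^{-1}\to\Pi$, because $(1+q^{2n})^{-1}$ tends to $1$ for $|q|<1$
and to $0$ for $|q|>1$. -/
lemma aestronglyMeasurable_localProj (E₀ ν : ℝ) {J : Finset (Fin s)} (d₁ : Space d) {h : ℝ}
    (hh : 0 < h) {U : Set (Space d)} (hU : MeasurableSet U) {a c : ℝ} (hac : a < c)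
    (hJ : ∀ ξ ∈ U, ∀ k ∈ J, a < G.root E₀ k (h • ξ + d₁) ∧ G.root E₀ k (h • ξ + d₁) < c)
    (hJc : ∀ ξ ∈ U, ∀ k ∉ J, G.root E₀ k (h • ξ + d₁) < a ∨ c < G.root E₀ k (h • ξ + d₁)) :
    AEStronglyMeasurable (G.localProj E₀ ν J d₁ h) (volume.restrict U) := by
  classical
  let Q : Space d → Fiber s →L[ℂ] Fiber s := fun ξ =>
    (((c - a) / 2 : ℝ) : ℂ)⁻¹ • (G.shiftedOp E₀ (h • ξ + d₁) - (((a + c) / 2 : ℝ) : ℂ) • 1)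
  let q : Space d → Fin s → ℝ := fun ξ k =>
    ((c - a) / 2)⁻¹ * (G.root E₀ k (h • ξ + d₁) - (a + c) / 2)
  have hr : 0 < (c - a) / 2 := by linarith
  have hQ : ∀ ξ b, G.IsEigenbasis E₀ (h • ξ + d₁) b → ∀ n : ℕ, 1 + Q ξ ^ (2 * n) =
      diagOp b fun k => ((1 + q ξ k ^ (2 * n) : ℝ) : ℂ) := by
    intro ξ b hb n
    have h1 : Q ξ = diagOp b fun k => (q ξ k : ℂ) := by
      refine eq_diagOp b fun k => ?_
      simp only [Q, q]
      rw [hb, smul_apply, sub_apply, smul_apply, diagOp_basis, one_apply_eq_self, ← sub_smul, smul_smul]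
      push_cast
      rfl
    rw [h1, ← diagHom_apply, ← diagHom_apply, ← map_pow, ← map_one (diagHom b), ← map_add]
    congr 1
    funext k
    simp
  have hne : ∀ ξ k (n : ℕ), 1 + q ξ k ^ (2 * n) ≠ 0 := by
    intro ξ k n
    have : 0 ≤ q ξ k ^ (2 * n) := (even_two_mul n).pow_nonneg _
    positivity
  have hQc : Continuous Q := by
    have h1 : Continuous fun ξ : Space d => h • ξ + d₁ := by fun_prop
    have h2 : Continuous fun ξ => G.shiftedOp E₀ (h • ξ + d₁) - (((a + c) / 2 : ℝ) : ℂ) • 1 :=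
      ((G.continuous_shiftedOp E₀).comp h1).sub continuous_const
    exact h2.const_smul (((c - a) / 2 : ℝ) : ℂ)⁻¹
  refine aestronglyMeasurable_of_tendsto_ae (u := (atTop : Filter ℕ))
    (f := fun n ξ => Ring.inverse (1 + Q ξ ^ (2 * n))) (fun n => ?_) ?_
  · refine Continuous.aestronglyMeasurable (continuous_iff_continuousAt.2 fun ξ => ?_)
    obtain ⟨b, hb⟩ := G.exists_isEigenbasis E₀ (h • ξ + d₁)
    obtain ⟨x, hx⟩ : IsUnit (1 + Q ξ ^ (2 * n)) := by
      rw [hQ ξ b hb]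
      exact isUnit_diagOp b fun k => by exact_mod_cast hne ξ k n
    have h1 := NormedRing.inverse_continuousAt x
    rw [hx] at h1
    exact ContinuousAt.comp (f := fun ξ => 1 + Q ξ ^ (2 * n)) h1
      (continuous_const.add (hQc.pow _)).continuousAt
  · filter_upwards [ae_restrict_mem hU] with ξ hξ
    obtain ⟨b, hb⟩ := G.exists_isEigenbasis E₀ (h • ξ + d₁)
    rw [hb.localProj_eq hh]
    have h1 : ∀ n : ℕ, Ring.inverse (1 + Q ξ ^ (2 * n)) =
        diagOp b fun k => (((1 + q ξ k ^ (2 * n))⁻¹ : ℝ) : ℂ) := by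
      intro n
      rw [hQ ξ b hb, inverse_diagOp b fun k => by exact_mod_cast hne ξ k n]
      congr 1
      funext k
      simp
    simp only [h1]
    refine ((continuous_diagOp b).tendsto _).comp (tendsto_pi_nhds.2 fun k => ?_)
    by_cases hk : k ∈ J
    · rw [if_pos ⟨k, hk, rfl⟩]
      have h2 := hJ ξ hξ k hk
      have h3 : |q ξ k| < 1 := by
        simp only [q]
        rw [abs_mul, abs_of_pos (inv_pos.2 hr), inv_mul_lt_iff₀ hr, abs_lt]
        constructor <;> linarith
      have h4 : Tendsto (fun n : ℕ => (1 + q ξ k ^ (2 * n))⁻¹) atTop (𝓝 1) := by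
        have h5 : Tendsto (fun n : ℕ => (q ξ k ^ 2) ^ n) atTop (𝓝 0) :=
          tendsto_pow_atTop_nhds_zero_of_lt_one (sq_nonneg _) (by rwa [sq_lt_one_iff_abs_lt_one])
        have h6 := (h5.const_add 1).inv₀ (by norm_num)
        simpa [pow_mul] using h6
      exact_mod_cast (Complex.continuous_ofReal.tendsto _).comp h4
    · have h2 := hJc ξ hξ k hk
      rw [if_neg]
      · have h3 : 1 < |q ξ k| := by
          simp only [q]
          rw [abs_mul, abs_of_pos (inv_pos.2 hr), lt_inv_mul_iff₀ hr, lt_abs]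
          rcases h2 with h2 | h2
          · right; linarith
          · left; linarith
        have h4 : Tendsto (fun n : ℕ => (1 + q ξ k ^ (2 * n))⁻¹) atTop (𝓝 0) := by
          refine Tendsto.inv_tendsto_atTop (tendsto_atTop_add_const_left _ _ ?_)
          have h5 : Tendsto (fun n : ℕ => (q ξ k ^ 2) ^ n) atTop atTop :=
            tendsto_pow_atTop_atTop_of_one_lt ((one_lt_sq_iff_one_lt_abs _).2 h3)
          simpa [pow_mul] using h5
        exact_mod_cast (Complex.continuous_ofReal.tendsto _).comp h4
      · rintro ⟨l, hl, hlk⟩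
        have h3 := hJ ξ hξ l hl
        rw [hlk] at h3
        rcases h2 with h2 | h2 <;> linarith

end Spectral

end PeriodicGraph

/-! ### A pair of opposite small eigenvalues of an analytic curve of operators -/

section Curve

variable {s : ℕ}

lemma aeval_diagOp (b : OrthonormalBasis (Fin s) ℂ (Fiber s)) (φ : Fin s → ℂ)
    (q : Polynomial ℂ) : Polynomial.aeval (diagOp b φ) q = diagOp b fun k => q.eval (φ k) := by
  rw [← diagHom_apply, Polynomial.aeval_algHom_apply, diagHom_apply]
  congr 1
  funext k
  have h1 := Polynomial.aeval_algHom_apply (Pi.evalAlgHom ℂ (fun _ : Fin s => ℂ) k) φ q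
  rw [← Polynomial.coe_aeval_eq_eval]
  exact h1.symm

lemma analyticAt_aeval {M : ℝ → Fiber s →L[ℂ] Fiber s} {t : ℝ} (hM : AnalyticAt ℝ M t)
    (q : Polynomial ℂ) : AnalyticAt ℝ (fun t => Polynomial.aeval (M t) q) t := by
  simp only [Polynomial.aeval_eq_sum_range]
  refine Finset.analyticAt_fun_sum _ fun n _ => ?_
  exact (analyticAt_const (v := q.coeff n)).smul (hM.pow n)

/-- The product of $1-x/\mu_k$ over the nonzero $\mu_k$. Evaluated on an operator with eigenvalues
$\mu_k$, it is the projection onto the kernel. -/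
lemma exists_polynomial_eval (μ : Fin s → ℂ) :
    ∃ q : Polynomial ℂ, q.eval 0 = 1 ∧ ∀ k, μ k * q.eval (μ k) = 0 := by
  classical
  refine ⟨∏ k, if μ k = 0 then 1 else 1 - Polynomial.C (μ k)⁻¹ * Polynomial.X, ?_, fun k => ?_⟩
  · rw [Polynomial.eval_prod]
    refine Finset.prod_eq_one fun k _ => ?_
    split_ifs <;> simp
  · by_cases hk : μ k = 0
    · rw [hk, zero_mul]
    · rw [Polynomial.eval_prod, Finset.prod_eq_zero (Finset.mem_univ k), mul_zero]
      rw [if_neg hk]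
      simp [hk]

lemma tendsto_rpow_nhdsGT_zero {a : ℝ} (ha : 0 < a) :
    Tendsto (fun t : ℝ => t ^ a) (𝓝[>] 0) (𝓝 0) := by
  have h := (Real.continuousAt_rpow_const 0 a (Or.inr ha.le)).tendsto
  rw [Real.zero_rpow ha.ne'] at h
  exact h.mono_left nhdsWithin_le_nhds

/-- The order of vanishing of an analytic curve is determined by the growth of its norm. -/
lemma exists_tendsto_rpow_smul {E : Type*} [NormedAddCommGroup E] [NormedSpace ℝ E] {X : ℝ → E}
    (hX : AnalyticAt ℝ X 0) {ν p : ℝ} (hp : 0 < p)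
    (hlim : Tendsto (fun t => ‖t ^ (-ν) • X t‖) (𝓝[>] 0) (𝓝 p)) :
    ∃ Z, Tendsto (fun t => t ^ (-ν) • X t) (𝓝[>] 0) (𝓝 Z) := by
  have hne : ¬ ∀ᶠ t in 𝓝 (0 : ℝ), X t = 0 := by
    intro h0
    have h1 : Tendsto (fun t => ‖t ^ (-ν) • X t‖) (𝓝[>] 0) (𝓝 0) := by
      refine tendsto_const_nhds.congr' ?_
      filter_upwards [nhdsWithin_le_nhds h0] with t ht
      rw [ht, smul_zero, norm_zero]
    exact hp.ne' (tendsto_nhds_unique hlim h1)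
  -- The curve is not identically zero near $0$, so it factors as $t^nZ(t)$ with $Z(0)\ne0$.
  obtain ⟨n, Z, hZ, hZ0, hXZ⟩ := hX.exists_eventuallyEq_pow_smul_nonzero_iff.2 hne
  have hZlim : Tendsto Z (𝓝[>] 0) (𝓝 (Z 0)) := hZ.continuousAt.tendsto.mono_left nhdsWithin_le_nhds
  have hZn : 0 < ‖Z 0‖ := norm_pos_iff.2 hZ0
  have hXZ' : ∀ᶠ t in 𝓝[>] (0 : ℝ), t ^ (-ν) • X t = t ^ ((n : ℝ) - ν) • Z t := by
    filter_upwards [nhdsWithin_le_nhds hXZ, self_mem_nhdsWithin] with t ht ht0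
    rw [ht, sub_zero, smul_smul, ← Real.rpow_natCast, ← Real.rpow_add ht0]
    ring_nf
  have hpow : Tendsto (fun t : ℝ => t ^ ((n : ℝ) - ν)) (𝓝[>] 0) (𝓝 (p / ‖Z 0‖)) := by
    refine (hlim.div hZlim.norm hZn.ne').congr' ?_
    filter_upwards [hXZ', self_mem_nhdsWithin,
      hZlim.eventually (isOpen_ne.mem_nhds hZ0)] with t ht ht0 htZ
    have ht0' : (0 : ℝ) < t := ht0
    rw [Pi.div_apply, ht, norm_smul, Real.norm_of_nonneg (by positivity),
      mul_div_cancel_right₀ _ (norm_ne_zero_iff.2 htZ)]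
  have hq : p / ‖Z 0‖ ≠ 0 := by positivity
  -- The power $t^{n-\nu}$ has a finite nonzero limit, which excludes both $n<\nu$ and $n>\nu$.
  have hn : (n : ℝ) = ν := by
    rcases lt_trichotomy (n : ℝ) ν with h | h | h
    · exfalso
      have h1 := (tendsto_rpow_nhdsGT_zero (sub_pos.2 h)).mul hpow
      rw [zero_mul] at h1
      have h2 : Tendsto (fun t : ℝ => t ^ (ν - n) * t ^ ((n : ℝ) - ν)) (𝓝[>] 0) (𝓝 1) := by
        refine tendsto_const_nhds.congr' ?_
        filter_upwards [self_mem_nhdsWithin] with t ht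
        rw [← Real.rpow_add ht]
        simp
      exact one_ne_zero (tendsto_nhds_unique h2 h1)
    · exact h
    · exact absurd (tendsto_nhds_unique hpow (tendsto_rpow_nhdsGT_zero (sub_pos.2 h))) hq
  refine ⟨Z 0, hZlim.congr' ?_⟩
  filter_upwards [hXZ'] with t ht
  rw [ht, hn, sub_self, Real.rpow_zero, one_smul]

open scoped Classical in
/-- If two eigenvalues `±μ` of an analytic curve of self-adjoint operators satisfy
`t^{-ν} μ → p > 0` and the others stay away from `0`, the part of the curve in these eigenspaces,
divided by `t^ν`, converges. -/
lemma exists_tendsto_smul_diagOp {M : ℝ → Fiber s →L[ℂ] Fiber s} (hM : AnalyticAt ℝ M 0)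
    {b : ℝ → OrthonormalBasis (Fin s) ℂ (Fiber s)} {μ : ℝ → Fin s → ℝ}
    (hb : ∀ t, M t = diagOp (b t) fun k => (μ t k : ℂ)) {i j : Fin s} {ν p ε : ℝ}
    (hν : 0 < ν) (hp : 0 < p) (hε : 0 < ε)
    (hij : ∀ᶠ t in 𝓝[>] (0 : ℝ), μ t i = -μ t j) (hj : ∀ᶠ t in 𝓝[>] (0 : ℝ), 0 < μ t j)
    (hgap : ∀ᶠ t in 𝓝[>] (0 : ℝ), ∀ k, k ≠ i → k ≠ j → ε ≤ |μ t k|)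
    (hlim : Tendsto (fun t => t ^ (-ν) * μ t j) (𝓝[>] 0) (𝓝 p)) :
    ∃ Z, Tendsto (fun t => t ^ (-ν) •
      diagOp (b t) fun k => if k = i ∨ k = j then (μ t k : ℂ) else 0) (𝓝[>] 0) (𝓝 Z) := by
  -- The plan is to replace the non-analytic spectral cutoff by the analytic operator $q(M)^{r+1}$:
  -- near $0$ the polynomial is close to $1$, and it is small at the eigenvalues that stay away from
  -- $0$.
  obtain ⟨q, hq0, hq⟩ := exists_polynomial_eval fun k => (μ 0 k : ℂ)
  -- With $r+1>\nu$, a contribution $O(t^{r+1})$ is negligible after division by $t^\nu$.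
  set r := ⌈ν⌉₊ with hr
  have hrν : 0 < (r : ℝ) + 1 - ν := by
    have := Nat.le_ceil ν
    rw [← hr] at this
    linarith
  let N : ℝ → Fiber s →L[ℂ] Fiber s := fun t => Polynomial.aeval (M t) q
  have hN : AnalyticAt ℝ N 0 := analyticAt_aeval hM q
  have hNd : ∀ t, N t = diagOp (b t) fun k => q.eval (μ t k : ℂ) := fun t => by
    simp only [N]
    rw [hb t, aeval_diagOp]
  have hWd : ∀ t, M t * N t = diagOp (b t) fun k => (μ t k : ℂ) * q.eval (μ t k : ℂ) := fun t => by
    rw [hNd, hb t, ← diagHom_apply, ← diagHom_apply, ← map_mul]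
    rfl
  have hXd : ∀ t, M t * N t ^ (r + 1) =
      diagOp (b t) fun k => (μ t k : ℂ) * q.eval (μ t k : ℂ) ^ (r + 1) := fun t => by
    rw [hNd, hb t, ← diagHom_apply, ← diagHom_apply, ← map_pow, ← map_mul]
    rfl
  have hX : AnalyticAt ℝ (fun t => M t * N t ^ (r + 1)) 0 := hM.mul (hN.pow _)
  -- The curve $M\,q(M)$ is differentiable and vanishes at $t=0$, so its norm, and with it every
  -- $|\mu_kq(\mu_k)|$, is $O(t)$. For the eigenvalues with $|\mu_k|\ge\varepsilon$ this gives
  -- $|q(\mu_k)|=O(t)$.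
  obtain ⟨C, hC0, hC⟩ : ∃ C > 0, ∀ᶠ t in 𝓝 (0 : ℝ), ‖M t * N t‖ ≤ C * ‖t‖ := by
    have h1 := (hM.mul hN).differentiableAt.isBigO_sub
    have h0 : M 0 * N 0 = 0 := by
      rw [hWd]
      refine clm_ext_basis (b 0) fun k => ?_
      rw [diagOp_basis, hq, zero_smul, zero_apply]
    obtain ⟨C, hC0, hC⟩ := h1.exists_pos
    refine ⟨C, hC0, ?_⟩
    filter_upwards [hC.bound] with t ht
    simpa [h0] using ht
  let Y : ℝ → Fiber s →L[ℂ] Fiber s := fun t => t ^ (-ν) •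
    diagOp (b t) fun k => if k = i ∨ k = j then (μ t k : ℂ) else 0
  have hYd : ∀ t, Y t = diagOp (b t) fun k =>
      ((t ^ (-ν) : ℝ) : ℂ) * if k = i ∨ k = j then (μ t k : ℂ) else 0 := fun t =>
    clm_ext_basis (b t) fun k => by
      simp only [Y]
      rw [smul_apply, diagOp_basis, diagOp_basis, mul_smul]
      rfl
  have hX'd : ∀ t, t ^ (-ν) • (M t * N t ^ (r + 1)) = diagOp (b t) fun k =>
      ((t ^ (-ν) : ℝ) : ℂ) * ((μ t k : ℂ) * q.eval (μ t k : ℂ) ^ (r + 1)) := fun t =>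
    clm_ext_basis (b t) fun k => by
      rw [hXd, smul_apply, diagOp_basis, diagOp_basis, mul_smul _ (_ * _)]
      rfl
  have hYn : Tendsto (fun t => ‖Y t‖) (𝓝[>] 0) (𝓝 p) := by
    refine hlim.congr' ?_
    filter_upwards [hij, hj, self_mem_nhdsWithin] with t ht htj ht0
    have ht0' : (0 : ℝ) < t := ht0
    have h1 : 0 < t ^ (-ν) * μ t j := by positivity
    refine le_antisymm ?_ ?_
    · have h2 := le_norm_diagOp (b t)
        (fun k => ((t ^ (-ν) : ℝ) : ℂ) * if k = i ∨ k = j then (μ t k : ℂ) else 0) j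
      rw [← hYd] at h2
      simp only [or_true, if_true] at h2
      rwa [← Complex.ofReal_mul, Complex.norm_real, Real.norm_of_nonneg h1.le] at h2
    · rw [hYd]
      refine norm_diagOp_le _ h1.le fun k => ?_
      split_ifs with hk
      · rw [← Complex.ofReal_mul, Complex.norm_real, Real.norm_eq_abs, abs_mul,
          abs_of_pos (by positivity)]
        rcases hk with rfl | rfl
        · rw [ht, abs_neg, abs_of_pos htj]
        · rw [abs_of_pos htj]
      · rw [mul_zero, norm_zero]
        exact h1.le
  have hμ : Tendsto (fun t => μ t j) (𝓝[>] 0) (𝓝 0) := by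
    have h1 := (tendsto_rpow_nhdsGT_zero hν).mul hlim
    rw [zero_mul] at h1
    refine h1.congr' ?_
    filter_upwards [self_mem_nhdsWithin] with t ht
    rw [← mul_assoc, ← Real.rpow_add ht, add_neg_cancel, Real.rpow_zero, one_mul]
  have hqlim : ∀ c : ℂ, Tendsto (fun t => ‖q.eval (c * (μ t j : ℂ)) ^ (r + 1) - 1‖)
      (𝓝[>] 0) (𝓝 0) := by
    intro c
    have h1 : Continuous fun x : ℝ => ‖q.eval (c * (x : ℂ)) ^ (r + 1) - 1‖ := by
      have := q.continuous
      fun_prop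
    have h2 := (h1.tendsto 0).comp hμ
    simpa [hq0, Function.comp_def] using h2
  -- On the pair the error is $t^{-\nu}|\mu|\,|q(\pm\mu)^{r+1}-1|$, which tends to $0$ since
  -- $q(0)=1$; on the other eigenvalues it is $O(t^{r+1-\nu})$.
  have hdiff : Tendsto (fun t => ‖t ^ (-ν) • (M t * N t ^ (r + 1)) - Y t‖) (𝓝[>] 0) (𝓝 0) := by
    have h1 := (hlim.mul ((hqlim 1).add (hqlim (-1)))).add
      ((tendsto_rpow_nhdsGT_zero hrν).const_mul (C * (C / ε) ^ r))
    rw [add_zero, mul_zero, mul_zero, add_zero] at h1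
    refine squeeze_zero' (Eventually.of_forall fun _ => norm_nonneg _) ?_ h1
    filter_upwards [hij, hj, hgap, nhdsWithin_le_nhds hC, self_mem_nhdsWithin] with t ht htj hg hCt ht0
    have ht0' : (0 : ℝ) < t := ht0
    have htν : 0 < t ^ (-ν) := by positivity
    rw [hX'd, hYd, ← diagHom_apply, ← diagHom_apply, ← map_sub, diagHom_apply]
    have hA : 0 ≤ t ^ (-ν) * μ t j * (‖q.eval (1 * (μ t j : ℂ)) ^ (r + 1) - 1‖ +
        ‖q.eval (-1 * (μ t j : ℂ)) ^ (r + 1) - 1‖) := by positivity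
    have hB : 0 ≤ C * (C / ε) ^ r * t ^ ((r : ℝ) + 1 - ν) := by positivity
    refine norm_diagOp_le _ (add_nonneg hA hB) fun k => ?_
    rw [Pi.sub_apply, ← mul_sub, norm_mul, Complex.norm_real, Real.norm_of_nonneg htν.le]
    by_cases hk : k = i ∨ k = j
    · rw [if_pos hk, ← mul_sub_one, norm_mul]
      refine le_trans ?_ (le_add_of_nonneg_right hB)
      rw [← mul_assoc]
      rcases hk with rfl | rfl
      · rw [ht, Complex.norm_real, norm_neg, Real.norm_of_nonneg htj.le, neg_one_mul,
          ← Complex.ofReal_neg]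
        gcongr
        exact le_add_of_nonneg_left (norm_nonneg _)
      · rw [Complex.norm_real, Real.norm_of_nonneg htj.le, one_mul]
        gcongr
        exact le_add_of_nonneg_right (norm_nonneg _)
    · rw [if_neg hk, sub_zero]
      refine le_trans ?_ (le_add_of_nonneg_left hA)
      push Not at hk
      have h2 : ‖(μ t k : ℂ) * q.eval (μ t k : ℂ)‖ ≤ C * t := by
        have h3 := le_norm_diagOp (b t) (fun k => (μ t k : ℂ) * q.eval (μ t k : ℂ)) k
        rw [← hWd] at h3
        rw [Real.norm_of_nonneg ht0'.le] at hCt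
        exact h3.trans hCt
      have h4 : ‖q.eval (μ t k : ℂ)‖ ≤ C / ε * t := by
        rw [norm_mul, Complex.norm_real, Real.norm_eq_abs] at h2
        rw [div_mul_eq_mul_div, le_div_iff₀ hε]
        nlinarith [hg k hk.1 hk.2, norm_nonneg (q.eval (μ t k : ℂ))]
      have h5 : (t : ℝ) ^ ((r : ℝ) + 1 - ν) = t ^ (-ν) * t ^ (r + 1) := by
        rw [← Real.rpow_natCast, ← Real.rpow_add ht0']
        push_cast
        ring_nf
      rw [pow_succ', ← mul_assoc, norm_mul, norm_pow, h5]
      calc t ^ (-ν) * (‖(μ t k : ℂ) * q.eval (μ t k : ℂ)‖ * ‖q.eval (μ t k : ℂ)‖ ^ r)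
          ≤ t ^ (-ν) * ((C * t) * (C / ε * t) ^ r) := by gcongr
        _ = C * (C / ε) ^ r * (t ^ (-ν) * t ^ (r + 1)) := by rw [mul_pow, pow_succ]; ring
  have hX'n : Tendsto (fun t => ‖t ^ (-ν) • (M t * N t ^ (r + 1))‖) (𝓝[>] 0) (𝓝 p) := by
    have h1 : Tendsto (fun t => ‖t ^ (-ν) • (M t * N t ^ (r + 1))‖ - ‖Y t‖) (𝓝[>] 0) (𝓝 0) :=
      squeeze_zero_norm (fun t => abs_norm_sub_norm_le _ _) hdiff
    simpa using h1.add hYn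
  obtain ⟨Z, hZ⟩ := exists_tendsto_rpow_smul hX hp hX'n
  refine ⟨Z, ?_⟩
  have h1 := hZ.sub (tendsto_zero_iff_norm_tendsto_zero.2 hdiff)
  simpa [Y] using h1

end Curve

/-! ### The characteristic roots near the reference point -/

section Limits

variable {d s : ℕ}

lemma tendsto_of_tendsto_iteratedFDeriv_zero {E F ι : Type*} [NormedAddCommGroup E]
    [NormedSpace ℝ E] [NormedAddCommGroup F] [NormedSpace ℝ F] {l : Filter ι} {f : ι → E → F}
    {g : E → F} {x : E}
    (h : Tendsto (fun i => iteratedFDeriv ℝ 0 (f i) x) l (𝓝 (iteratedFDeriv ℝ 0 g x))) :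
    Tendsto (fun i => f i x) l (𝓝 (g x)) := by
  have h1 := ((continuousMultilinearCurryFin0 ℝ E F).continuous.tendsto _).comp h
  simpa [Function.comp_def] using h1

/-- Coordinates bounded by $\pi$ exclude nonzero multiples of $2\pi$. Thus uniqueness of the zero on
the torus becomes positivity of the root at every nonzero point of the cell set. -/
lemma toTorus_add_ne {η : Space d} (hη : ∀ k, |η k| ≤ Real.pi) (h0 : η ≠ 0) (d₁ : Space d) :
    toTorus (η + d₁) ≠ toTorus d₁ := by
  intro h
  apply h0
  ext k
  have h1 := congrFun h k
  simp only [toTorus, PiLp.add_apply, Real.Angle.coe_add, add_eq_right] at h1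
  obtain ⟨n, hn⟩ := Real.Angle.coe_eq_zero_iff.1 h1
  rw [zsmul_eq_mul] at hn
  by_cases hn0 : n = 0
  · rw [hn0] at hn
    simpa using hn.symm
  · have h2 : (1 : ℝ) ≤ |(n : ℝ)| := by exact_mod_cast Int.one_le_abs hn0
    have h3 := hη k
    rw [← hn, abs_mul, abs_of_pos (by positivity : 0 < 2 * Real.pi)] at h3
    nlinarith [Real.pi_pos]

namespace PeriodicGraph

variable {G : PeriodicGraph d s} {E₀ ν : ℝ} {i j : Fin s} {K₀ : Set (Torus d)} {d₁ : Space d}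
  {P : Space d → ℝ} {γ ε : ℝ}

lemma CondB1.root_pos (hB1 : G.CondB1 E₀ j K₀ d₁) {η : Space d} (hη : η ∈ cellSet K₀ d₁)
    (h0 : η ≠ 0) : 0 < G.root E₀ j (η + d₁) :=
  lt_of_le_of_ne (hB1.1 _ hη.2) fun h =>
    toTorus_add_ne hη.1 h0 d₁ (hB1.2.2.2 _ hη.2 h.symm)

lemma CondB3.tendsto_localRoot (hB3 : G.CondB3 E₀ ν j K₀ d₁ P γ) {ξ : Space d} (hξ : ξ ≠ 0) :
    Tendsto (fun h => G.localRoot E₀ ν j d₁ h ξ) (𝓝[>] 0) (𝓝 (P ξ)) :=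
  tendsto_of_tendsto_iteratedFDeriv_zero (hB3.2.2.2.1 ξ hξ 0)

lemma CondB4.tendsto_localProj {J : Finset (Fin s)} {Pr₀ : Space d → Fiber s →L[ℂ] Fiber s}
    (hB4 : G.CondB4 E₀ ν J d₁ Pr₀) {ξ : Space d} (hξ : ξ ≠ 0) :
    Tendsto (fun h => G.localProj E₀ ν J d₁ h ξ) (𝓝[>] 0) (𝓝 (Pr₀ ξ)) :=
  tendsto_of_tendsto_iteratedFDeriv_zero (hB4.2 ξ hξ 0)

lemma eventually_smul_mem_ball (hε : 0 < ε) (ξ : Space d) :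
    ∀ᶠ h in 𝓝[>] (0 : ℝ), h • ξ ∈ Metric.ball (0 : Space d) ε := by
  have h1 : Tendsto (fun h : ℝ => h • ξ) (𝓝[>] 0) (𝓝 0) := by
    have h2 : Continuous fun h : ℝ => h • ξ := by fun_prop
    have h3 := h2.tendsto 0
    rw [zero_smul] at h3
    exact h3.mono_left nhdsWithin_le_nhds
  exact h1.eventually (Metric.ball_mem_nhds _ hε)

lemma eventually_root_pos (hB1 : G.CondB1 E₀ j K₀ d₁) (hε : 0 < ε)
    (hεK : Metric.ball 0 ε ⊆ cellSet K₀ d₁) {ξ : Space d} (hξ : ξ ≠ 0) :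
    ∀ᶠ h in 𝓝[>] (0 : ℝ), 0 < G.root E₀ j (h • ξ + d₁) := by
  filter_upwards [eventually_smul_mem_ball hε ξ, self_mem_nhdsWithin] with h hh h0
  exact hB1.root_pos (hεK hh) (smul_ne_zero (ne_of_gt h0) hξ)

/-- For small $h$ the local root at $\xi$ is positive and at most $C^{-1}P(\xi)$. -/
lemma CondB3.pos (hB3 : G.CondB3 E₀ ν j K₀ d₁ P γ) (hB1 : G.CondB1 E₀ j K₀ d₁) (hε : 0 < ε)
    (hεK : Metric.ball 0 ε ⊆ cellSet K₀ d₁) {ξ : Space d} (hξ : ξ ≠ 0) : 0 < P ξ := by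
  obtain ⟨C, hC, h₀, hh₀, hCP⟩ := hB3.2.2.2.2
  obtain ⟨h, hpos, hmem, hh⟩ := ((eventually_root_pos hB1 hε hεK hξ).and
    ((eventually_smul_mem_ball hε ξ).and (Ioo_mem_nhdsGT hh₀))).exists
  have h1 := (hCP h hh ξ hξ (hεK hmem)).2
  rw [G.localRoot_eq E₀ ν d₁ hh.1] at h1
  have h2 : 0 < h ^ (-ν) * G.root E₀ j (h • ξ + d₁) :=
    mul_pos (Real.rpow_pos_of_pos hh.1 _) hpos
  exact pos_of_mul_pos_right (h2.trans_le h1) (inv_pos.2 hC).le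

/-- The exponent of the scaling is the degree of homogeneity of the limit. -/
lemma CondB3.exponent_eq (hB3 : G.CondB3 E₀ ν j K₀ d₁ P γ) {ξ : Space d} (hξ : ξ ≠ 0)
    (hP : 0 < P ξ) : ν = γ := by
  have h2 : (2 : ℝ) • ξ ≠ 0 := smul_ne_zero two_ne_zero hξ
  have hscale : Tendsto (fun h : ℝ => h * 2) (𝓝[>] 0) (𝓝[>] 0) := by
    refine tendsto_nhdsWithin_iff.2 ⟨?_, ?_⟩
    · have h3 : Continuous fun h : ℝ => h * 2 := by fun_prop
      have h4 := h3.tendsto 0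
      rw [zero_mul] at h4
      exact h4.mono_left nhdsWithin_le_nhds
    · filter_upwards [self_mem_nhdsWithin] with h hh
      exact mul_pos (Set.mem_Ioi.1 hh) (two_pos : (0 : ℝ) < 2)
  -- Both $P_h(2\xi)$ and $P_{2h}(\xi)$ sample the root at $2h\xi+d_1$, so $P_h(2\xi)=2^\nu
  -- P_{2h}(\xi)$. In the limit $2^\gamma P(\xi)=2^\nu P(\xi)$.
  have h3 : Tendsto (fun h => G.localRoot E₀ ν j d₁ h ((2 : ℝ) • ξ)) (𝓝[>] 0)
      (𝓝 ((2 : ℝ) ^ ν * P ξ)) := by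
    refine (((hB3.tendsto_localRoot hξ).comp hscale).const_mul ((2 : ℝ) ^ ν)).congr' ?_
    filter_upwards [self_mem_nhdsWithin] with h hh
    have hh' : (0 : ℝ) < h := hh
    rw [Function.comp_apply, G.localRoot_eq E₀ ν d₁ (mul_pos hh' two_pos),
      G.localRoot_eq E₀ ν d₁ hh', smul_smul, Real.mul_rpow hh'.le two_pos.le,
      Real.rpow_neg two_pos.le]
    have h5 : (2 : ℝ) ^ ν ≠ 0 := by positivity
    field_simp
  have h4 := tendsto_nhds_unique h3 (hB3.tendsto_localRoot h2)
  rw [hB3.2.2.1 ξ hξ 2 two_pos] at h4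
  have h5 := mul_right_cancel₀ hP.ne' h4
  exact (Real.strictMono_rpow_of_base_gt_one one_lt_two).injective h5

lemma CondB22.root_neg (hB22 : G.CondB22 E₀ i j K₀) {η : Space d} (hη : η ∈ cellSet K₀ d₁) :
    G.root E₀ i (η + d₁) = -G.root E₀ j (η + d₁) := hB22.1 _ hη.2

lemma lt_or_gt_of_ne_pair (hij : (i : ℕ) + 1 = j) {k : Fin s} (hi : k ≠ i) (hj : k ≠ j) :
    k < i ∨ j < k := by
  rw [Fin.lt_def, Fin.lt_def]
  have h1 : (k : ℕ) ≠ i := fun h => hi (Fin.ext h)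
  have h2 : (k : ℕ) ≠ j := fun h => hj (Fin.ext h)
  omega

/-- The difference of the two eigenprojections in the symmetric case converges. -/
lemma exists_tendsto_localProj_sub (hB1 : G.CondB1 E₀ j K₀ d₁) (hB3 : G.CondB3 E₀ ν j K₀ d₁ P γ)
    (hε : 0 < ε) (hεK : Metric.ball 0 ε ⊆ cellSet K₀ d₁) (hij : (i : ℕ) + 1 = j)
    (hB22 : G.CondB22 E₀ i j K₀) {ξ : Space d} (hξ : ξ ≠ 0) :
    ∃ Z, Tendsto (fun h => G.localProj E₀ ν {j} d₁ h ξ - G.localProj E₀ ν {i} d₁ h ξ)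
      (𝓝[>] 0) (𝓝 Z) := by
  classical
  have hP := hB3.pos hB1 hε hεK hξ
  have hν : 0 < ν := hB3.exponent_eq hξ hP ▸ hB3.1
  choose b hb using fun t : ℝ => G.exists_isEigenbasis E₀ (t • ξ + d₁)
  have hM : AnalyticAt ℝ (fun t : ℝ => G.shiftedOp E₀ (t • ξ + d₁)) 0 := by
    refine AnalyticAt.fun_comp (G.analyticAt_shiftedOp E₀ _) ?_
    exact (analyticAt_id.smul analyticAt_const).add analyticAt_const
  have hpos := eventually_root_pos hB1 hε hεK hξ
  have hlim : Tendsto (fun t => t ^ (-ν) * G.root E₀ j (t • ξ + d₁)) (𝓝[>] 0) (𝓝 (P ξ)) := by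
    refine (hB3.tendsto_localRoot hξ).congr' ?_
    filter_upwards [self_mem_nhdsWithin] with h hh
    exact G.localRoot_eq E₀ ν d₁ hh j ξ
  have hneg : ∀ᶠ t in 𝓝[>] (0 : ℝ), G.root E₀ i (t • ξ + d₁) = -G.root E₀ j (t • ξ + d₁) := by
    filter_upwards [eventually_smul_mem_ball hε ξ] with t ht
    exact hB22.root_neg (hεK ht)
  obtain ⟨ε₁, hε₁, ε₂, hε₂, hgap⟩ := hB22.2
  have hgap' : ∀ᶠ t in 𝓝[>] (0 : ℝ), ∀ k, k ≠ i → k ≠ j →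
      min ε₁ ε₂ ≤ |G.root E₀ k (t • ξ + d₁)| := by
    filter_upwards [eventually_smul_mem_ball hε ξ] with t ht k hki hkj
    have h1 := hgap _ (subset_closure (hεK ht).2)
    rcases lt_or_gt_of_ne_pair hij hki hkj with h2 | h2
    · have h3 := h1.1 k h2
      rw [abs_of_neg (by linarith)]
      exact (min_le_left _ _).trans (by linarith)
    · have h3 := h1.2.2.2.2 k h2
      rw [abs_of_pos (by linarith)]
      exact (min_le_right _ _).trans h3.le
  obtain ⟨Z, hZ⟩ := exists_tendsto_smul_diagOp hM hb hν hP (lt_min hε₁ hε₂) hneg hpos hgap' hlim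
  -- The convergent part of the curve equals $t^{-\nu}\lambda_j(\Pi^{(+)}-\Pi^{(-)})$, and the
  -- scalar in front tends to $P(\xi)>0$, so it can be divided out.
  refine ⟨(P ξ)⁻¹ • Z, ((hlim.inv₀ hP.ne').smul hZ).congr' ?_⟩
  filter_upwards [hpos, hneg, self_mem_nhdsWithin, hgap', eventually_smul_mem_ball hε ξ]
    with t ht htn ht0 htg htb
  have ht0' : (0 : ℝ) < t := ht0
  rw [(hb t).localProj_eq ht0', (hb t).localProj_eq ht0']
  refine clm_ext_basis (b t) fun k => ?_
  rw [smul_apply, smul_apply, sub_apply, diagOp_basis, diagOp_basis, diagOp_basis]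
  simp only [Finset.mem_singleton, exists_eq_left]
  have htν : t ^ (-ν) ≠ 0 := by positivity
  by_cases hki : k = i
  · subst hki
    have h1 : G.root E₀ j (t • ξ + d₁) ≠ G.root E₀ k (t • ξ + d₁) := by
      rw [htn]; intro h; linarith
    rw [if_pos (Or.inl rfl), if_neg h1, if_pos rfl, htn, zero_smul, zero_sub, one_smul,
      Complex.coe_smul, smul_smul, smul_smul]
    rw [show (t ^ (-ν) * G.root E₀ j (t • ξ + d₁))⁻¹ * t ^ (-ν) * -G.root E₀ j (t • ξ + d₁) = -1 by
      field_simp, neg_one_smul]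
  · by_cases hkj : k = j
    · subst hkj
      have h1 : G.root E₀ i (t • ξ + d₁) ≠ G.root E₀ k (t • ξ + d₁) := by
        rw [htn]; intro h; linarith
      rw [if_pos (Or.inr rfl), if_pos rfl, if_neg h1, zero_smul, sub_zero, one_smul,
        Complex.coe_smul, smul_smul, smul_smul]
      rw [show (t ^ (-ν) * G.root E₀ k (t • ξ + d₁))⁻¹ * t ^ (-ν) * G.root E₀ k (t • ξ + d₁) = 1 by
        field_simp, one_smul]
    · have h1 := hgap _ (subset_closure (hεK htb).2)
      have h2 : G.root E₀ j (t • ξ + d₁) ≠ G.root E₀ k (t • ξ + d₁) ∧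
          G.root E₀ i (t • ξ + d₁) ≠ G.root E₀ k (t • ξ + d₁) := by
        rcases lt_or_gt_of_ne_pair hij hki hkj with h3 | h3
        · have h4 := h1.1 k h3
          exact ⟨by intro h; linarith, by intro h; linarith⟩
        · have h4 := h1.2.2.2.2 k h3
          exact ⟨by intro h; linarith, by intro h; linarith⟩
      rw [if_neg (by tauto), if_neg h2.1, if_neg h2.2]
      simp

/-- The sum of the two projections converges by (B-4) and their difference by analyticity along
rays; half the sum and half the difference of the two limits give $\Pi_0^{(\pm)}$. -/
lemma exists_tendsto_localProj_pair (hB1 : G.CondB1 E₀ j K₀ d₁)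
    (hB3 : G.CondB3 E₀ ν j K₀ d₁ P γ) (hε : 0 < ε) (hεK : Metric.ball 0 ε ⊆ cellSet K₀ d₁)
    (hij : (i : ℕ) + 1 = j) (hB22 : G.CondB22 E₀ i j K₀)
    {Pr₀ : Space d → Fiber s →L[ℂ] Fiber s} (hB4 : G.CondB4 E₀ ν {i, j} d₁ Pr₀) :
    ∃ PrPlus PrMinus : Space d → Fiber s →L[ℂ] Fiber s, ∀ ξ ≠ 0,
      Tendsto (fun h => G.localProj E₀ ν {j} d₁ h ξ) (𝓝[>] 0) (𝓝 (PrPlus ξ)) ∧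
      Tendsto (fun h => G.localProj E₀ ν {i} d₁ h ξ) (𝓝[>] 0) (𝓝 (PrMinus ξ)) ∧
      PrPlus ξ + PrMinus ξ = Pr₀ ξ := by
  choose! Z hZ using fun (ξ : Space d) (hξ : ξ ≠ 0) =>
    exists_tendsto_localProj_sub hB1 hB3 hε hεK hij hB22 hξ
  refine ⟨fun ξ => (2⁻¹ : ℂ) • (Pr₀ ξ + Z ξ), fun ξ => (2⁻¹ : ℂ) • (Pr₀ ξ - Z ξ), fun ξ hξ =>
    ⟨?_, ?_, ?_⟩⟩
  · refine (((hB4.tendsto_localProj hξ).add (hZ ξ hξ)).const_smul (2⁻¹ : ℂ)).congr' ?_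
    filter_upwards [eventually_root_pos hB1 hε hεK hξ, eventually_smul_mem_ball hε ξ,
      self_mem_nhdsWithin] with h hpos hb hh
    rw [G.localProj_pair E₀ ν d₁ hh (by rw [hB22.root_neg (hεK hb)]; intro h; linarith)]
    module
  · refine (((hB4.tendsto_localProj hξ).sub (hZ ξ hξ)).const_smul (2⁻¹ : ℂ)).congr' ?_
    filter_upwards [eventually_root_pos hB1 hε hεK hξ, eventually_smul_mem_ball hε ξ,
      self_mem_nhdsWithin] with h hpos hb hh
    rw [G.localProj_pair E₀ ν d₁ hh (by rw [hB22.root_neg (hεK hb)]; intro h; linarith)]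
    module
  · module

end PeriodicGraph

end Limits

/-! ### The continuum limit -/

section Interpolation

variable {d s : ℕ}

lemma ae_ne_zero (hd : 0 < d) : ∀ᵐ ξ : Space d, ξ ≠ 0 := by
  have : Nontrivial (Space d) :=
    Module.nontrivial_of_finrank_pos (R := ℝ) (by rw [finrank_euclideanSpace_fin]; exact hd)
  rw [ae_iff]
  simp

/-- Continuity extends the vanishing to the boundary sphere, so that the cutoff is zero off the open
ball on which the spectral gap is available. -/
lemma eq_zero_of_le_norm {χ : Space d → ℝ} (hχ : Continuous χ) {r : ℝ} (hr : 0 < r)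
    (h0 : ∀ ξ, r < ‖ξ‖ → χ ξ = 0) {ξ : Space d} (hξ : r ≤ ‖ξ‖) : χ ξ = 0 := by
  have h1 : (Metric.closedBall (0 : Space d) r)ᶜ ⊆ χ ⁻¹' {0} := by
    intro x hx
    refine h0 x ?_
    simpa using hx
  have h2 := closure_minimal h1 ((isClosed_singleton (x := (0 : ℝ))).preimage hχ)
  rw [closure_compl, interior_closedBall _ hr.ne'] at h2
  exact h2 (by simpa using hξ)

lemma exists_abs_le {χ : Space d → ℝ} (hχ : Continuous χ) {r : ℝ}
    (h0 : ∀ ξ, r < ‖ξ‖ → χ ξ = 0) : ∃ C : NNReal, ∀ ξ, ‖χ ξ‖ ≤ C := by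
  have hc : HasCompactSupport χ := HasCompactSupport.intro (isCompact_closedBall (0 : Space d) r)
    fun x hx => h0 x (by simpa using hx)
  obtain ⟨C, hC⟩ := hc.exists_bound_of_continuous hχ
  exact ⟨C.toNNReal, fun ξ => (hC ξ).trans (Real.le_coe_toNNReal C)⟩

namespace PeriodicGraph

variable (G : PeriodicGraph d s)

/-- The eigenvalues with index in `J` are separated from the others on a punctured ball. -/
def HasGap (E₀ : ℝ) (J : Finset (Fin s)) (d₁ : Space d) (r : ℝ) : Prop :=
  ∃ a c : ℝ, a < c ∧ ∀ η : Space d, ‖η‖ < r → η ≠ 0 →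
    (∀ k ∈ J, a < G.root E₀ k (η + d₁) ∧ G.root E₀ k (η + d₁) < c) ∧
    ∀ k ∉ J, G.root E₀ k (η + d₁) < a ∨ c < G.root E₀ k (η + d₁)

/-- The operator `χ(hξ) Π_h(ξ) R_h(ξ)`. -/
def cutoffProj (E₀ ν : ℝ) (J : Finset (Fin s)) (d₁ : Space d) (χ : Space d → ℝ)
    (R : ℝ → Space d → Fiber s →L[ℂ] Fiber s) (h : ℝ) (ξ : Space d) : Fiber s →L[ℂ] Fiber s :=
  (χ (h • ξ) : ℂ) • (G.localProj E₀ ν J d₁ h ξ * R h ξ)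

variable {G}

/-- The spectral gap gives measurability of the projection on the punctured ball, and the cutoff
vanishes outside the ball. The bound is the product of those of $\chi$, the projection and $R_h$.
For fixed $\xi$ and small $h$ one has $\chi(h\xi)=1$, so the limit is unaffected by the cutoff. -/
lemma exists_cellFamily_cutoffProj (hd : 0 < d) {E₀ ν : ℝ} {J : Finset (Fin s)} {d₁ : Space d}
    {χ : Space d → ℝ} (hχ : Continuous χ) {r : ℝ} (hr : 0 < r) (hχ1 : ∀ ξ, ‖ξ‖ < r → χ ξ = 1)
    (hχ0 : ∀ ξ, 2 * r < ‖ξ‖ → χ ξ = 0) (hgap : G.HasGap E₀ J d₁ (2 * r))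
    {R : ℝ → Space d → Fiber s →L[ℂ] Fiber s} (hR : ∀ h > 0, Continuous (R h)) {C : NNReal}
    (hC : ∀ h > 0, ∀ ξ, ‖R h ξ‖ ≤ C) {A₀ : Space d → Fiber s →L[ℂ] Fiber s}
    (hA₀ : ∀ ξ ≠ 0, Tendsto (fun h => G.localProj E₀ ν J d₁ h ξ * R h ξ) (𝓝[>] 0) (𝓝 (A₀ ξ))) :
    ∃ B, CellFamily (G.cutoffProj E₀ ν J d₁ χ R) A₀ B := by
  obtain ⟨D, hD⟩ := exists_abs_le hχ hχ0
  refine ⟨D * (1 * C), ⟨fun h hh => ?_, fun h hh ξ => ?_, ?_⟩⟩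
  · obtain ⟨a, c, hac, hg⟩ := hgap
    let U : Set (Space d) := {ξ | ‖h • ξ‖ < 2 * r} ∩ {0}ᶜ
    have hU : MeasurableSet U := by
      refine MeasurableSet.inter ?_ (measurableSet_singleton 0).compl
      exact (isOpen_lt (by fun_prop) continuous_const).measurableSet
    have hU' : ∀ ξ ∈ U, ‖h • ξ‖ < 2 * r ∧ h • ξ ≠ 0 := fun ξ hξ =>
      ⟨hξ.1, smul_ne_zero (ne_of_gt hh) hξ.2⟩
    have hm := G.aestronglyMeasurable_localProj E₀ ν d₁ hh hU hac
      (fun ξ hξ => (hg _ (hU' ξ hξ).1 (hU' ξ hξ).2).1)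
      (fun ξ hξ => (hg _ (hU' ξ hξ).1 (hU' ξ hξ).2).2)
    have hχh : Continuous fun ξ : Space d => (χ (h • ξ) : ℂ) := by fun_prop
    have hm2 : AEStronglyMeasurable (G.cutoffProj E₀ ν J d₁ χ R h) (volume.restrict U) :=
      hχh.aestronglyMeasurable.smul (hm.mul (hR h hh).aestronglyMeasurable)
    refine AEStronglyMeasurable.restrict ?_
    refine ((aestronglyMeasurable_indicator_iff hU).2 hm2).congr ?_
    filter_upwards [ae_ne_zero hd] with ξ hξ
    by_cases hξU : ξ ∈ U
    · rw [Set.indicator_of_mem hξU]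
    · have h1 : 2 * r ≤ ‖h • ξ‖ := by
        by_contra h2
        exact hξU ⟨not_le.1 h2, hξ⟩
      rw [Set.indicator_of_notMem hξU, cutoffProj, eq_zero_of_le_norm hχ (by positivity) hχ0 h1,
        Complex.ofReal_zero]
      exact (zero_smul ℂ (G.localProj E₀ ν J d₁ h ξ * R h ξ)).symm
  · refine enorm_le_coe.2 ?_
    change ‖G.cutoffProj E₀ ν J d₁ χ R h ξ‖ ≤ (D : ℝ) * (1 * C)
    rw [cutoffProj, norm_smul, Complex.norm_real]
    gcongr
    · exact hD _
    · refine (norm_mul_le _ _).trans ?_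
      gcongr
      · exact G.norm_localProj_le E₀ ν J d₁ h ξ
      · exact hC h hh ξ
  · filter_upwards [ae_ne_zero hd] with ξ hξ
    refine (hA₀ ξ hξ).congr' ?_
    filter_upwards [eventually_smul_mem_ball hr ξ] with h hh
    rw [cutoffProj, hχ1 _ (by simpa using hh), Complex.ofReal_one, one_smul]

variable {E₀ ν : ℝ} {i j : Fin s} {K₀ : Set (Torus d)} {d₁ : Space d} {P : Space d → ℝ} {γ r : ℝ}

lemma CondB21.hasGap (hB21 : G.CondB21 E₀ j K₀) (hr : Metric.ball 0 r ⊆ cellSet K₀ d₁) :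
    G.HasGap E₀ {j} d₁ r := by
  obtain ⟨ε₁, hε₁, ε₂, hε₂, hg⟩ := hB21
  refine ⟨-ε₁, ε₂, by linarith, fun η hη _ => ?_⟩
  have h1 := hg _ (subset_closure (hr (mem_ball_zero_iff.2 hη)).2)
  refine ⟨fun k hk => ?_, fun k hk => ?_⟩
  · rw [Finset.mem_singleton.1 hk]
    exact ⟨h1.2.1, h1.2.2.1⟩
  · rcases lt_or_gt_of_ne (fun h => hk (Finset.mem_singleton.2 h)) with h2 | h2
    · exact Or.inl (h1.1 k h2)
    · exact Or.inr (h1.2.2.2 k h2)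

lemma CondB22.hasGap_pair (hB22 : G.CondB22 E₀ i j K₀) (hij : (i : ℕ) + 1 = j)
    (hr : Metric.ball 0 r ⊆ cellSet K₀ d₁) : G.HasGap E₀ {i, j} d₁ r := by
  obtain ⟨-, ε₁, hε₁, ε₂, hε₂, hg⟩ := hB22
  refine ⟨-ε₁, ε₂, by linarith, fun η hη _ => ?_⟩
  have h1 := hg _ (subset_closure (hr (mem_ball_zero_iff.2 hη)).2)
  refine ⟨fun k hk => ?_, fun k hk => ?_⟩
  · rcases Finset.mem_insert.1 hk with rfl | hk
    · exact ⟨h1.2.1, h1.2.2.1.trans_lt h1.2.2.2.1⟩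
    · rw [Finset.mem_singleton.1 hk]
      exact ⟨h1.2.1.trans_le h1.2.2.1, h1.2.2.2.1⟩
  · simp only [Finset.mem_insert, Finset.mem_singleton, not_or] at hk
    rcases lt_or_gt_of_ne_pair hij hk.1 hk.2 with h2 | h2
    · exact Or.inl (h1.1 k h2)
    · exact Or.inr (h1.2.2.2.2 k h2)

/-- Away from $d_1$ the value $0$ separates the two roots of the pair; they meet at $d_1$ itself,
which is why the gap is asked for on a punctured ball. -/
lemma CondB22.hasGap_upper (hB22 : G.CondB22 E₀ i j K₀) (hB1 : G.CondB1 E₀ j K₀ d₁)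
    (hij : (i : ℕ) + 1 = j) (hr : Metric.ball 0 r ⊆ cellSet K₀ d₁) : G.HasGap E₀ {j} d₁ r := by
  obtain ⟨ε₁, hε₁, ε₂, hε₂, hg⟩ := hB22.2
  refine ⟨0, ε₂, hε₂, fun η hη hη0 => ?_⟩
  have hmem := hr (mem_ball_zero_iff.2 hη)
  have h1 := hg _ (subset_closure hmem.2)
  have hpos := hB1.root_pos hmem hη0
  have hneg := hB22.root_neg hmem
  refine ⟨fun k hk => ?_, fun k hk => ?_⟩
  · rw [Finset.mem_singleton.1 hk]
    exact ⟨hpos, h1.2.2.2.1⟩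
  · by_cases hki : k = i
    · rw [hki]
      left
      linarith
    · rcases lt_or_gt_of_ne_pair hij hki (fun h => hk (Finset.mem_singleton.2 h)) with h2 | h2
      · left
        linarith [h1.1 k h2]
      · exact Or.inr (h1.2.2.2.2 k h2)

lemma CondB22.hasGap_lower (hB22 : G.CondB22 E₀ i j K₀) (hB1 : G.CondB1 E₀ j K₀ d₁)
    (hij : (i : ℕ) + 1 = j) (hr : Metric.ball 0 r ⊆ cellSet K₀ d₁) : G.HasGap E₀ {i} d₁ r := by
  obtain ⟨ε₁, hε₁, ε₂, hε₂, hg⟩ := hB22.2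
  refine ⟨-ε₁, 0, by linarith, fun η hη hη0 => ?_⟩
  have hmem := hr (mem_ball_zero_iff.2 hη)
  have h1 := hg _ (subset_closure hmem.2)
  have hpos := hB1.root_pos hmem hη0
  have hneg := hB22.root_neg hmem
  refine ⟨fun k hk => ?_, fun k hk => ?_⟩
  · rw [Finset.mem_singleton.1 hk]
    exact ⟨h1.2.1, by linarith⟩
  · by_cases hkj : k = j
    · rw [hkj]
      right
      linarith
    · rcases lt_or_gt_of_ne_pair hij (fun h => hk (Finset.mem_singleton.2 h)) hkj with h2 | h2
      · exact Or.inl (h1.1 k h2)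
      · right
        linarith [h1.2.2.2.2 k h2]

lemma tendsto_localProj_mul_resolventOp {k : Fin s} {z : ℂ} (hz : z.im ≠ 0) {ξ : Space d} {p : ℝ}
    {A : Fiber s →L[ℂ] Fiber s}
    (hp : Tendsto (fun h => G.localRoot E₀ ν k d₁ h ξ) (𝓝[>] 0) (𝓝 p))
    (hA : Tendsto (fun h => G.localProj E₀ ν {k} d₁ h ξ) (𝓝[>] 0) (𝓝 A)) :
    Tendsto (fun h => G.localProj E₀ ν {k} d₁ h ξ * G.resolventOp E₀ ν d₁ z h ξ) (𝓝[>] 0)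
      (𝓝 (((p : ℂ) - z)⁻¹ • A)) := by
  have h1 : Tendsto (fun h => ((G.localRoot E₀ ν k d₁ h ξ : ℂ) - z)⁻¹) (𝓝[>] 0)
      (𝓝 ((p : ℂ) - z)⁻¹) :=
    (((Complex.continuous_ofReal.tendsto p).comp hp).sub_const z).inv₀ (ofReal_sub_ne_zero hz p)
  refine (h1.smul hA).congr' ?_
  filter_upwards [self_mem_nhdsWithin] with h hh
  exact (G.localProj_singleton_comp_resolventOp E₀ ν k d₁ hh hz ξ).symm

lemma memLp_periodization {h : ℝ} (hh : 0 < h) {F : Space d → Fiber s} (hF : StronglyMeasurable F)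
    (hFi : Integrable F) (hF2 : MemLp F 2 volume)
    (h2 : ∫⁻ ξ in cell d h, ‖periodization h F ξ - F ξ‖ₑ ^ 2 < ⊤) :
    MemLp (periodization h F) 2 (volume.restrict (cell d h)) := by
  have hm : AEStronglyMeasurable (periodization h F) (volume.restrict (cell d h)) := by
    rw [← Measure.restrict_congr_set (halfOpenCell_ae_eq h)]
    exact aestronglyMeasurable_periodization hh hF hFi
  have h3 := (memLp_two_of_lintegral_sq (K := fun ξ => periodization h F ξ - F ξ)
    (hm.sub hF2.1.restrict) h2).add (hF2.restrict _)
  refine h3.ae_eq (ae_of_all _ fun ξ => ?_)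
  simp

/-- Applying the resolvent to the transformed equation expresses $\widehat u_h$ by the periodization
of `F`; the factor $(h/2\pi)^{-d/2}$ produced there cancels the one in the definition of the
interpolation. -/
lemma interpolation_eq_synthesis {z : ℂ} (hz : z.im ≠ 0) {J : Finset (Fin s)} {χ : Space d → ℝ}
    {h : ℝ} (hh : 0 < h) {u : (Fin d → ℤ) → Fiber s} {F : Space d → Fiber s}
    (hF : StronglyMeasurable F) (hFi : Integrable F)
    (hu : IsLatticeSolution G E₀ ν d₁ z (synthesis F) h u)
    (hS : MemLp (periodization h F) 2 (volume.restrict (cell d h))) :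
    interpolation G E₀ ν J d₁ χ h u = synthesis (cellMul h
      (G.cutoffProj E₀ ν J d₁ χ (G.resolventOp E₀ ν d₁ z) h) (periodization h F)) := by
  funext x
  have h1 := G.symbolOp_discFourier_ae_eq hh hu hS (integral_exp_periodization hh hF hFi)
  have h2 : ∀ ξ, Complex.exp (Complex.I * (inner ℝ x ξ : ℂ)) • cellMul h
      (G.cutoffProj E₀ ν J d₁ χ (G.resolventOp E₀ ν d₁ z) h) (periodization h F) ξ =
      (cell d h).indicator (fun ξ => Complex.exp (Complex.I * (inner ℝ x ξ : ℂ)) •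
        G.cutoffProj E₀ ν J d₁ χ (G.resolventOp E₀ ν d₁ z) h ξ (periodization h F ξ)) ξ := by
    intro ξ
    by_cases hξ : ξ ∈ cell d h <;> simp [cellMul, hξ]
  rw [synthesis]
  simp only [h2]
  rw [integral_indicator (measurableSet_cell h), interpolation, ← integral_smul]
  refine integral_congr_ae ?_
  filter_upwards [h1] with ξ hξ
  have h3 : discFourier h u ξ = (((modeConst d h)⁻¹ : ℝ) : ℂ) •
      G.resolventOp E₀ ν d₁ z h ξ (periodization h F ξ) := by
    rw [← map_smul, ← hξ, G.resolventOp_apply_sub E₀ ν d₁ hh hz]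
  have h4 : (modeConst d h : ℂ) * (((modeConst d h)⁻¹ : ℝ) : ℂ) = 1 := by
    rw [← Complex.ofReal_mul, mul_inv_cancel₀ (modeConst_pos hh).ne', Complex.ofReal_one]
  rw [h3, map_smul, smul_comm _ (((modeConst d h)⁻¹ : ℝ) : ℂ), smul_comm _ (((modeConst d h)⁻¹ : ℝ) : ℂ)]
  change (modeConst d h : ℂ) • _ = _
  rw [smul_smul, h4, one_smul]
  rfl

/-- The interpolations of the lattice solutions converge to the Fourier integral of the limit
multiplier. -/
lemma convergesTo_interpolation {z : ℂ} (hz : z.im ≠ 0) {J : Finset (Fin s)} {χ : Space d → ℝ}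
    {N : ℕ} (hN : d < 2 * N) {F : Space d → Fiber s} (hF : StronglyMeasurable F)
    (hFi : Integrable F) (hFN : weightedEnergy N F < ⊤)
    {u : ℝ → (Fin d → ℤ) → Fiber s} {h₀ : ℝ} (hh₀ : 0 < h₀)
    (hu : ∀ h ∈ Set.Ioo 0 h₀, IsLatticeSolution G E₀ ν d₁ z (synthesis F) h (u h))
    {A₀ : Space d → Fiber s →L[ℂ] Fiber s} {B : NNReal}
    (hA : CellFamily (G.cutoffProj E₀ ν J d₁ χ (G.resolventOp E₀ ν d₁ z)) A₀ B) :
    ConvergesTo (fun h => interpolation G E₀ ν J d₁ χ h (u h))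
      (synthesis fun ξ => A₀ ξ (F ξ)) := by
  have hF2 := memLp_two_of_weightedEnergy hF.aestronglyMeasurable hFN
  have hS1 := tendsto_lintegral_periodization_sub hF hFi
  have hS2 := tendsto_lintegral_periodization_sub_sq hN hF hFi hFN
  have hSm : ∀ h > 0, AEStronglyMeasurable (periodization h F) (volume.restrict (cell d h)) := by
    intro h hh
    rw [← Measure.restrict_congr_set (halfOpenCell_ae_eq h)]
    exact aestronglyMeasurable_periodization hh hF hFi
  have hS : ∀ᶠ h in 𝓝[>] 0, MemLp (periodization h F) 2 (volume.restrict (cell d h)) := by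
    filter_upwards [self_mem_nhdsWithin, hS2.eventually (gt_mem_nhds one_pos)] with h hh h2
    exact memLp_periodization hh hF hFi hF2 (h2.trans ENNReal.one_lt_top)
  have hF2' : ∫⁻ ξ, ‖F ξ‖ₑ ^ 2 ≠ ⊤ := by
    have := (eLpNorm_lt_top_iff_lintegral_rpow_enorm_lt_top (by norm_num) (by norm_num)).1 hF2.2
    simpa using this.ne
  refine convergesTo_synthesis (K := fun h => cellMul h
    (G.cutoffProj E₀ ν J d₁ χ (G.resolventOp E₀ ν d₁ z) h) (periodization h F))
    ?_ (memLp_one_iff_integrable.1 (hA.memLp_lim (memLp_one_iff_integrable.2 hFi)))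
    (hA.memLp_lim hF2) ?_ ?_ ?_
  · filter_upwards [self_mem_nhdsWithin, hS] with h hh h2
    exact ⟨memLp_one_iff_integrable.1 (hA.memLp_cellMul hh (h2.mono_exponent (by norm_num))),
      hA.memLp_cellMul hh h2⟩
  · simpa using hA.tendsto_lintegral_sub one_ne_zero hF.aestronglyMeasurable
      (by simpa using hFi.2.ne) hSm (by simpa using hS1)
  · exact hA.tendsto_lintegral_sub two_ne_zero hF.aestronglyMeasurable hF2' hSm hS2
  · filter_upwards [Ioo_mem_nhdsGT hh₀, hS] with h hh h2
    exact interpolation_eq_synthesis hz hh.1 hF hFi (hu h hh) h2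

/-- The limit equation for one eigenprojection. -/
lemma exists_isUniqueL2Solution {z : ℂ} (hz : z.im ≠ 0) {p : Space d → ℝ}
    {Pr : Space d → Fiber s →L[ℂ] Fiber s} {F f : Space d → Fiber s} (hFi : Integrable F)
    (hF2 : MemLp F 2 volume) (hFf : ∀ᵐ ξ, fourierCont f ξ = (twoPiPow d : ℂ) • F ξ)
    {A A' : ℝ → Space d → Fiber s →L[ℂ] Fiber s} {B B' : NNReal} (hA : CellFamily A Pr B)
    (hA' : CellFamily A' (fun ξ => ((p ξ : ℂ) - z)⁻¹ • Pr ξ) B') :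
    ∃ (hW1 : Integrable fun ξ => (((p ξ : ℂ) - z)⁻¹ • Pr ξ) (F ξ))
      (hW2 : MemLp (fun ξ => (((p ξ : ℂ) - z)⁻¹ • Pr ξ) (F ξ)) 2 volume)
      (g : Lp (Fiber s) 2 (volume : Measure (Space d))),
      (∀ᵐ ξ, fourierL2 g ξ = Pr ξ (fourierCont f ξ)) ∧
      IsUniqueL2Solution p z g ((memLp_synthesis hW1 hW2).toLp _) := by
  have hK1 := memLp_one_iff_integrable.1 (hA.memLp_lim (memLp_one_iff_integrable.2 hFi))
  have hK2 := hA.memLp_lim hF2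
  have hW1 := memLp_one_iff_integrable.1 (hA'.memLp_lim (memLp_one_iff_integrable.2 hFi))
  have hW2 := hA'.memLp_lim hF2
  refine ⟨hW1, hW2, (memLp_synthesis hK1 hK2).toLp _, ?_,
    isUniqueL2Solution_synthesis hz hK1 hK2 hW1 hW2 (ae_of_all _ fun ξ => ?_)⟩
  · filter_upwards [fourierL2_toLp_synthesis hK1 hK2, hFf] with ξ h1 h2
    rw [h1, h2, map_smul]
  · rw [smul_apply, smul_smul, mul_inv_cancel₀ (ofReal_sub_ne_zero hz _), one_smul]

end PeriodicGraph

lemma synthesis_add {K L : Space d → Fiber s} (hK : Integrable K) (hL : Integrable L) :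
    synthesis (fun ξ => K ξ + L ξ) = synthesis K + synthesis L := by
  funext x
  have h1 := synthesis_sub (hK.add hL) hL x
  rw [add_sub_cancel_right] at h1
  rw [Pi.add_apply, h1, sub_add_cancel]
  rfl

end Interpolation

end ContinuumLimit

end

/-! ### The theorem: assembly of the two cases. -/

open ContinuumLimit

theorem mainTheorem4 {d s : ℕ} (hd : 2 ≤ d) (G : PeriodicGraph d s) (E₀ ν : ℝ) (j : Fin s)
    (K₀ : Set (Torus d)) (hK₀ : IsOpen K₀) (d₁ : Space d) (P : Space d → ℝ) (γ : ℝ)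
    (hB1 : G.CondB1 E₀ j K₀ d₁)
    (hB3 : G.CondB3 E₀ ν j K₀ d₁ P γ)
    (ε : ℝ) (hε : 0 < ε) (hεK : Metric.ball 0 (2 * ε) ⊆ PeriodicGraph.cellSet K₀ d₁)
    (χ : Space d → ℝ) (hχ : ContDiff ℝ ∞ χ)
    (hχ_one : ∀ ξ, ‖ξ‖ < ε → χ ξ = 1) (hχ_zero : ∀ ξ, 2 * ε < ‖ξ‖ → χ ξ = 0)
    (Pr₀ : Space d → Fiber s →L[ℂ] Fiber s)
    (m σ : ℝ) (hm : ((d / 2 : ℕ) : ℝ) + 1 < m) (hσ : (d : ℝ) + 1 < σ)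
    (f : Space d → Fiber s) (hf_cont : Continuous f) (hf : MemWeightedSobolev m σ f)
    (z : ℂ) (hz : z.im ≠ 0)
    (u : ℝ → (Fin d → ℤ) → Fiber s) (h₀ : ℝ) (hh₀ : 0 < h₀)
    (hu : ∀ h ∈ Set.Ioo 0 h₀, IsLatticeSolution G E₀ ν d₁ z f h (u h)) :
    -- case (B-2-1)
    (G.CondB21 E₀ j K₀ → G.CondB4 E₀ ν {j} d₁ Pr₀ →
      ∃ (v : Space d → Fiber s) (hv : MemLp v 2 volume),
        ConvergesTo (fun h => interpolation G E₀ ν {j} d₁ χ h (u h)) v ∧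
        ∃ g : Lp (Fiber s) 2 (volume : Measure (Space d)),
          (∀ᵐ ξ, fourierL2 g ξ = Pr₀ ξ (fourierCont f ξ)) ∧
          IsUniqueL2Solution P z g (hv.toLp v)) ∧
    -- case (B-2-2), with `i = j - 1`
    (∀ i : Fin s, (i : ℕ) + 1 = j → G.CondB22 E₀ i j K₀ → G.CondB4 E₀ ν {i, j} d₁ Pr₀ →
      ∃ (v : Space d → Fiber s) (hv : MemLp v 2 volume),
        ConvergesTo (fun h => interpolation G E₀ ν {i, j} d₁ χ h (u h)) v ∧
        ∃ PrPlus PrMinus : Space d → Fiber s →L[ℂ] Fiber s,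
          (∀ ξ ≠ 0,
            Tendsto (fun h => G.localProj E₀ ν {j} d₁ h ξ) (𝓝[>] 0) (𝓝 (PrPlus ξ)) ∧
            Tendsto (fun h => G.localProj E₀ ν {i} d₁ h ξ) (𝓝[>] 0) (𝓝 (PrMinus ξ)) ∧
            PrPlus ξ + PrMinus ξ = Pr₀ ξ) ∧
          ∃ gplus gminus vplus vminus : Lp (Fiber s) 2 (volume : Measure (Space d)),
            (∀ᵐ ξ, fourierL2 gplus ξ = PrPlus ξ (fourierCont f ξ)) ∧
            (∀ᵐ ξ, fourierL2 gminus ξ = PrMinus ξ (fourierCont f ξ)) ∧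
            hv.toLp v = vplus + vminus ∧
            IsUniqueL2Solution P z gplus vplus ∧
            IsUniqueL2Solution (fun ξ => -P ξ) z gminus vminus) := by
  have hd0 : 0 < d := by omega
  -- The least integer with $d<2N$; the hypothesis on `m` says precisely $N<m$.
  set N := d / 2 + 1 with hNdef
  have hN : d < 2 * N := by omega
  have hNm : (N : ℝ) ≤ m := by
    rw [hNdef]
    push_cast
    exact hm.le
  have hdR : (0 : ℝ) ≤ d := Nat.cast_nonneg d
  -- From here on `f` is literally the inverse Fourier integral of `F`.
  obtain ⟨F, hF, hFi, hFN, rfl, hFf⟩ :=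
    hf.exists_synthesis hN hNm (by linarith) (by linarith) hf_cont
  have hF2 := memLp_two_of_weightedEnergy hF.aestronglyMeasurable hFN
  have hχc := hχ.continuous
  have hε2 : 0 < 2 * ε := by positivity
  -- The multiplier lemma is used with $R_h=1$, giving the projections that define the sources, and
  -- with $R_h$ the resolvent, giving the solutions.
  have hOne : ∀ h > (0 : ℝ), Continuous fun _ : Space d => (1 : Fiber s →L[ℂ] Fiber s) :=
    fun _ _ => continuous_const
  have hOneB : ∀ h > (0 : ℝ), ∀ _ : Space d, ‖(1 : Fiber s →L[ℂ] Fiber s)‖ ≤ (1 : NNReal) :=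
    fun _ _ _ => ContinuousLinearMap.norm_id_le
  have hRes : ∀ h > (0 : ℝ), Continuous (G.resolventOp E₀ ν d₁ z h) :=
    fun h hh => G.continuous_resolventOp E₀ ν d₁ hh hz
  have hResB : ∀ h > (0 : ℝ), ∀ ξ, ‖G.resolventOp E₀ ν d₁ z h ξ‖ ≤ (|z.im|⁻¹).toNNReal :=
    fun h hh ξ => (G.norm_resolventOp_le E₀ ν d₁ hh hz ξ).trans (Real.le_coe_toNNReal _)
  refine ⟨fun hB21 hB4 => ?_, fun i hij hB22 hB4 => ?_⟩
  · have hgap := hB21.hasGap hεK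
    obtain ⟨B, hA⟩ := PeriodicGraph.exists_cellFamily_cutoffProj hd0 hχc hε hχ_one hχ_zero hgap hOne hOneB
      (A₀ := Pr₀) (fun ξ hξ => by simpa using hB4.tendsto_localProj hξ)
    obtain ⟨B', hA'⟩ := PeriodicGraph.exists_cellFamily_cutoffProj hd0 hχc hε hχ_one hχ_zero hgap hRes hResB
      (A₀ := fun ξ => ((P ξ : ℂ) - z)⁻¹ • Pr₀ ξ) (fun ξ hξ =>
        PeriodicGraph.tendsto_localProj_mul_resolventOp hz (hB3.tendsto_localRoot hξ) (hB4.tendsto_localProj hξ))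
    obtain ⟨hW1, hW2, g, hg, hsol⟩ :=
      PeriodicGraph.exists_isUniqueL2Solution hz hFi hF2 hFf hA hA'
    exact ⟨_, memLp_synthesis hW1 hW2,
      PeriodicGraph.convergesTo_interpolation hz hN hF hFi hFN hh₀ hu hA', g, hg, hsol⟩
  · obtain ⟨PrPlus, PrMinus, hPr⟩ :=
      PeriodicGraph.exists_tendsto_localProj_pair hB1 hB3 hε2 hεK hij hB22 hB4
    have hgapj := hB22.hasGap_upper hB1 hij hεK
    have hgapi := hB22.hasGap_lower hB1 hij hεK
    have hrooti : ∀ ξ ≠ 0, Tendsto (fun h => G.localRoot E₀ ν i d₁ h ξ) (𝓝[>] 0) (𝓝 (-P ξ)) := by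
      intro ξ hξ
      refine (hB3.tendsto_localRoot hξ).neg.congr' ?_
      filter_upwards [PeriodicGraph.eventually_smul_mem_ball hε2 ξ, self_mem_nhdsWithin]
        with h hb hh
      rw [G.localRoot_eq E₀ ν d₁ hh, G.localRoot_eq E₀ ν d₁ hh, hB22.root_neg (hεK hb), mul_neg]
    have hlimj : ∀ ξ ≠ 0, Tendsto (fun h => G.localProj E₀ ν {j} d₁ h ξ *
        G.resolventOp E₀ ν d₁ z h ξ) (𝓝[>] 0) (𝓝 (((P ξ : ℂ) - z)⁻¹ • PrPlus ξ)) := fun ξ hξ =>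
      PeriodicGraph.tendsto_localProj_mul_resolventOp hz (hB3.tendsto_localRoot hξ) (hPr ξ hξ).1
    have hlimi : ∀ ξ ≠ 0, Tendsto (fun h => G.localProj E₀ ν {i} d₁ h ξ *
        G.resolventOp E₀ ν d₁ z h ξ) (𝓝[>] 0) (𝓝 ((((-P ξ : ℝ) : ℂ) - z)⁻¹ • PrMinus ξ)) := fun ξ hξ =>
      PeriodicGraph.tendsto_localProj_mul_resolventOp hz (hrooti ξ hξ) (hPr ξ hξ).2.1
    obtain ⟨B₁, hA₁⟩ := PeriodicGraph.exists_cellFamily_cutoffProj hd0 hχc hε hχ_one hχ_zero hgapj hOne hOneB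
      (A₀ := PrPlus) (fun ξ hξ => by simpa using (hPr ξ hξ).1)
    obtain ⟨B₂, hA₂⟩ := PeriodicGraph.exists_cellFamily_cutoffProj hd0 hχc hε hχ_one hχ_zero hgapi hOne hOneB
      (A₀ := PrMinus) (fun ξ hξ => by simpa using (hPr ξ hξ).2.1)
    obtain ⟨B₁', hA₁'⟩ := PeriodicGraph.exists_cellFamily_cutoffProj hd0 hχc hε hχ_one hχ_zero hgapj hRes hResB hlimj
    obtain ⟨B₂', hA₂'⟩ := PeriodicGraph.exists_cellFamily_cutoffProj hd0 hχc hε hχ_one hχ_zero hgapi hRes hResB hlimi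
    -- Convergence is proved for the pair as a whole. Its limit multiplier is the sum of the two
    -- single ones, because for small $h$ and $\xi\ne0$ the pair projection is the sum of the two
    -- eigenprojections.
    obtain ⟨B', hA'⟩ := PeriodicGraph.exists_cellFamily_cutoffProj hd0 hχc hε hχ_one hχ_zero
      (hB22.hasGap_pair hij hεK) hRes hResB
      (A₀ := fun ξ => ((P ξ : ℂ) - z)⁻¹ • PrPlus ξ + (((-P ξ : ℝ) : ℂ) - z)⁻¹ • PrMinus ξ)
      (fun ξ hξ => by
        refine ((hlimj ξ hξ).add (hlimi ξ hξ)).congr' ?_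
        filter_upwards [PeriodicGraph.eventually_root_pos hB1 hε2 hεK hξ,
          PeriodicGraph.eventually_smul_mem_ball hε2 ξ, self_mem_nhdsWithin] with h hpos hb hh
        rw [G.localProj_pair E₀ ν d₁ hh (by rw [hB22.root_neg (hεK hb)]; intro h; linarith),
          add_mul])
    obtain ⟨hV1, hV2, gplus, hgplus, hsolplus⟩ :=
      PeriodicGraph.exists_isUniqueL2Solution hz hFi hF2 hFf hA₁ hA₁'
    obtain ⟨hW1, hW2, gminus, hgminus, hsolminus⟩ :=
      PeriodicGraph.exists_isUniqueL2Solution (p := fun ξ => -P ξ) hz hFi hF2 hFf hA₂ hA₂'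
    have hconv := PeriodicGraph.convergesTo_interpolation hz hN hF hFi hFN hh₀ hu hA'
    have hadd := synthesis_add hV1 hW1
    simp only [add_apply] at hconv
    rw [hadd] at hconv
    exact ⟨_, (memLp_synthesis hV1 hV2).add (memLp_synthesis hW1 hW2), hconv, PrPlus, PrMinus, hPr,
      gplus, gminus, _, _, hgplus, hgminus, MemLp.toLp_add _ _, hsolplus, hsolminus⟩
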